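/- **Setting.** A Restricted Boltzmann Machine (RBM) with $n$ observed and $m$ latent variables is given by $J\in\mathbb R^{n\times m}$, $h\in\mathbb R^n$, $g\in\mathbb R^m$ and is the law $\mathbb P(X=x,Y=y)\propto\exp(x^TJy+h^Tx+g^Ty)$ on $\{-1,1\}^n\times\{-1,1\}^m$. The observed variables satisfy $\mathbb P(X=x)\propto e^{f(x)}$ with $f(x)=\sum_{j}\rho(J_j\cdot x+g_j)+h^Tx$, where $J_j$ is the $j$-th column of $J$ and $\rho(t)=\log(e^t+e^{-t})$. Write $f(x)=\sum_{S\subseteq[n]}\hat f(S)\prod_{i\in S}x_i$. The MRF neighborhood $N(u)$ of an observed variable $u$ is the set of $i\ne u$ for which some $S\ni u,i$ has $\hat f(S)\neq0$. Let * $D=\max_u|N(u)|$; * $\alpha=\min\{|\hat f(S)|: S\ne\emptyset,\ \hat f(S)\ne0\}$; * $\gamma=\max_u\sum_{S\ni u}|\hat f(S)|$; * $d=\max_j|\{i:J_{ij}\ne0\}|$; * $s=\max_u|\{j:\exists i\in N(u),\ J_{ij}\neq0\}|$. Assume $d\ge1$, $\gamma>0$ and $d-1\le D$ (so that no denominator below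 vanishes), and set $$\tau=\frac12\cdot\frac{4\alpha^2(e^{-2\gamma})^{d+D-1}}{d^{4d}\,2^{d+1}\binom{D}{d-1}\gamma e^{2\gamma}},\qquad \tau'=\frac1{(4d)^{2^s}}\Big(\frac1d\Big)^{2^s(2^s+1)}\tau,\qquad L=\frac8{(\tau')^2}.$$ **Algorithm.** Given samples $x^{(1)},\dots,x^{(M)}\in\{-1,1\}^n$ with empirical probabilities $\hat{\mathbb P}$, let $$\hat\nu_{u,I|S}=\frac1{2^{|I|+1}}\sum_{r\in\{\pm1\}}\sum_{G\in\{\pm1\}^I}\frac1M\sum_{k=1}^M\Big|\hat{\mathbb P}(X_u=r,X_I=G\mid X_S=x^{(k)}_S)-\hat{\mathbb P}(X_u=r\mid X_S=x^{(k)}_S)\,\hat{\mathbb P}(X_I=G\mid X_S=x^{(k)}_S)\Big|.$$ Run from an observed variable $u$, the algorithm starts with $S=\emptyset$. While $|S|\le L$ and there is $I\subseteq[n]\setminus\{u\}\setminus S$ with $|I|\le2^s$ and $\hat\nu_{u,I|S}>\tau'$, it picks such an $I$ and replaces $S$ by $S\cup I$. Then, for each $i$ in the resulting set, one after the other, it removes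 $i$ from the current $S$ if $\hat\nu_{u,\{i\}|S\setminus\{i\}}<\tau'$. It returns $S$. **Theorem.** (a) Let $\omega>0$ and let $M$ independent samples of the observed variables be given, where $$M\ \ge\ \frac{60\cdot2^{2L}}{(\tau')^2(e^{-2\gamma})^{2L}}\Big(\log(1/\omega)+\log(L+2^s+1)+(L+2^s+1)\log(2n)+\log2\Big).$$ Then with probability at least $1-\omega$, for every observed variable $u$ simultaneously, the algorithm run from $u$ returns exactly $N(u)$, whichever sets $I$ it picks and in whichever order it prunes. (b) Each run of the algorithm takes $O(MLn^{2^s+1})$ time. That is, there are a single program for a unit-cost random access machine with real-number registers and an absolute constant $C$ such that, for every such RBM, every $M\ge1$, all samples and every $u$, the program, given $n,M,u,s,\tau',L$ and read access to the samples, halts after at most $C\,M\,L\,n^{2^s+1}$ steps and returns an output of the algorithm run from $u$. -/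

import Mathlib

open Finset
open scoped BigOperators Classical

noncomputable section

/-! ### Restricted Boltzmann machines and the Markov random field of the observed variables -/

/-- The real value of a spin; `ℤˣ = {1, -1}` is the set of spins. -/
def spin (a : ℤˣ) : ℝ := ((a : ℤ) : ℝ)

/-- Parameters of an RBM with `n` observed and `m` latent variables: the interaction matrix `J` and
the external fields `h` (observed) and `g` (latent). -/
structure RBM (n m : ℕ) where
  J : Matrix (Fin n) (Fin m) ℝ
  h : Fin n → ℝ
  g : Fin m → ℝ

namespace RBM

variable {n m : ℕ}

/-- `exp (xᵀ J y + hᵀ x + gᵀ y)`. -/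
def weight (R : RBM n m) (x : Fin n → ℤˣ) (y : Fin m → ℤˣ) : ℝ :=
  Real.exp ((∑ i, ∑ j, spin (x i) * R.J i j * spin (y j))
    + (∑ i, R.h i * spin (x i)) + ∑ j, R.g j * spin (y j))

/-- `ℙ(X = x, Y = y)`. -/
def jointProb (R : RBM n m) (x : Fin n → ℤˣ) (y : Fin m → ℤˣ) : ℝ :=
  R.weight x y / ∑ x' : Fin n → ℤˣ, ∑ y' : Fin m → ℤˣ, R.weight x' y'

/-- `ℙ(X = x)`, the law of the observed variables. -/
def obsProb (R : RBM n m) (x : Fin n → ℤˣ) : ℝ := ∑ y : Fin m → ℤˣ, R.jointProb x y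

/-- The probability that `M` independent samples of the observed variables satisfy `E`. -/
def sampleProb (R : RBM n m) (M : ℕ) (E : (Fin M → Fin n → ℤˣ) → Prop) : ℝ :=
  ∑ x : Fin M → Fin n → ℤˣ with E x, ∏ k, R.obsProb (x k)

/-- The function `f` with `ℙ(X = x) ∝ exp (f x)`, namely
`f x = ∑ j, ρ (J_j ⬝ x + g_j) + hᵀ x` with `ρ t = log (eᵗ + e⁻ᵗ)`. -/
def logPotential (R : RBM n m) (x : Fin n → ℤˣ) : ℝ :=
  (∑ j, Real.log (Real.exp ((∑ i, R.J i j * spin (x i)) + R.g j)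
      + Real.exp (-((∑ i, R.J i j * spin (x i)) + R.g j))))
    + ∑ i, R.h i * spin (x i)

/-- The Fourier coefficient of `f` at `S`, so that `f x = ∑ S, fourier S * ∏ i ∈ S, x i`. -/
def fourier (R : RBM n m) (S : Finset (Fin n)) : ℝ :=
  (∑ x : Fin n → ℤˣ, R.logPotential x * ∏ i ∈ S, spin (x i)) / 2 ^ n

/-- The neighbourhood of the observed variable `u` in the MRF of the observed variables. -/
def nbhd (R : RBM n m) (u : Fin n) : Finset (Fin n) :=
  {i | i ≠ u ∧ ∃ S : Finset (Fin n), u ∈ S ∧ i ∈ S ∧ R.fourier S ≠ 0}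

/-- Maximum degree of an observed variable in the MRF. -/
def maxDegree (R : RBM n m) : ℕ := Finset.univ.sup fun u => (R.nbhd u).card

/-- Minimum absolute value of a nonzero Fourier coefficient. The constant term, which is only a
normalisation of `f`, is not a potential. -/
def minPotential (R : RBM n m) : ℝ :=
  sInf {a | ∃ S : Finset (Fin n), S.Nonempty ∧ R.fourier S ≠ 0 ∧ a = |R.fourier S|}

/-- The width `max_u ∑_{S ∋ u} |fourier S|` of the MRF. -/
def width (R : RBM n m) : ℝ := ⨆ u : Fin n, ∑ S : Finset (Fin n) with u ∈ S, |R.fourier S|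

/-- Maximum degree of a latent variable in the RBM. -/
def latentDegree (R : RBM n m) : ℕ :=
  Finset.univ.sup fun j : Fin m => (Finset.univ.filter fun i : Fin n => R.J i j ≠ 0).card

/-- Maximum number of latent variables connected to the MRF neighbourhood of an observed variable. -/
def latentCount (R : RBM n m) : ℕ :=
  Finset.univ.sup fun u : Fin n =>
    (Finset.univ.filter fun j : Fin m => ∃ i ∈ R.nbhd u, R.J i j ≠ 0).card

def tau (R : RBM n m) : ℝ :=
  1 / 2 * (4 * R.minPotential ^ 2
      * Real.exp (-2 * R.width) ^ (R.latentDegree + R.maxDegree - 1)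
    / ((R.latentDegree : ℝ) ^ (4 * R.latentDegree) * 2 ^ (R.latentDegree + 1)
      * (R.maxDegree.choose (R.latentDegree - 1) : ℝ) * R.width * Real.exp (2 * R.width)))

def tau' (R : RBM n m) : ℝ :=
  1 / (4 * (R.latentDegree : ℝ)) ^ (2 ^ R.latentCount)
    * (1 / (R.latentDegree : ℝ)) ^ (2 ^ R.latentCount * (2 ^ R.latentCount + 1)) * R.tau

def L (R : RBM n m) : ℝ := 8 / R.tau' ^ 2

/-- The required number of samples, as a function of the failure probability `ω`. -/
def sampleBound (R : RBM n m) (ω : ℝ) : ℝ :=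
  60 * (2 : ℝ) ^ (2 * R.L) / (R.tau' ^ 2 * Real.exp (-2 * R.width) ^ (2 * R.L))
    * (Real.log (1 / ω) + Real.log (R.L + 2 ^ R.latentCount + 1)
      + (R.L + 2 ^ R.latentCount + 1) * Real.log (2 * n) + Real.log 2)

end RBM

/-! ### The empirical proxy for the conditional mutual information, and the algorithm -/

/-- The empirical conditional probability `ℙ̂(A | B)`. -/
def empCond {n M : ℕ} (x : Fin M → Fin n → ℤˣ) (A B : (Fin n → ℤˣ) → Prop) : ℝ :=
  ((Finset.univ.filter fun k => A (x k) ∧ B (x k)).card : ℝ)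
    / ((Finset.univ.filter fun k => B (x k)).card : ℝ)

/-- `ν̂_{u,I|S}`: the average over uniform `r ∈ {±1}`, `G ∈ {±1}^I` and over the samples `x k` of
`|ℙ̂(X_u = r, X_I = G | X_S = (x k)_S) - ℙ̂(X_u = r | X_S = (x k)_S) ℙ̂(X_I = G | X_S = (x k)_S)|`. -/
def nuHat {n M : ℕ} (x : Fin M → Fin n → ℤˣ) (u : Fin n) (I S : Finset (Fin n)) : ℝ :=
  1 / (2 * 2 ^ I.card) * ∑ r : ℤˣ, ∑ G : I → ℤˣ, 1 / (M : ℝ) * ∑ k : Fin M,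
    |empCond x (fun z => z u = r ∧ ∀ i : I, z i = G i) (fun z => ∀ i ∈ S, z i = x k i)
      - empCond x (fun z => z u = r) (fun z => ∀ i ∈ S, z i = x k i)
        * empCond x (fun z => ∀ i : I, z i = G i) (fun z => ∀ i ∈ S, z i = x k i)|

/-- One pass of the additive loop: `|S| ≤ L`, and some `I ⊆ [n] \ {u} \ S` of size at most `2 ^ s`
with `ν̂_{u,I|S} > τ` is added to `S`. Any such `I` may be chosen. -/
def GrowStep {n M : ℕ} (s : ℕ) (τ L : ℝ) (x : Fin M → Fin n → ℤˣ) (u : Fin n)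
    (S S' : Finset (Fin n)) : Prop :=
  (S.card : ℝ) ≤ L ∧ ∃ I : Finset (Fin n),
    I ⊆ (Finset.univ \ {u}) \ S ∧ I.card ≤ 2 ^ s ∧ τ < nuHat x u I S ∧ S' = S ∪ I

/-- `S` can be the set held when the additive loop, started from `∅`, ends. -/
def IsGrown {n M : ℕ} (s : ℕ) (τ L : ℝ) (x : Fin M → Fin n → ℤˣ) (u : Fin n)
    (S : Finset (Fin n)) : Prop :=
  Relation.ReflTransGen (GrowStep s τ L x u) ∅ S ∧ ∀ S', ¬ GrowStep s τ L x u S S'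

/-- One pass of the pruning loop. -/
def pruneStep {n M : ℕ} (τ : ℝ) (x : Fin M → Fin n → ℤˣ) (u : Fin n)
    (S : Finset (Fin n)) (i : Fin n) : Finset (Fin n) :=
  if nuHat x u {i} (S \ {i}) < τ then S \ {i} else S

/-- `T` is a possible output of the greedy add-and-prune algorithm with parameters `s`, `τ`, `L`, run
on the samples `x` from the variable `u`. The pruning loop goes once through the elements of the
grown set, in any order `l`. -/
def IsOutput {n M : ℕ} (s : ℕ) (τ L : ℝ) (x : Fin M → Fin n → ℤˣ) (u : Fin n)
    (T : Finset (Fin n)) : Prop :=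
  ∃ S : Finset (Fin n), IsGrown s τ L x u S ∧
    ∃ l : List (Fin n), l.Nodup ∧ l.toFinset = S ∧ T = l.foldl (pruneStep τ x u) S

/-! ### A unit-cost random access machine with real registers -/

/-- Memory: registers holding natural numbers, registers holding real numbers, and arrays of natural
numbers. -/
structure RamState where
  nat : ℕ → ℕ
  real : ℕ → ℝ
  arr : ℕ → ℕ → ℕ

/-- Programs. The names of registers and arrays are literals of the program, so that a program uses
finitely many of them; only positions inside an array or inside the input table are computed. -/
inductive RamProg where
  | skip : RamProg
  /-- `nat[d] := c` -/
  | const (d c : ℕ) : RamProg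
  /-- `nat[d] := nat[a]` -/
  | move (d a : ℕ) : RamProg
  /-- `nat[d] := nat[a] + nat[b]` -/
  | add (d a b : ℕ) : RamProg
  /-- `nat[d] := nat[a] - nat[b]`, truncated at `0` -/
  | sub (d a b : ℕ) : RamProg
  /-- `nat[d] := arr[p][nat[i]]` -/
  | load (d p i : ℕ) : RamProg
  /-- `arr[p][nat[i]] := nat[a]` -/
  | store (p i a : ℕ) : RamProg
  /-- `nat[d] := table[nat[i]][nat[j]]`, the entry of the read-only input table -/
  | read (d i j : ℕ) : RamProg
  /-- `real[d] := nat[a]` -/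
  | cast (d a : ℕ) : RamProg
  /-- `real[d] := real[a] + real[b]` -/
  | radd (d a b : ℕ) : RamProg
  /-- `real[d] := real[a] - real[b]` -/
  | rsub (d a b : ℕ) : RamProg
  /-- `real[d] := real[a] * real[b]` -/
  | rmul (d a b : ℕ) : RamProg
  /-- `real[d] := real[a] / real[b]` -/
  | rdiv (d a b : ℕ) : RamProg
  | seq (P Q : RamProg) : RamProg
  /-- `if nat[a] < nat[b] then P else Q` -/
  | ifLt (a b : ℕ) (P Q : RamProg) : RamProg
  /-- `if real[a] < real[b] then P else Q` -/
  | ifRealLt (a b : ℕ) (P Q : RamProg) : RamProg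
  /-- `while nat[a] < nat[b] do P` -/
  | whileLt (a b : ℕ) (P : RamProg) : RamProg

/-- `RamExec table P σ σ' t`: on the input table `table`, the program `P` started in the state `σ`
halts in the state `σ'` after exactly `t` steps. Each elementary instruction and each evaluation of a
test is one step. -/
inductive RamExec (table : ℕ → ℕ → ℕ) : RamProg → RamState → RamState → ℕ → Prop
  | skip (σ : RamState) : RamExec table .skip σ σ 1
  | const (σ : RamState) (d c : ℕ) :
      RamExec table (.const d c) σ { σ with nat := Function.update σ.nat d c } 1
  | move (σ : RamState) (d a : ℕ) :
      RamExec table (.move d a) σ { σ with nat := Function.update σ.nat d (σ.nat a) } 1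
  | add (σ : RamState) (d a b : ℕ) :
      RamExec table (.add d a b) σ
        { σ with nat := Function.update σ.nat d (σ.nat a + σ.nat b) } 1
  | sub (σ : RamState) (d a b : ℕ) :
      RamExec table (.sub d a b) σ
        { σ with nat := Function.update σ.nat d (σ.nat a - σ.nat b) } 1
  | load (σ : RamState) (d p i : ℕ) :
      RamExec table (.load d p i) σ
        { σ with nat := Function.update σ.nat d (σ.arr p (σ.nat i)) } 1
  | store (σ : RamState) (p i a : ℕ) :
      RamExec table (.store p i a) σ
        { σ with arr := Function.update σ.arr p (Function.update (σ.arr p) (σ.nat i) (σ.nat a)) } 1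
  | read (σ : RamState) (d i j : ℕ) :
      RamExec table (.read d i j) σ
        { σ with nat := Function.update σ.nat d (table (σ.nat i) (σ.nat j)) } 1
  | cast (σ : RamState) (d a : ℕ) :
      RamExec table (.cast d a) σ
        { σ with real := Function.update σ.real d (σ.nat a : ℝ) } 1
  | radd (σ : RamState) (d a b : ℕ) :
      RamExec table (.radd d a b) σ
        { σ with real := Function.update σ.real d (σ.real a + σ.real b) } 1
  | rsub (σ : RamState) (d a b : ℕ) :
      RamExec table (.rsub d a b) σ
        { σ with real := Function.update σ.real d (σ.real a - σ.real b) } 1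
  | rmul (σ : RamState) (d a b : ℕ) :
      RamExec table (.rmul d a b) σ
        { σ with real := Function.update σ.real d (σ.real a * σ.real b) } 1
  | rdiv (σ : RamState) (d a b : ℕ) :
      RamExec table (.rdiv d a b) σ
        { σ with real := Function.update σ.real d (σ.real a / σ.real b) } 1
  | seq {P Q : RamProg} {σ₁ σ₂ σ₃ : RamState} {t₁ t₂ : ℕ} :
      RamExec table P σ₁ σ₂ t₁ → RamExec table Q σ₂ σ₃ t₂ →
      RamExec table (.seq P Q) σ₁ σ₃ (t₁ + t₂)
  | ifLt_pos {a b : ℕ} {P Q : RamProg} {σ σ' : RamState} {t : ℕ} :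
      σ.nat a < σ.nat b → RamExec table P σ σ' t →
      RamExec table (.ifLt a b P Q) σ σ' (t + 1)
  | ifLt_neg {a b : ℕ} {P Q : RamProg} {σ σ' : RamState} {t : ℕ} :
      ¬ σ.nat a < σ.nat b → RamExec table Q σ σ' t →
      RamExec table (.ifLt a b P Q) σ σ' (t + 1)
  | ifRealLt_pos {a b : ℕ} {P Q : RamProg} {σ σ' : RamState} {t : ℕ} :
      σ.real a < σ.real b → RamExec table P σ σ' t →
      RamExec table (.ifRealLt a b P Q) σ σ' (t + 1)
  | ifRealLt_neg {a b : ℕ} {P Q : RamProg} {σ σ' : RamState} {t : ℕ} :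
      ¬ σ.real a < σ.real b → RamExec table Q σ σ' t →
      RamExec table (.ifRealLt a b P Q) σ σ' (t + 1)
  | while_stop {a b : ℕ} {P : RamProg} {σ : RamState} :
      ¬ σ.nat a < σ.nat b → RamExec table (.whileLt a b P) σ σ 1
  | while_step {a b : ℕ} {P : RamProg} {σ₁ σ₂ σ₃ : RamState} {t₁ t₂ : ℕ} :
      σ₁.nat a < σ₁.nat b → RamExec table P σ₁ σ₂ t₁ →
      RamExec table (.whileLt a b P) σ₂ σ₃ t₂ →
      RamExec table (.whileLt a b P) σ₁ σ₃ (t₁ + t₂ + 1)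

/-- The samples as an input table: entry `(k, i)` is `1` if the `i`-th coordinate of the `k`-th
sample is `+1`, and `0` otherwise. -/
def sampleTable {n M : ℕ} (x : Fin M → Fin n → ℤˣ) (k i : ℕ) : ℕ :=
  if hk : k < M then (if hi : i < n then (if x ⟨k, hk⟩ ⟨i, hi⟩ = 1 then 1 else 0) else 0) else 0

/-- The initial state: `n`, `M`, `u`, `s` in the first registers for natural numbers, `τ` and `L` in
the first registers for real numbers, and `0` everywhere else. -/
def ramInput (n M u s : ℕ) (τ L : ℝ) : RamState where
  nat := fun r => if r = 0 then n else if r = 1 then M else if r = 2 then u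
    else if r = 3 then s else 0
  real := fun r => if r = 0 then τ else if r = 1 then L else 0
  arr := fun _ _ => 0

/-- The set of variables that a final state returns: array `0` is its indicator function. -/
def ramOutput (n : ℕ) (σ : RamState) : Finset (Fin n) := {i | σ.arr 0 i = 1}

end

/-! The proxy `nuHat` is, for disjoint `S` and `I`, the quantity `nu` of the empirical law: the mean
of `|ℙ(X_u = 1 | X_{S ∪ I}) - ℙ(X_u = 1 | X_S)|` divided by `2 ^ |I|` (`nuHat_eq_nu`). The second
moment of the conditional probability given `X_S` lies in `[0, 1]`, and adding `I` to `S` raises it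
by at least `4 ^ |I| * nu ^ 2` (`condEnergy_add_le`). So, whatever the samples are, the growing loop
never holds more than `1 / (4 τ' ^ 2) = L / 32` sites, and accuracy of the estimates is only needed
for sets of that size.

Signal. Suppose that `S` misses a neighbour of `u`. The covariance of the spin at `u` with its local
field, given `X_S`, is bounded from both sides. From below (`fieldCov_ge`): the conditional
probability given all other spins is a strictly increasing function of the local field, with a
quantitative slope, and the local field is far in mean square from every function of `X_S`, because
one of its Walsh coefficients involves the missing site. From above (`fieldCov_le`): expanding the
local field in Walsh characters of at most `d - 1` sites bounds the covariance by the width times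
the largest `nu` of such a set of neighbours. Hence some `I` of at most `d - 1` missing neighbours
has large `nu` (`exists_nu_ge`).

Reduction to `2 ^ s` sites. Given the latent variables the observed ones are independent, and only
the at most `s` latent variables attached to the neighbourhood of `u` influence the neighbours. The
deviations that define `nu` are thus moments, of products over `I`, of signed measures with at most
`2 ^ s` support points. Interpolation (`sum_abs_moment_le`) bounds such a moment by moments of
products of at most `2 ^ s` factors, at the price `(1 + 2 |I|) ^ (2 ^ s)`. This gives a set of at
most `2 ^ s` missing neighbours with `nu ≥ 2 τ'` (`exists_nu_ge_two_mul_tau'`).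

Noise. An exponential moment bound and a union bound over all patterns on few sites give estimates
of `nu` within `τ' / 4` with probability at least `1 - ω`. Written without division by cell
probabilities (`nu_eq_sum`), `nu` is stable, so no lower bound on these probabilities is needed. On
accurate samples growth cannot stop before the neighbourhood is covered. Pruning then keeps exactly
the neighbours: the proxy of a non-neighbour estimates `0` by the local Markov property, that of a
neighbour estimates at least `2 τ'`.

Running time. An odometer of `2 ^ s` digits in base `n` lists the candidates. Each proxy costs `O(M
n)` steps: a pattern on a set is encoded as one number that addresses a table of tallies, and in the
form `nu` no sum over the patterns on `I` remains. At most `min n (L / 32)` additions occur, each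
followed by a fresh search. -/

/-! ### Laws on the cube of spin configurations -/

section Laws

variable {n : ℕ}

/-- The weight of the configurations that agree with `z` on `A`. -/
noncomputable def marg (w : (Fin n → ℤˣ) → ℝ) (A : Finset (Fin n)) (z : Fin n → ℤˣ) : ℝ :=
  ∑ y, if ∀ i ∈ A, y i = z i then w y else 0

/-- Indicator function of `y u = 1`. -/
noncomputable def up (u : Fin n) (y : Fin n → ℤˣ) : ℝ := if y u = 1 then 1 else 0

/-- The conditional probability, under the law `w`, of spin `1` at `u`, given that the configuration
agrees with `z` on `A`. -/
noncomputable def condUp (w : (Fin n → ℤˣ) → ℝ) (u : Fin n) (A : Finset (Fin n))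
    (z : Fin n → ℤˣ) : ℝ :=
  marg (fun y => up u y * w y) A z / marg w A z

/-- The proxy for conditional mutual information under the law `w`. -/
noncomputable def nu (w : (Fin n → ℤˣ) → ℝ) (u : Fin n) (I S : Finset (Fin n)) : ℝ :=
  (∑ z, w z * |condUp w u (S ∪ I) z - condUp w u S z|) / 2 ^ I.card

/-- `F` is determined by the coordinates in `A`. -/
def DetBy {α : Type*} (F : (Fin n → ℤˣ) → α) (A : Finset (Fin n)) : Prop :=
  ∀ y z, (∀ i ∈ A, y i = z i) → F y = F z

theorem DetBy.mono {α : Type*} {F : (Fin n → ℤˣ) → α} {A B : Finset (Fin n)} (h : DetBy F A)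
    (hAB : A ⊆ B) : DetBy F B :=
  fun y z hyz => h y z fun i hi => hyz i (hAB hi)

theorem detBy_marg (w : (Fin n → ℤˣ) → ℝ) (A : Finset (Fin n)) : DetBy (marg w A) A := by
  intro y z h
  unfold marg
  refine Finset.sum_congr rfl fun x _ => ?_
  have : (∀ i ∈ A, x i = y i) ↔ (∀ i ∈ A, x i = z i) :=
    forall₂_congr fun i hi => by rw [h i hi]
  simp only [this]

theorem detBy_condUp (w : (Fin n → ℤˣ) → ℝ) (u : Fin n) (A : Finset (Fin n)) :
    DetBy (condUp w u A) A := by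
  intro y z h
  unfold condUp
  rw [detBy_marg _ A y z h, detBy_marg w A y z h]

theorem up_nonneg (u : Fin n) (y : Fin n → ℤˣ) : 0 ≤ up u y := by unfold up; split_ifs <;> simp
theorem up_le_one (u : Fin n) (y : Fin n → ℤˣ) : up u y ≤ 1 := by unfold up; split_ifs <;> simp
theorem marg_nonneg {w : (Fin n → ℤˣ) → ℝ} (hw : ∀ y, 0 ≤ w y) (A : Finset (Fin n))
    (z : Fin n → ℤˣ) : 0 ≤ marg w A z :=
  Finset.sum_nonneg fun y _ => by split_ifs <;> simp [hw]

theorem marg_mono {w w' : (Fin n → ℤˣ) → ℝ} (hw : ∀ y, w y ≤ w' y) (A : Finset (Fin n))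
    (z : Fin n → ℤˣ) : marg w A z ≤ marg w' A z :=
  Finset.sum_le_sum fun y _ => by split_ifs <;> simp [hw]

theorem up_mul_le {w : (Fin n → ℤˣ) → ℝ} (hw : ∀ y, 0 ≤ w y) (u : Fin n) (y : Fin n → ℤˣ) :
    up u y * w y ≤ w y :=
  mul_le_of_le_one_left (hw y) (up_le_one u y)

theorem up_mul_nonneg {w : (Fin n → ℤˣ) → ℝ} (hw : ∀ y, 0 ≤ w y) (u : Fin n) (y : Fin n → ℤˣ) :
    0 ≤ up u y * w y :=
  mul_nonneg (up_nonneg u y) (hw y)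

theorem marg_anti {w : (Fin n → ℤˣ) → ℝ} (hw : ∀ y, 0 ≤ w y) {A B : Finset (Fin n)} (hAB : A ⊆ B)
    (z : Fin n → ℤˣ) : marg w B z ≤ marg w A z := by
  refine Finset.sum_le_sum fun y _ => ?_
  by_cases h : ∀ i ∈ B, y i = z i
  · rw [if_pos h, if_pos fun i hi => h i (hAB hi)]
  · rw [if_neg h]; split_ifs <;> simp [hw]

theorem le_marg {w : (Fin n → ℤˣ) → ℝ} (hw : ∀ y, 0 ≤ w y) (A : Finset (Fin n))
    (z : Fin n → ℤˣ) : w z ≤ marg w A z := by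
  have := Finset.single_le_sum (f := fun y => if ∀ i ∈ A, y i = z i then w y else 0)
    (fun y _ => by split_ifs <;> simp [hw]) (mem_univ z)
  simpa [marg] using this

/-- On a cell of weight zero `condUp` takes the default value `0`, and the identity survives because
the numerator is dominated by the denominator. -/
theorem marg_mul_condUp {w : (Fin n → ℤˣ) → ℝ} (hw : ∀ y, 0 ≤ w y) (u : Fin n)
    (A : Finset (Fin n)) (z : Fin n → ℤˣ) :
    marg w A z * condUp w u A z = marg (fun y => up u y * w y) A z := by
  unfold condUp
  by_cases h : marg w A z = 0
  · have h1 := marg_nonneg (up_mul_nonneg hw u) A z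
    have h2 := marg_mono (up_mul_le hw u) A z
    rw [h, zero_mul]; linarith
  · field_simp

theorem condUp_nonneg {w : (Fin n → ℤˣ) → ℝ} (hw : ∀ y, 0 ≤ w y) (u : Fin n)
    (A : Finset (Fin n)) (z : Fin n → ℤˣ) : 0 ≤ condUp w u A z :=
  div_nonneg (marg_nonneg (up_mul_nonneg hw u) A z) (marg_nonneg hw A z)

theorem condUp_le_one {w : (Fin n → ℤˣ) → ℝ} (hw : ∀ y, 0 ≤ w y) (u : Fin n)
    (A : Finset (Fin n)) (z : Fin n → ℤˣ) : condUp w u A z ≤ 1 :=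
  div_le_one_of_le₀ (marg_mono (up_mul_le hw u) A z) (marg_nonneg hw A z)

theorem card_agree (A : Finset (Fin n)) (z : Fin n → ℤˣ) :
    ((univ.filter fun y : Fin n → ℤˣ => ∀ i ∈ A, z i = y i).card : ℝ) = 2 ^ n / 2 ^ A.card := by
  have h1 : (univ.filter fun y : Fin n → ℤˣ => ∀ i ∈ A, z i = y i)
      = Fintype.piFinset fun i => if i ∈ A then {z i} else univ := by
    ext y
    simp only [mem_filter, mem_univ, true_and, Fintype.mem_piFinset]
    refine forall_congr' fun i => ?_
    by_cases hi : i ∈ A <;> simp [hi, eq_comm, Int.units_eq_one_or]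
  have h2 : (Fintype.piFinset fun i => if i ∈ A then {z i} else (univ : Finset ℤˣ)).card
      * 2 ^ A.card = 2 ^ n := by
    rw [Fintype.card_piFinset]
    have : ∀ i, (if i ∈ A then {z i} else (univ : Finset ℤˣ)).card = if i ∈ A then 1 else 2 := by
      intro i; split_ifs <;> simp
    simp only [this]
    have h3 : (2 : ℕ) ^ A.card = ∏ i : Fin n, if i ∈ A then 2 else 1 := by
      rw [Finset.prod_ite_mem, univ_inter, Finset.prod_const]
    rw [h3, ← Finset.prod_mul_distrib,
      Finset.prod_congr rfl (g := fun _ => 2) (by intro i _; split_ifs <;> rfl)]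
    simp
  rw [h1, eq_div_iff (by positivity)]
  exact_mod_cast h2

/-- Exchange the sums: each `y` is counted once for every `z` that agrees with it on `A`, and `F` is
the same at both. This converts sums over cells, with repetition, into expectations. -/
theorem sum_marg_mul (w : (Fin n → ℤˣ) → ℝ) {A : Finset (Fin n)} {F : (Fin n → ℤˣ) → ℝ}
    (hF : DetBy F A) :
    ∑ z, marg w A z * F z = 2 ^ n / 2 ^ A.card * ∑ y, w y * F y := by
  unfold marg
  simp_rw [Finset.sum_mul]
  rw [Finset.sum_comm, Finset.mul_sum]
  refine Finset.sum_congr rfl fun y _ => ?_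
  have : ∀ z, (if ∀ i ∈ A, y i = z i then w y else 0) * F z
      = if ∀ i ∈ A, y i = z i then w y * F y else 0 := by
    intro z
    split_ifs with h
    · rw [hF y z h]
    · simp
  simp_rw [this]
  rw [← Finset.sum_filter, Finset.sum_const, nsmul_eq_mul, card_agree]

/-- The tower property: `condUp w u A` is the conditional expectation of `up u` given the
coordinates in `A`. -/
theorem sum_mul_condUp {w : (Fin n → ℤˣ) → ℝ} (hw : ∀ y, 0 ≤ w y) (u : Fin n)
    {A : Finset (Fin n)} {F : (Fin n → ℤˣ) → ℝ} (hF : DetBy F A) :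
    ∑ z, w z * (F z * condUp w u A z) = ∑ z, w z * (F z * up u z) := by
  have hFc : DetBy (fun z => F z * condUp w u A z) A := fun y z h => by
    simp only [hF y z h, detBy_condUp w u A y z h]
  have h1 := sum_marg_mul w hFc
  have h2 := sum_marg_mul (fun y => up u y * w y) hF
  have h3 : ∀ z, marg w A z * (F z * condUp w u A z) = marg (fun y => up u y * w y) A z * F z := by
    intro z; rw [← marg_mul_condUp hw]; ring
  simp_rw [h3] at h1
  rw [h1] at h2
  have h4 := mul_left_cancel₀ (by positivity) h2
  rw [h4]
  exact Finset.sum_congr rfl fun z _ => by ring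

theorem sum_mul_eq_marg_condUp {w : (Fin n → ℤˣ) → ℝ} (hw : ∀ y, 0 ≤ w y) (u : Fin n)
    {S T : Finset (Fin n)} (hST : S ⊆ T) :
    ∑ z, w z * |condUp w u T z - condUp w u S z|
      = 2 ^ T.card / 2 ^ n * ∑ z, |marg (fun y => up u y * w y) T z
        - marg w T z * condUp w u S z| := by
  have hF : DetBy (fun z => |condUp w u T z - condUp w u S z|) T := fun y z h => by
    simp only [detBy_condUp w u T y z h, (detBy_condUp w u S).mono hST y z h]
  have h1 := sum_marg_mul w hF
  have h3 : ∀ z, marg w T z * |condUp w u T z - condUp w u S z|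
      = |marg (fun y => up u y * w y) T z - marg w T z * condUp w u S z| := by
    intro z
    rw [← marg_mul_condUp hw, ← mul_sub, abs_mul, abs_of_nonneg (marg_nonneg hw T z)]
  simp_rw [h3] at h1
  rw [h1]
  field_simp

/-- No quotient by the weight of a cell of `S ∪ I` is left. This form is linear in mixtures of laws
apart from the fixed factor `condUp w u S z`, which serves the latent-variable argument, and it is
stable under small errors, which serves concentration. -/
theorem nu_eq_sum {w : (Fin n → ℤˣ) → ℝ} (hw : ∀ y, 0 ≤ w y) (u : Fin n)
    {I S : Finset (Fin n)} (hIS : Disjoint S I) :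
    nu w u I S = 2 ^ S.card / 2 ^ n * ∑ z, |marg (fun y => up u y * w y) (S ∪ I) z
        - marg w (S ∪ I) z * condUp w u S z| := by
  unfold nu
  rw [sum_mul_eq_marg_condUp hw u subset_union_left, card_union_of_disjoint hIS, pow_add]
  field_simp

theorem nu_nonneg {w : (Fin n → ℤˣ) → ℝ} (hw : ∀ y, 0 ≤ w y) (u : Fin n)
    (I S : Finset (Fin n)) : 0 ≤ nu w u I S :=
  div_nonneg (Finset.sum_nonneg fun z _ => mul_nonneg (hw z) (abs_nonneg _)) (by positivity)

theorem nu_empty (w : (Fin n → ℤˣ) → ℝ) (u : Fin n) (S : Finset (Fin n)) : nu w u ∅ S = 0 := by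
  simp [nu]

/-- Second moment of the conditional probability, the potential function of the greedy algorithm. -/
noncomputable def condEnergy (w : (Fin n → ℤˣ) → ℝ) (u : Fin n) (A : Finset (Fin n)) : ℝ :=
  ∑ z, w z * condUp w u A z ^ 2

theorem condEnergy_nonneg {w : (Fin n → ℤˣ) → ℝ} (hw : ∀ y, 0 ≤ w y) (u : Fin n)
    (A : Finset (Fin n)) : 0 ≤ condEnergy w u A :=
  Finset.sum_nonneg fun z _ => mul_nonneg (hw z) (sq_nonneg _)

theorem condEnergy_le_one {w : (Fin n → ℤˣ) → ℝ} (hw : ∀ y, 0 ≤ w y) (hw1 : ∑ y, w y = 1)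
    (u : Fin n) (A : Finset (Fin n)) : condEnergy w u A ≤ 1 := by
  rw [← hw1]
  refine Finset.sum_le_sum fun z _ => mul_le_of_le_one_right (hw z) ?_
  exact pow_le_one₀ (condUp_nonneg hw u A z) (condUp_le_one hw u A z)

/-- Pythagoras: `condUp` given `S` is the orthogonal projection of `condUp` given `S ∪ I`, so the
energies differ by the mean square of the difference. By Cauchy–Schwarz this is at least the square
of its mean absolute value, which is `2 ^ |I| * nu`. -/
theorem condEnergy_add_le {w : (Fin n → ℤˣ) → ℝ} (hw : ∀ y, 0 ≤ w y) (hw1 : ∑ y, w y = 1)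
    (u : Fin n) (I S : Finset (Fin n)) :
    condEnergy w u S + 4 ^ I.card * nu w u I S ^ 2 ≤ condEnergy w u (S ∪ I) := by
  set p := condUp w u S
  set q := condUp w u (S ∪ I)
  have hp : DetBy p S := detBy_condUp w u S
  have h1 : ∑ z, w z * (p z * q z) = ∑ z, w z * (p z * p z) := by
    rw [sum_mul_condUp hw u hp, sum_mul_condUp hw u (hp.mono subset_union_left)]
  have h2 : ∑ z, w z * (q z - p z) ^ 2 = condEnergy w u (S ∪ I) - condEnergy w u S := by
    have : ∀ z, w z * (q z - p z) ^ 2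
        = w z * q z ^ 2 - 2 * (w z * (p z * q z)) + w z * (p z * p z) := fun z => by ring
    simp_rw [this, Finset.sum_add_distrib, Finset.sum_sub_distrib, ← Finset.mul_sum, h1]
    have h5 : ∑ z, w z * (p z * p z) = condEnergy w u S :=
      Finset.sum_congr rfl fun z _ => by rw [sq]
    have h6 : ∑ z, w z * q z ^ 2 = condEnergy w u (S ∪ I) := rfl
    rw [h5, h6]
    ring
  have h3 : (∑ z, w z * |q z - p z|) ^ 2 ≤ ∑ z, w z * (q z - p z) ^ 2 := by
    have := Finset.sum_sq_le_sum_mul_sum_of_sq_le_mul univ (r := fun z => w z * |q z - p z|)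
      (f := w) (g := fun z => w z * (q z - p z) ^ 2) (fun z _ => hw z)
      (fun z _ => mul_nonneg (hw z) (sq_nonneg _))
      (fun z _ => by rw [mul_pow, sq_abs]; exact le_of_eq (by ring))
    rwa [hw1, one_mul] at this
  have h4 : 4 ^ I.card * nu w u I S ^ 2 = (∑ z, w z * |q z - p z|) ^ 2 := by
    unfold nu
    rw [div_pow, ← pow_mul, mul_comm I.card, pow_mul]
    norm_num
    field_simp
    rfl
  linarith

end Laws

/-! ### The flip of a spin -/

section Flip

variable {n : ℕ}

theorem spin_mul_self (a : ℤˣ) : spin a * spin a = 1 := by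
  rcases Int.units_eq_one_or a with h | h <;> simp [h, spin]

theorem spin_neg (a : ℤˣ) : spin (-a) = -spin a := by simp [spin]

theorem abs_spin (a : ℤˣ) : |spin a| = 1 := by
  rcases Int.units_eq_one_or a with h | h <;> simp [h, spin]

theorem sum_spins (F : ℤˣ → ℝ) : ∑ b, F b = F 1 + F (-1) := by
  rw [UnitsInt.univ, Finset.sum_pair (by decide)]

/-- Flip the spin at `v`. -/
def flipAt (v : Fin n) (z : Fin n → ℤˣ) : Fin n → ℤˣ := Function.update z v (-(z v))

theorem flipAt_same (v : Fin n) (z : Fin n → ℤˣ) : flipAt v z v = -(z v) := by simp [flipAt]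

theorem flipAt_of_ne {v i : Fin n} (h : i ≠ v) (z : Fin n → ℤˣ) : flipAt v z i = z i := by
  simp [flipAt, h]

theorem flipAt_flipAt (v : Fin n) (z : Fin n → ℤˣ) : flipAt v (flipAt v z) = z := by
  funext i
  by_cases h : i = v
  · subst h; simp [flipAt_same]
  · simp [flipAt_of_ne h]

theorem flipAt_comm (v w : Fin n) (z : Fin n → ℤˣ) : flipAt v (flipAt w z) = flipAt w (flipAt v z) := by
  by_cases hvw : v = w
  · rw [hvw]
  funext i
  by_cases h : i = v
  · subst h; rw [flipAt_same, flipAt_of_ne hvw, flipAt_of_ne hvw, flipAt_same]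
  · by_cases h' : i = w
    · subst h'; rw [flipAt_of_ne h, flipAt_same, flipAt_same, flipAt_of_ne h]
    · simp [flipAt_of_ne h, flipAt_of_ne h']

theorem sum_flipAt (v : Fin n) (F : (Fin n → ℤˣ) → ℝ) : ∑ z, F (flipAt v z) = ∑ z, F z :=
  Equiv.sum_comp (⟨flipAt v, flipAt v, flipAt_flipAt v, flipAt_flipAt v⟩ : Equiv.Perm (Fin n → ℤˣ)) F

theorem DetBy.flipAt_eq {α : Type*} {F : (Fin n → ℤˣ) → α} {A : Finset (Fin n)} (h : DetBy F A)
    {v : Fin n} (hv : v ∉ A) (z : Fin n → ℤˣ) : F (flipAt v z) = F z :=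
  h _ _ fun i hi => flipAt_of_ne (by rintro rfl; exact hv hi) z

/-- The Walsh characters of the cube. -/
noncomputable def walsh (S : Finset (Fin n)) (z : Fin n → ℤˣ) : ℝ := ∏ i ∈ S, spin (z i)

theorem walsh_mul_self (S : Finset (Fin n)) (z : Fin n → ℤˣ) : walsh S z * walsh S z = 1 := by
  unfold walsh
  rw [← Finset.prod_mul_distrib]
  exact Finset.prod_eq_one fun i _ => spin_mul_self _

theorem abs_walsh (S : Finset (Fin n)) (z : Fin n → ℤˣ) : |walsh S z| = 1 := by
  unfold walsh
  rw [Finset.abs_prod]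
  exact Finset.prod_eq_one fun i _ => abs_spin _

theorem detBy_walsh (S : Finset (Fin n)) : DetBy (walsh S) S := fun y z h =>
  Finset.prod_congr rfl fun i hi => by rw [h i hi]

theorem walsh_eq_mul_erase {S : Finset (Fin n)} {v : Fin n} (hv : v ∈ S) (z : Fin n → ℤˣ) :
    walsh S z = spin (z v) * walsh (S.erase v) z :=
  (Finset.mul_prod_erase S (fun i => spin (z i)) hv).symm

theorem walsh_flipAt {S : Finset (Fin n)} {v : Fin n} (hv : v ∈ S) (z : Fin n → ℤˣ) :
    walsh S (flipAt v z) = -walsh S z := by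
  rw [walsh_eq_mul_erase hv, walsh_eq_mul_erase hv, flipAt_same, spin_neg,
    (detBy_walsh _).flipAt_eq (Finset.notMem_erase v S)]
  ring

theorem sum_mul_walsh_eq_zero {F : (Fin n → ℤˣ) → ℝ} {A T : Finset (Fin n)} (hF : DetBy F A)
    {v : Fin n} (hv : v ∈ T) (hvA : v ∉ A) : ∑ z, F z * walsh T z = 0 := by
  have h := sum_flipAt v fun z => F z * walsh T z
  simp_rw [hF.flipAt_eq hvA, walsh_flipAt hv, mul_neg, Finset.sum_neg_distrib] at h
  linarith

/-- The sum over `S` is the expansion of `∏ i, (1 + x i * z i)`; a coordinate where `x` and `z`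
differ contributes the factor `0`. -/
theorem sum_walsh_mul_walsh (x z : Fin n → ℤˣ) :
    ∑ S : Finset (Fin n), walsh S x * walsh S z = if x = z then 2 ^ n else 0 := by
  have h1 : ∑ S : Finset (Fin n), walsh S x * walsh S z
      = ∏ i : Fin n, (1 + spin (x i) * spin (z i)) := by
    rw [Finset.prod_one_add, Finset.powerset_univ]
    exact Finset.sum_congr rfl fun S _ => Finset.prod_mul_distrib.symm
  rw [h1]
  split_ifs with h
  · subst h
    simp_rw [spin_mul_self]
    norm_num
  · obtain ⟨i, hi⟩ := Function.ne_iff.mp h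
    refine Finset.prod_eq_zero (mem_univ i) ?_
    rcases Int.units_eq_one_or (x i) with h1 | h1 <;> rcases Int.units_eq_one_or (z i) with h2 | h2
    · exact absurd (h1.trans h2.symm) hi
    · simp [h1, h2, spin]
    · simp [h1, h2, spin]
    · exact absurd (h1.trans h2.symm) hi

/-! ### Averaging over the spin at one site -/

/-- Average of `F` over the two values of the spin at `v`. -/
noncomputable def avg (v : Fin n) (F : (Fin n → ℤˣ) → ℝ) (z : Fin n → ℤˣ) : ℝ :=
  (F z + F (flipAt v z)) / 2

/-- Average of `F` over the spins at the sites in a list. -/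
noncomputable def avgList (l : List (Fin n)) (F : (Fin n → ℤˣ) → ℝ) : (Fin n → ℤˣ) → ℝ :=
  l.foldr avg F

theorem avgList_cons (v : Fin n) (l : List (Fin n)) (F : (Fin n → ℤˣ) → ℝ) :
    avgList (v :: l) F = avg v (avgList l F) := rfl

theorem avgList_sub (l : List (Fin n)) (F G : (Fin n → ℤˣ) → ℝ) (z : Fin n → ℤˣ) :
    avgList l (fun z => F z - G z) z = avgList l F z - avgList l G z := by
  induction l generalizing z with
  | nil => rfl
  | cons v l ih => simp only [avgList_cons, avg, ih]; ring

theorem sum_avgList (l : List (Fin n)) (F : (Fin n → ℤˣ) → ℝ) :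
    ∑ z, avgList l F z = ∑ z, F z := by
  induction l with
  | nil => rfl
  | cons v l ih =>
    simp only [avgList_cons, avg]
    rw [← Finset.sum_div, Finset.sum_add_distrib, sum_flipAt v, ih]
    ring

/-- Two configurations that agree on `A` except at `v` either agree on `A`, or become so after
flipping `v` in one of them. The average is symmetric under that flip. -/
theorem DetBy.avg {F : (Fin n → ℤˣ) → ℝ} {A : Finset (Fin n)} (hF : DetBy F A) (v : Fin n) :
    DetBy (avg v F) (A.erase v) := by
  intro y z h
  unfold _root_.avg
  by_cases hyz : y v = z v
  · have h1 : F y = F z := hF y z fun i hi => by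
      by_cases hiv : i = v
      · rw [hiv, hyz]
      · exact h i (mem_erase.mpr ⟨hiv, hi⟩)
    have h2 : F (flipAt v y) = F (flipAt v z) := hF _ _ fun i hi => by
      by_cases hiv : i = v
      · rw [hiv, flipAt_same, flipAt_same, hyz]
      · rw [flipAt_of_ne hiv, flipAt_of_ne hiv]; exact h i (mem_erase.mpr ⟨hiv, hi⟩)
    rw [h1, h2]
  · have hy : y v = -z v := by
      rcases Int.units_eq_one_or (y v) with h1 | h1 <;>
        rcases Int.units_eq_one_or (z v) with h2 | h2 <;> simp_all
    have h1 : F y = F (flipAt v z) := hF _ _ fun i hi => by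
      by_cases hiv : i = v
      · rw [hiv, flipAt_same, hy]
      · rw [flipAt_of_ne hiv]; exact h i (mem_erase.mpr ⟨hiv, hi⟩)
    have h2 : F (flipAt v y) = F z := hF _ _ fun i hi => by
      by_cases hiv : i = v
      · rw [hiv, flipAt_same, hy, neg_neg]
      · rw [flipAt_of_ne hiv]; exact h i (mem_erase.mpr ⟨hiv, hi⟩)
    rw [h1, h2, add_comm]

theorem DetBy.avgList {F : (Fin n → ℤˣ) → ℝ} {A : Finset (Fin n)} (hF : DetBy F A)
    (l : List (Fin n)) : DetBy (avgList l F) (A \ l.toFinset) := by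
  induction l with
  | nil => simpa [_root_.avgList] using hF
  | cons v l ih =>
    rw [avgList_cons]
    refine (ih.avg v).mono fun i hi => ?_
    simp only [mem_erase, mem_sdiff, List.mem_toFinset, List.mem_cons] at hi ⊢
    tauto

/-- Averaging over every coordinate that `F` depends on leaves a constant, and averaging preserves
the total sum. -/
theorem avgList_eq_mean {F : (Fin n → ℤˣ) → ℝ} {l : List (Fin n)} (hF : DetBy F l.toFinset)
    (z : Fin n → ℤˣ) : avgList l F z = (∑ y, F y) / 2 ^ n := by
  have h : ∀ y, avgList l F y = avgList l F z := fun y =>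
    hF.avgList l y z fun i hi => by simp at hi
  rw [← sum_avgList l F, Finset.sum_congr rfl fun y _ => h y]
  simp

theorem avgList_odd {F : (Fin n → ℤˣ) → ℝ} {v : Fin n} (hF : ∀ z, F (flipAt v z) = -F z)
    (l : List (Fin n)) (z : Fin n → ℤˣ) : avgList l F (flipAt v z) = -avgList l F z := by
  induction l generalizing z with
  | nil => exact hF z
  | cons w l ih =>
    simp only [avgList_cons, avg]
    rw [flipAt_comm w v, ih, ih]
    ring

/-- Averages over other sites commute with the flip at `v`, hence keep the function odd there, and
the average at `v` then kills it. -/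
theorem avgList_eq_zero {F : (Fin n → ℤˣ) → ℝ} {v : Fin n} (hF : ∀ z, F (flipAt v z) = -F z)
    {l : List (Fin n)} (hv : v ∈ l) (z : Fin n → ℤˣ) : avgList l F z = 0 := by
  induction l generalizing z with
  | nil => simp at hv
  | cons w l ih =>
    simp only [avgList_cons, avg]
    rcases List.mem_cons.mp hv with h | h
    · subst h
      rw [avgList_odd hF]
      ring
    · rw [ih h, ih h]
      ring

/-- The averages are uniform whereas the norm is weighted by `w`. Each average costs one factor `c`:
convexity of the square gives the mean of the values at `z` and at its flip, and moving the flip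
onto `w` costs at most `c`. -/
theorem avgList_sq_le {w : (Fin n → ℤˣ) → ℝ} (hw : ∀ y, 0 ≤ w y) {c : ℝ} (hc : 1 ≤ c)
    (hflip : ∀ v z, w (flipAt v z) ≤ c * w z) (l : List (Fin n)) (F : (Fin n → ℤˣ) → ℝ) :
    ∑ z, w z * avgList l F z ^ 2 ≤ c ^ l.length * ∑ z, w z * F z ^ 2 := by
  induction l with
  | nil => simp [avgList]
  | cons v l ih =>
    set G := avgList l F
    have h1 : ∑ z, w z * avg v G z ^ 2 ≤ ∑ z, w z * ((G z ^ 2 + G (flipAt v z) ^ 2) / 2) := by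
      refine Finset.sum_le_sum fun z _ => mul_le_mul_of_nonneg_left ?_ (hw z)
      unfold avg
      nlinarith [sq_nonneg (G z - G (flipAt v z))]
    have h2 : ∑ z, w z * G (flipAt v z) ^ 2 = ∑ z, w (flipAt v z) * G z ^ 2 := by
      rw [← sum_flipAt v]
      simp_rw [flipAt_flipAt]
    have h3 : ∑ z, w (flipAt v z) * G z ^ 2 ≤ c * ∑ z, w z * G z ^ 2 := by
      rw [Finset.mul_sum]
      refine Finset.sum_le_sum fun z _ => ?_
      rw [← mul_assoc]
      exact mul_le_mul_of_nonneg_right (hflip v z) (sq_nonneg _)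
    have h4 : 0 ≤ ∑ z, w z * G z ^ 2 :=
      Finset.sum_nonneg fun z _ => mul_nonneg (hw z) (sq_nonneg _)
    have h5 : ∑ z, w z * ((G z ^ 2 + G (flipAt v z) ^ 2) / 2)
        = (∑ z, w z * G z ^ 2 + ∑ z, w z * G (flipAt v z) ^ 2) / 2 := by
      rw [← Finset.sum_add_distrib, Finset.sum_div]
      exact Finset.sum_congr rfl fun z _ => by ring
    rw [avgList_cons, List.length_cons, pow_succ']
    calc _ ≤ c * ∑ z, w z * G z ^ 2 := by nlinarith
      _ ≤ c * (c ^ l.length * ∑ z, w z * F z ^ 2) := by gcongr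
      _ = _ := by ring

end Flip

/-! ### The Markov random field of the observed variables -/

namespace RBM

variable {n m : ℕ} (R : RBM n m)

/-- For fixed `x` the exponent is a sum over the latent spins, so the sum over `y` factors into
two-term sums `eᵗ + e⁻ᵗ`, whose logarithms are the terms of `logPotential`. -/
theorem sum_weight (x : Fin n → ℤˣ) :
    ∑ y : Fin m → ℤˣ, R.weight x y = Real.exp (R.logPotential x) := by
  have h1 : ∀ y, R.weight x y = Real.exp (∑ i, R.h i * spin (x i))
      * ∏ j, Real.exp (spin (y j) * ((∑ i, R.J i j * spin (x i)) + R.g j)) := by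
    intro y
    unfold weight
    rw [← Real.exp_sum, ← Real.exp_add, Finset.sum_comm]
    congr 1
    have : ∀ j, spin (y j) * ((∑ i, R.J i j * spin (x i)) + R.g j)
        = (∑ i, spin (x i) * R.J i j * spin (y j)) + R.g j * spin (y j) := by
      intro j
      rw [mul_add, Finset.mul_sum]
      congr 1
      · exact Finset.sum_congr rfl fun i _ => by ring
      · ring
    simp_rw [this, Finset.sum_add_distrib]
    ring
  simp_rw [h1]
  rw [← Finset.mul_sum, logPotential, Real.exp_add, mul_comm]
  congr 1
  have h2 := Finset.prod_univ_sum (fun _ : Fin m => (univ : Finset ℤˣ))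
    (fun j b => Real.exp (spin b * ((∑ i, R.J i j * spin (x i)) + R.g j)))
  rw [Fintype.piFinset_univ] at h2
  rw [← h2, Real.exp_sum]
  refine Finset.prod_congr rfl fun j _ => ?_
  rw [sum_spins, Real.exp_log (by positivity)]
  simp [spin]

/-- The partition function of the observed variables. -/
noncomputable def partition : ℝ := ∑ x : Fin n → ℤˣ, Real.exp (R.logPotential x)

theorem partition_pos : 0 < R.partition :=
  Finset.sum_pos (fun _ _ => Real.exp_pos _) univ_nonempty

theorem jointProb_eq (x : Fin n → ℤˣ) (y : Fin m → ℤˣ) :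
    R.jointProb x y = R.weight x y / R.partition := by
  unfold jointProb partition
  simp_rw [sum_weight]

theorem obsProb_eq (x : Fin n → ℤˣ) :
    R.obsProb x = Real.exp (R.logPotential x) / R.partition := by
  unfold obsProb
  simp_rw [jointProb_eq]
  rw [← Finset.sum_div, sum_weight]

theorem obsProb_pos (x : Fin n → ℤˣ) : 0 < R.obsProb x := by
  rw [obsProb_eq]; exact div_pos (Real.exp_pos _) R.partition_pos

theorem obsProb_nonneg (x : Fin n → ℤˣ) : 0 ≤ R.obsProb x := (R.obsProb_pos x).le

theorem sum_obsProb : ∑ x, R.obsProb x = 1 := by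
  simp_rw [obsProb_eq]
  rw [← Finset.sum_div]
  exact div_self R.partition_pos.ne'

theorem logPotential_eq_sum (z : Fin n → ℤˣ) :
    R.logPotential z = ∑ T : Finset (Fin n), R.fourier T * walsh T z := by
  have h : ∀ T : Finset (Fin n), R.fourier T * walsh T z
      = ∑ x, R.logPotential x / 2 ^ n * (walsh T x * walsh T z) := by
    intro T
    change (∑ x : Fin n → ℤˣ, R.logPotential x * walsh T x) / 2 ^ n * walsh T z = _
    rw [Finset.sum_div, Finset.sum_mul]
    exact Finset.sum_congr rfl fun x _ => by ring
  simp_rw [h]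
  rw [Finset.sum_comm]
  simp_rw [← Finset.mul_sum, sum_walsh_mul_walsh]
  simp

/-- The local field at `u`. -/
noncomputable def localField (u : Fin n) (z : Fin n → ℤˣ) : ℝ :=
  ∑ T : Finset (Fin n) with u ∈ T, R.fourier T * walsh (T.erase u) z

/-- Only the characters that contain `u` change sign, and together they are the spin at `u` times
the local field. -/
theorem logPotential_flipAt (u : Fin n) (z : Fin n → ℤˣ) :
    R.logPotential (flipAt u z) = R.logPotential z - 2 * (spin (z u) * R.localField u z) := by
  rw [logPotential_eq_sum, logPotential_eq_sum, localField, Finset.sum_filter, Finset.mul_sum,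
    Finset.mul_sum, ← Finset.sum_sub_distrib]
  refine Finset.sum_congr rfl fun T _ => ?_
  split_ifs with h
  · rw [walsh_flipAt h, walsh_eq_mul_erase h]; ring
  · rw [(detBy_walsh T).flipAt_eq h]; ring

theorem mem_nbhd {u i : Fin n} :
    i ∈ R.nbhd u ↔ i ≠ u ∧ ∃ S : Finset (Fin n), u ∈ S ∧ i ∈ S ∧ R.fourier S ≠ 0 := by
  simp [nbhd]

theorem notMem_nbhd_self (u : Fin n) : u ∉ R.nbhd u := by simp [mem_nbhd]

theorem erase_subset_nbhd {u : Fin n} {T : Finset (Fin n)} (hu : u ∈ T) (hT : R.fourier T ≠ 0) :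
    T.erase u ⊆ R.nbhd u := fun _ hi =>
  R.mem_nbhd.mpr ⟨(mem_erase.mp hi).1, T, hu, (mem_erase.mp hi).2, hT⟩

theorem detBy_localField (u : Fin n) : DetBy (R.localField u) (R.nbhd u) := by
  intro y z h
  refine Finset.sum_congr rfl fun T hT => ?_
  by_cases hT0 : R.fourier T = 0
  · simp [hT0]
  · rw [(detBy_walsh _).mono (R.erase_subset_nbhd (mem_filter.mp hT).2 hT0) y z h]

theorem sum_abs_fourier_le_width (u : Fin n) :
    ∑ T : Finset (Fin n) with u ∈ T, |R.fourier T| ≤ R.width :=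
  le_ciSup (f := fun u : Fin n => ∑ T : Finset (Fin n) with u ∈ T, |R.fourier T|)
    (Set.finite_range _).bddAbove u

theorem abs_localField_le (u : Fin n) (z : Fin n → ℤˣ) : |R.localField u z| ≤ R.width := by
  refine le_trans (Finset.abs_sum_le_sum_abs _ _) (le_trans ?_ (R.sum_abs_fourier_le_width u))
  simp [abs_mul, abs_walsh]

theorem obsProb_flipAt (u : Fin n) (z : Fin n → ℤˣ) :
    R.obsProb (flipAt u z) = Real.exp (-2 * (spin (z u) * R.localField u z)) * R.obsProb z := by
  rw [obsProb_eq, obsProb_eq, logPotential_flipAt, sub_eq_add_neg, Real.exp_add]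
  ring_nf

theorem obsProb_flipAt_le (u : Fin n) (z : Fin n → ℤˣ) :
    R.obsProb (flipAt u z) ≤ Real.exp (2 * R.width) * R.obsProb z := by
  rw [obsProb_flipAt]
  refine mul_le_mul_of_nonneg_right (Real.exp_le_exp.mpr ?_) (R.obsProb_nonneg z)
  have h := abs_le.mp (R.abs_localField_le u z)
  rcases Int.units_eq_one_or (z u) with h1 | h1 <;> simp only [h1, spin] <;> norm_num <;> linarith

/-- The conditional probability of spin `1` at `u`, given all other spins. -/
noncomputable def localProb (u : Fin n) (z : Fin n → ℤˣ) : ℝ :=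
  Real.sigmoid (2 * R.localField u z)

theorem detBy_localProb (u : Fin n) : DetBy (R.localProb u) (R.nbhd u) := fun y z h => by
  simp only [localProb, R.detBy_localField u y z h]

/-- `localProb` is the conditional expectation of `up u` given all other spins. Pair each
configuration with its flip at `u`: neither `F` nor the local field sees the flip, and on a pair the
claim is the formula for the sigmoid. -/
theorem sum_mul_localProb {u : Fin n} {A : Finset (Fin n)} (hu : u ∉ A) {F : (Fin n → ℤˣ) → ℝ}
    (hF : DetBy F A) :
    ∑ z, R.obsProb z * (F z * R.localProb u z) = ∑ z, R.obsProb z * (F z * up u z) := by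
  have h : ∀ G : (Fin n → ℤˣ) → ℝ, ∑ z, G z = (∑ z, (G z + G (flipAt u z))) / 2 := fun G => by
    rw [Finset.sum_add_distrib, sum_flipAt]; ring
  rw [h, h (fun z => R.obsProb z * (F z * up u z))]
  congr 1
  refine Finset.sum_congr rfl fun z _ => ?_
  rw [hF.flipAt_eq hu, (R.detBy_localProb u).flipAt_eq (R.notMem_nbhd_self u), obsProb_flipAt]
  unfold up localProb
  rw [flipAt_same, Real.sigmoid_def]
  set a := R.localField u z
  rcases Int.units_eq_one_or (z u) with h1 | h1
  · have h2 : (0 : ℝ) < Real.exp (-(2 * a)) := Real.exp_pos _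
    simp only [h1, spin]
    have h3 : (-2 * (((1 : ℤˣ) : ℤ) : ℝ) * a) = -(2 * a) := by simp
    simp only [← mul_assoc, h3]
    have h4 : ¬ (-1 : ℤˣ) = 1 := by decide
    simp only [h4, if_true, if_false]
    field_simp
    ring
  · have h2 : (0 : ℝ) < Real.exp (2 * a) := Real.exp_pos _
    simp only [h1, spin]
    have h3 : (-2 * (((-1 : ℤˣ) : ℤ) : ℝ) * a) = 2 * a := by simp
    simp only [← mul_assoc, h3, Real.exp_neg]
    have h4 : ¬ (-1 : ℤˣ) = 1 := by decide
    simp only [h4, if_true, if_false, neg_neg]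
    field_simp
    ring

/-- The indicator function of agreement with `z` on `A`. -/
theorem detBy_agree (A : Finset (Fin n)) (z : Fin n → ℤˣ) :
    DetBy (fun y => if ∀ i ∈ A, y i = z i then (1 : ℝ) else 0) A := by
  intro x y h
  have : (∀ i ∈ A, x i = z i) ↔ (∀ i ∈ A, y i = z i) :=
    forall₂_congr fun i hi => by rw [h i hi]
  simp only [this]

theorem marg_up_eq {u : Fin n} {A : Finset (Fin n)} (hu : u ∉ A) (z : Fin n → ℤˣ) :
    marg (fun y => up u y * R.obsProb y) A z
      = marg (fun y => R.localProb u y * R.obsProb y) A z := by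
  have h := R.sum_mul_localProb hu (detBy_agree A z)
  unfold marg
  rw [Finset.sum_congr rfl fun y _ => ?_, ← h]
  · exact Finset.sum_congr rfl fun y _ => by split_ifs <;> ring
  · split_ifs <;> ring

theorem marg_obsProb_pos (A : Finset (Fin n)) (z : Fin n → ℤˣ) : 0 < marg R.obsProb A z :=
  lt_of_lt_of_le (R.obsProb_pos z) (le_marg R.obsProb_nonneg A z)

/-- `localProb` is determined by the neighbourhood, so it is constant on the cells of any set that
contains it. -/
theorem condUp_eq_localProb {u : Fin n} {A : Finset (Fin n)} (hu : u ∉ A) (hA : R.nbhd u ⊆ A)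
    (z : Fin n → ℤˣ) : condUp R.obsProb u A z = R.localProb u z := by
  unfold condUp
  rw [R.marg_up_eq hu, div_eq_iff (R.marg_obsProb_pos A z).ne']
  unfold marg
  rw [Finset.mul_sum]
  refine Finset.sum_congr rfl fun y _ => ?_
  split_ifs with h
  · simp only [(R.detBy_localProb u).mono hA y z h]
  · simp

/-- Local Markov property: nothing is gained by conditioning on more than the neighbourhood. -/
theorem nu_eq_zero {u : Fin n} {I S : Finset (Fin n)} (huS : u ∉ S) (huI : u ∉ I)
    (hS : R.nbhd u ⊆ S) : nu R.obsProb u I S = 0 := by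
  unfold nu
  have h : ∀ z, condUp R.obsProb u (S ∪ I) z - condUp R.obsProb u S z = 0 := fun z => by
    rw [R.condUp_eq_localProb (by simp [huS, huI]) (hS.trans subset_union_left),
      R.condUp_eq_localProb huS hS, sub_self]
  simp [h]

theorem localProb_mem (u : Fin n) (z : Fin n → ℤˣ) :
    R.localProb u z ∈ Set.Icc (Real.sigmoid (2 * -R.width)) (Real.sigmoid (2 * R.width)) := by
  have h := abs_le.mp (R.abs_localField_le u z)
  exact ⟨Real.sigmoid_le (by linarith), Real.sigmoid_le (by linarith)⟩

/-- On each cell `condUp` is an average of `localProb`, so it stays in the range of `t ↦ sigmoid (2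
* t)` on `[-width, width]` and can be inverted there. -/
theorem condUp_mem {u : Fin n} {A : Finset (Fin n)} (hu : u ∉ A) (z : Fin n → ℤˣ) :
    condUp R.obsProb u A z ∈ Set.Icc (Real.sigmoid (2 * -R.width)) (Real.sigmoid (2 * R.width)) := by
  have hm : ∀ c, marg (fun y => c * R.obsProb y) A z = c * marg R.obsProb A z := by
    intro c
    unfold marg
    rw [Finset.mul_sum]
    exact Finset.sum_congr rfl fun y _ => by split_ifs <;> simp
  unfold condUp
  rw [R.marg_up_eq hu]
  constructor
  · rw [le_div_iff₀ (R.marg_obsProb_pos A z), ← hm]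
    exact marg_mono (fun y => mul_le_mul_of_nonneg_right (R.localProb_mem u y).1
      (R.obsProb_nonneg y)) A z
  · rw [div_le_iff₀ (R.marg_obsProb_pos A z), ← hm]
    exact marg_mono (fun y => mul_le_mul_of_nonneg_right (R.localProb_mem u y).2
      (R.obsProb_nonneg y)) A z

end RBM

/-! ### Strong monotonicity of the sigmoid on bounded intervals -/

theorem Real.sigmoid_two_mul_sub (a b : ℝ) :
    Real.sigmoid (2 * a) - Real.sigmoid (2 * b)
      = Real.sinh (a - b) / (2 * Real.cosh a * Real.cosh b) := by
  have h : ∀ t : ℝ, Real.sigmoid (2 * t) = Real.exp t / (2 * Real.cosh t) := by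
    intro t
    have : 2 * Real.cosh t = Real.exp t + Real.exp (-t) := by rw [Real.cosh_eq]; ring
    rw [this, Real.sigmoid_def, show -(2 * t) = -t + -t by ring, Real.exp_add, Real.exp_neg]
    have := Real.exp_pos t
    field_simp
  rw [h, h, div_sub_div _ _ (by positivity) (by positivity),
    div_eq_div_iff (by positivity) (by positivity), Real.sinh_sub]
  simp only [Real.cosh_eq, Real.sinh_eq]
  ring

theorem Real.cosh_le_exp_of_abs_le {a c : ℝ} (h : |a| ≤ c) : Real.cosh a ≤ Real.exp c := by
  have := abs_le.mp h
  have h1 : Real.exp a ≤ Real.exp c := Real.exp_le_exp.mpr (by linarith)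
  have h2 : Real.exp (-a) ≤ Real.exp c := Real.exp_le_exp.mpr (by linarith)
  rw [Real.cosh_eq]; linarith

/-- In the formula for the difference use `t * sinh t ≥ t ^ 2` in the numerator and `cosh ≤ exp c`
twice in the denominator. -/
theorem Real.sigmoid_sub_mul_sub_ge {a b c : ℝ} (ha : |a| ≤ c) (hb : |b| ≤ c) :
    Real.exp (-2 * c) / 2 * (a - b) ^ 2
      ≤ (Real.sigmoid (2 * a) - Real.sigmoid (2 * b)) * (a - b) := by
  have h1 : (a - b) ^ 2 ≤ Real.sinh (a - b) * (a - b) := by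
    rcases le_total 0 (a - b) with h | h
    · have := Real.self_le_sinh_iff.mpr h
      nlinarith
    · have := Real.sinh_le_self_iff.mpr h
      nlinarith
  have h2 : Real.exp (-2 * c) / 2 ≤ 1 / (2 * Real.cosh a * Real.cosh b) := by
    have h3 : Real.cosh a * Real.cosh b ≤ Real.exp (2 * c) := by
      rw [two_mul, Real.exp_add]
      exact mul_le_mul (cosh_le_exp_of_abs_le ha) (cosh_le_exp_of_abs_le hb)
        (Real.cosh_pos b).le (Real.exp_pos _).le
    rw [show -2 * c = -(2 * c) by ring, Real.exp_neg, inv_eq_one_div, div_div]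
    have := Real.cosh_pos a
    have := Real.cosh_pos b
    exact one_div_le_one_div_of_le (by positivity) (by nlinarith)
  rw [Real.sigmoid_two_mul_sub]
  calc _ ≤ 1 / (2 * Real.cosh a * Real.cosh b) * (Real.sinh (a - b) * (a - b)) := by
        have := Real.cosh_pos a
        have := Real.cosh_pos b
        gcongr
    _ = _ := by ring

/-! ### Every incomplete set misses a correlated set of few neighbours -/

namespace RBM

variable {n m : ℕ} (R : RBM n m)

theorem width_nonneg : 0 ≤ R.width :=
  Real.iSup_nonneg fun _ => Finset.sum_nonneg fun _ _ => abs_nonneg _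

theorem nbhd_card_le (u : Fin n) : (R.nbhd u).card ≤ R.maxDegree :=
  Finset.le_sup (f := fun u => (R.nbhd u).card) (mem_univ u)

theorem latent_card_le (j : Fin m) :
    (univ.filter fun i : Fin n => R.J i j ≠ 0).card ≤ R.latentDegree :=
  Finset.le_sup (f := fun j : Fin m => (univ.filter fun i : Fin n => R.J i j ≠ 0).card)
    (mem_univ j)

theorem minPotential_le {T : Finset (Fin n)} (hT : T.Nonempty) (h : R.fourier T ≠ 0) :
    R.minPotential ≤ |R.fourier T| :=
  csInf_le ⟨0, by rintro a ⟨T, -, -, rfl⟩; exact abs_nonneg _⟩ ⟨T, hT, h, rfl⟩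

theorem minPotential_nonneg : 0 ≤ R.minPotential :=
  Real.sInf_nonneg (by rintro a ⟨T, -, -, rfl⟩; exact abs_nonneg _)

theorem exists_fourier_ne_zero (h : 0 < R.width) :
    ∃ (u : Fin n) (T : Finset (Fin n)), u ∈ T ∧ R.fourier T ≠ 0 := by
  by_contra! hne
  have : R.width = 0 := by
    unfold width
    have h0 : ∀ u : Fin n, ∑ S : Finset (Fin n) with u ∈ S, |R.fourier S| = 0 := fun u =>
      Finset.sum_eq_zero fun T hT => by rw [hne u T (mem_filter.mp hT).2, abs_zero]
    simp [h0]
  linarith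

/-- The infimum runs over a finite set, nonempty because the width is positive, so it is attained at
a nonzero coefficient; the default value of `sInf` on the empty set does not intervene. -/
theorem minPotential_pos (h : 0 < R.width) : 0 < R.minPotential := by
  obtain ⟨u, T, hu, hT⟩ := R.exists_fourier_ne_zero h
  set A := {a | ∃ S : Finset (Fin n), S.Nonempty ∧ R.fourier S ≠ 0 ∧ a = |R.fourier S|}
  have hfin : A.Finite := (Set.finite_range fun S : Finset (Fin n) => |R.fourier S|).subset
    (by rintro a ⟨S, -, -, rfl⟩; exact ⟨S, rfl⟩)
  have hne : A.Nonempty := ⟨_, T, ⟨u, hu⟩, hT, rfl⟩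
  obtain ⟨S, -, hS, h⟩ := hne.csInf_mem hfin
  change 0 < sInf A
  rw [h]
  exact abs_pos.mpr hS

theorem minPotential_le_width (h : 0 < R.width) : R.minPotential ≤ R.width := by
  obtain ⟨u, T, hu, hT⟩ := R.exists_fourier_ne_zero h
  refine (R.minPotential_le ⟨u, hu⟩ hT).trans (le_trans ?_ (R.sum_abs_fourier_le_width u))
  exact Finset.single_le_sum (f := fun T => |R.fourier T|) (fun _ _ => abs_nonneg _)
    (mem_filter.mpr ⟨mem_univ T, hu⟩)

/-- Each summand of `f` depends on at most `d` spins: one latent variable sees at most `d` sites,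
and an external field sees one site, which is where `1 ≤ d` enters. A character with a site outside
these is orthogonal to the summand. -/
theorem fourier_eq_zero_of_card_gt (hd : 0 < R.latentDegree) {T : Finset (Fin n)}
    (hT : R.latentDegree < T.card) : R.fourier T = 0 := by
  have h1 : ∀ (F : (Fin n → ℤˣ) → ℝ) (A : Finset (Fin n)), DetBy F A → A.card ≤ R.latentDegree →
      ∑ x, F x * walsh T x = 0 := by
    intro F A hF hA
    obtain ⟨v, hv, hvA⟩ := Finset.exists_mem_notMem_of_card_lt_card (lt_of_le_of_lt hA hT)
    exact sum_mul_walsh_eq_zero hF hv hvA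
  have h2 : ∑ x, R.logPotential x * walsh T x = 0 := by
    unfold logPotential
    simp_rw [add_mul, Finset.sum_mul, Finset.sum_add_distrib]
    rw [Finset.sum_comm, Finset.sum_eq_zero, Finset.sum_comm, Finset.sum_eq_zero, add_zero]
    · intro i _
      refine h1 (fun x => R.h i * spin (x i)) {i} (fun y z h => ?_) (by simpa using Nat.succ_le_of_lt hd)
      simp only [h i (mem_singleton_self i)]
    · intro j _
      refine h1 (fun x => Real.log (Real.exp ((∑ i, R.J i j * spin (x i)) + R.g j)
        + Real.exp (-((∑ i, R.J i j * spin (x i)) + R.g j)))) _ (fun y z h => ?_)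
        (R.latent_card_le j)
      have : ∑ i, R.J i j * spin (y i) = ∑ i, R.J i j * spin (z i) := by
        refine Finset.sum_congr rfl fun i _ => ?_
        by_cases hi : R.J i j = 0
        · simp [hi]
        · rw [h i (by simpa using hi)]
      simp only [this]
  change (∑ x : Fin n → ℤˣ, R.logPotential x * walsh T x) / 2 ^ n = 0
  rw [h2, zero_div]

/-- The Walsh coefficient of the local field at `T \ {u}` is that of `f` at `T`. It is read off by
flipping `u` in the sum that defines the latter. -/
theorem sum_localField_mul_walsh {u : Fin n} {T : Finset (Fin n)} (hu : u ∈ T) :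
    ∑ z, R.localField u z * walsh (T.erase u) z = 2 ^ n * R.fourier T := by
  have h1 : R.fourier T = (∑ x : Fin n → ℤˣ, R.logPotential x * walsh T x) / 2 ^ n := rfl
  have h2 := sum_flipAt u fun z => R.logPotential z * walsh T z
  have h3 : ∀ z, R.logPotential (flipAt u z) * walsh T (flipAt u z)
      = 2 * (R.localField u z * walsh (T.erase u) z) - R.logPotential z * walsh T z := by
    intro z
    rw [logPotential_flipAt, walsh_flipAt hu, walsh_eq_mul_erase hu]
    linear_combination (2 * R.localField u z * walsh (T.erase u) z) * spin_mul_self (z u)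
  simp_rw [h3, Finset.sum_sub_distrib, ← Finset.mul_sum] at h2
  rw [h1]
  field_simp
  linarith

/-- The local field cannot be approximated by a function that ignores one of the neighbours. -/
theorem sum_sq_localField_sub_ge {u v : Fin n} {S T : Finset (Fin n)} (hu : u ∈ T) (hv : v ∈ T)
    (huv : v ≠ u) (hvS : v ∉ S) (hT : R.fourier T ≠ 0) {g : (Fin n → ℤˣ) → ℝ} (hg : DetBy g S) :
    R.fourier T ^ 2 ≤ Real.exp (2 * R.width) ^ R.maxDegree
      * ∑ z, R.obsProb z * (R.localField u z - g z) ^ 2 := by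
  set A := T.erase u
  have hvA : v ∈ A := mem_erase.mpr ⟨huv, hv⟩
  set l := (R.nbhd u).toList
  have hl : l.toFinset = R.nbhd u := Finset.toList_toFinset _
  have hAN : A ⊆ R.nbhd u := R.erase_subset_nbhd hu hT
  -- Averaging over all neighbours of `u` extracts the Walsh coefficient of the local field exactly,
  -- while the term with `g` vanishes because it is odd at `v`. The mean-square bound for averages
  -- then applies with at most `maxDegree` factors.
  have h1 : ∀ z, avgList l (fun z => R.localField u z * walsh A z - g z * walsh A z) z
      = R.fourier T := by
    intro z
    rw [avgList_sub, avgList_eq_mean, avgList_eq_zero (v := v), R.sum_localField_mul_walsh hu]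
    · field_simp; ring
    · intro z
      rw [hg.flipAt_eq hvS, walsh_flipAt hvA]; ring
    · simpa [l] using hAN hvA
    · rw [hl]
      intro y z h
      simp only [R.detBy_localField u y z h, (detBy_walsh A).mono hAN y z h]
  have hexp : 1 ≤ Real.exp (2 * R.width) :=
    Real.one_le_exp (by linarith [R.width_nonneg])
  have h2 := avgList_sq_le R.obsProb_nonneg hexp R.obsProb_flipAt_le l
    (fun z => R.localField u z * walsh A z - g z * walsh A z)
  simp_rw [h1] at h2
  rw [← Finset.sum_mul, sum_obsProb, one_mul] at h2
  have h3 : ∀ z, (R.localField u z * walsh A z - g z * walsh A z) ^ 2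
      = (R.localField u z - g z) ^ 2 := by
    intro z
    rw [← sub_mul, mul_pow, sq (walsh A z), walsh_mul_self, mul_one]
  simp_rw [h3] at h2
  refine h2.trans (mul_le_mul_of_nonneg_right ?_
    (Finset.sum_nonneg fun z _ => mul_nonneg (R.obsProb_nonneg z) (sq_nonneg _)))
  refine pow_le_pow_right₀ hexp ?_
  rw [Finset.length_toList]
  exact R.nbhd_card_le u

/-- The covariance of the spin at `u` with its local field, given the spins in `S`. -/
noncomputable def fieldCov (u : Fin n) (S : Finset (Fin n)) : ℝ :=
  ∑ z, R.obsProb z * ((up u z - condUp R.obsProb u S z) * R.localField u z)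

/-- Let `g` be the field whose sigmoid is the conditional probability `p` given `S`. Subtracting `g`
from the local field does not change the covariance, which becomes the mean of a product of two
increments of a strongly increasing function. It thus controls the mean-square distance from the
local field to `g`, a function of the spins in `S` only. -/
theorem fieldCov_ge {u v : Fin n} {S T : Finset (Fin n)} (hu : u ∈ T) (hv : v ∈ T)
    (huv : v ≠ u) (huS : u ∉ S) (hvS : v ∉ S) (hT : R.fourier T ≠ 0) :
    R.fourier T ^ 2 * (Real.exp (-2 * R.width) ^ (R.maxDegree + 1) / 2) ≤ R.fieldCov u S := by
  have hw := R.obsProb_nonneg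
  set p := condUp R.obsProb u S with hp
  -- The intermediate value theorem inverts `b ↦ sigmoid (2 * b)` with values in `[-width, width]`;
  -- the bound on `b` is what the monotonicity constant requires.
  have hg : ∀ t ∈ Set.Icc (Real.sigmoid (2 * -R.width)) (Real.sigmoid (2 * R.width)),
      ∃ b, |b| ≤ R.width ∧ Real.sigmoid (2 * b) = t := by
    intro t ht
    have hc : ContinuousOn (fun b => Real.sigmoid (2 * b)) (Set.Icc (-R.width) R.width) :=
      (continuous_sigmoid.comp (continuous_const.mul continuous_id)).continuousOn
    obtain ⟨b, hb, hbt⟩ := intermediate_value_Icc (by linarith [R.width_nonneg]) hc ht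
    exact ⟨b, abs_le.mpr hb, hbt⟩
  choose! G hG1 hG2 using hg
  set g : (Fin n → ℤˣ) → ℝ := fun z => G (p z)
  have hpD : DetBy p S := detBy_condUp _ u S
  have hgD : DetBy g S := fun y z h => by simp only [g, hpD y z h]
  have hpm : ∀ z, p z ∈ Set.Icc (Real.sigmoid (2 * -R.width)) (Real.sigmoid (2 * R.width)) :=
    fun z => R.condUp_mem huS z
  have e1 : ∑ z, R.obsProb z * (R.localField u z * R.localProb u z)
      = ∑ z, R.obsProb z * (R.localField u z * up u z) :=
    R.sum_mul_localProb (R.notMem_nbhd_self u) (R.detBy_localField u)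
  -- Both sides equal the mean of `g * up u`, since `g` depends only on `S` and `u ∉ S`.
  have e2 : ∑ z, R.obsProb z * (g z * R.localProb u z) = ∑ z, R.obsProb z * (g z * p z) := by
    rw [R.sum_mul_localProb huS hgD, sum_mul_condUp hw u hgD]
  have e3 : R.fieldCov u S
      = ∑ z, R.obsProb z * ((R.localProb u z - p z) * (R.localField u z - g z)) := by
    have h1 : ∀ z, R.obsProb z * ((R.localProb u z - p z) * (R.localField u z - g z))
        = R.obsProb z * (R.localField u z * R.localProb u z)
          - R.obsProb z * (p z * R.localField u z)
          - R.obsProb z * (g z * R.localProb u z) + R.obsProb z * (g z * p z) := fun z => by ring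
    have h2 : ∀ z, R.obsProb z * ((up u z - p z) * R.localField u z)
        = R.obsProb z * (R.localField u z * up u z)
          - R.obsProb z * (p z * R.localField u z) := fun z => by ring
    change ∑ z, R.obsProb z * ((up u z - p z) * R.localField u z) = _
    simp_rw [h1, h2, Finset.sum_add_distrib, Finset.sum_sub_distrib]
    rw [e1, e2]
    ring
  have h4 : Real.exp (-2 * R.width) / 2 * ∑ z, R.obsProb z * (R.localField u z - g z) ^ 2
      ≤ R.fieldCov u S := by
    rw [e3, Finset.mul_sum]
    refine Finset.sum_le_sum fun z _ => ?_
    have := Real.sigmoid_sub_mul_sub_ge (R.abs_localField_le u z) (hG1 _ (hpm z))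
    rw [hG2 _ (hpm z)] at this
    have := mul_le_mul_of_nonneg_left this (hw z)
    calc _ = R.obsProb z * (Real.exp (-2 * R.width) / 2 * (R.localField u z - g z) ^ 2) := by ring
      _ ≤ _ := this
  have h5 := R.sum_sq_localField_sub_ge hu hv huv hvS hT hgD
  have h6 : Real.exp (-2 * R.width) ^ R.maxDegree * Real.exp (2 * R.width) ^ R.maxDegree = 1 := by
    rw [← mul_pow, ← Real.exp_add]; simp
  set E := ∑ z, R.obsProb z * (R.localField u z - g z) ^ 2
  have h7 : R.fourier T ^ 2 * Real.exp (-2 * R.width) ^ R.maxDegree ≤ E := by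
    calc _ ≤ (Real.exp (2 * R.width) ^ R.maxDegree * E) * Real.exp (-2 * R.width) ^ R.maxDegree := by
          gcongr
      _ = (Real.exp (-2 * R.width) ^ R.maxDegree * Real.exp (2 * R.width) ^ R.maxDegree) * E := by
          ring
      _ = E := by rw [h6, one_mul]
  calc _ = Real.exp (-2 * R.width) / 2
        * (R.fourier T ^ 2 * Real.exp (-2 * R.width) ^ R.maxDegree) := by ring
    _ ≤ Real.exp (-2 * R.width) / 2 * E := by gcongr
    _ ≤ _ := h4

/-- The character is determined by `S ∪ A`, so the tower property replaces `up u` by its conditional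
probability given `S ∪ A`. Then the character has modulus one, and what remains is `nu` without its
normalisation. -/
theorem abs_sum_sub_mul_walsh_le {u : Fin n} (S A : Finset (Fin n)) :
    |∑ z, R.obsProb z * ((up u z - condUp R.obsProb u S z) * walsh A z)|
      ≤ 2 ^ (A \ S).card * nu R.obsProb u (A \ S) S := by
  have hw := R.obsProb_nonneg
  have hA : DetBy (walsh A) (S ∪ A \ S) := (detBy_walsh A).mono (by simp)
  have h1 : ∑ z, R.obsProb z * ((up u z - condUp R.obsProb u S z) * walsh A z)
      = ∑ z, R.obsProb z
        * ((condUp R.obsProb u (S ∪ A \ S) z - condUp R.obsProb u S z) * walsh A z) := by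
    have := sum_mul_condUp hw u hA
    simp_rw [sub_mul, mul_sub, Finset.sum_sub_distrib]
    congr 1
    rw [Finset.sum_congr rfl fun z _ => by rw [mul_comm (up u z)], ← this]
    exact Finset.sum_congr rfl fun z _ => by ring
  rw [h1]
  refine (Finset.abs_sum_le_sum_abs _ _).trans (le_of_eq ?_)
  unfold nu
  rw [mul_div_cancel₀ _ (by positivity)]
  refine Finset.sum_congr rfl fun z _ => ?_
  rw [abs_mul, abs_mul, abs_walsh, mul_one, abs_of_nonneg (hw z)]

/-- Expand the local field in characters `T \ {u}`. Nonzero coefficients have at most `d` sites, all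
neighbours apart from `u`, and the absolute coefficients sum to at most the width. -/
theorem fieldCov_le (hd : 0 < R.latentDegree) {u : Fin n} {S : Finset (Fin n)} {β : ℝ}
    (hβ : ∀ I ⊆ R.nbhd u \ S, I.card ≤ R.latentDegree - 1 → nu R.obsProb u I S ≤ β) :
    R.fieldCov u S ≤ R.width * (2 ^ (R.latentDegree - 1) * β) := by
  have hβ0 : 0 ≤ β := by
    have := hβ ∅ (by simp) (by simp)
    rwa [nu_empty] at this
  have h1 : R.fieldCov u S = ∑ T : Finset (Fin n) with u ∈ T, R.fourier T
      * ∑ z, R.obsProb z * ((up u z - condUp R.obsProb u S z) * walsh (T.erase u) z) := by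
    unfold fieldCov localField
    simp_rw [Finset.mul_sum]
    rw [Finset.sum_comm]
    exact Finset.sum_congr rfl fun T _ => Finset.sum_congr rfl fun z _ => by ring
  have h2 : ∀ T ∈ univ.filter (fun T : Finset (Fin n) => u ∈ T), R.fourier T
      * ∑ z, R.obsProb z * ((up u z - condUp R.obsProb u S z) * walsh (T.erase u) z)
      ≤ |R.fourier T| * (2 ^ (R.latentDegree - 1) * β) := by
    intro T hT
    have huT := (mem_filter.mp hT).2
    by_cases h0 : R.fourier T = 0
    · simp [h0]
    refine (le_abs_self _).trans ?_
    rw [abs_mul]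
    refine mul_le_mul_of_nonneg_left ((R.abs_sum_sub_mul_walsh_le S _).trans ?_) (abs_nonneg _)
    have hcT : T.card ≤ R.latentDegree := by
      by_contra h
      exact h0 (R.fourier_eq_zero_of_card_gt hd (not_le.mp h))
    have hc : (T.erase u \ S).card ≤ R.latentDegree - 1 := by
      refine (card_le_card sdiff_subset).trans ?_
      rw [card_erase_of_mem huT]
      omega
    have := hβ (T.erase u \ S) (sdiff_subset_sdiff (R.erase_subset_nbhd huT h0) le_rfl) hc
    have h3 : (2 : ℝ) ^ (T.erase u \ S).card ≤ 2 ^ (R.latentDegree - 1) :=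
      pow_le_pow_right₀ (by norm_num) hc
    exact mul_le_mul h3 this (nu_nonneg R.obsProb_nonneg _ _ _) (by positivity)
  rw [h1]
  refine (Finset.sum_le_sum h2).trans ?_
  rw [← Finset.sum_mul]
  exact mul_le_mul_of_nonneg_right (R.sum_abs_fourier_le_width u) (by positivity)

/-- If `S` does not contain the neighbourhood of `u`, then some small set of further neighbours is
correlated with `u` given `S`. -/
theorem exists_nu_ge (hd : 0 < R.latentDegree) (hγ : 0 < R.width) {u : Fin n}
    {S : Finset (Fin n)} (huS : u ∉ S) (hS : ¬ R.nbhd u ⊆ S) :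
    2 ≤ R.latentDegree ∧ ∃ I ⊆ R.nbhd u \ S, I.card ≤ R.latentDegree - 1 ∧
      R.minPotential ^ 2 * Real.exp (-2 * R.width) ^ (R.maxDegree + 1)
        / (2 ^ R.latentDegree * R.width) ≤ nu R.obsProb u I S := by
  obtain ⟨v, hv, hvS⟩ := Finset.not_subset.mp hS
  obtain ⟨hvu, T, huT, hvT, hT⟩ := R.mem_nbhd.mp hv
  refine ⟨?_, ?_⟩
  · by_contra h
    refine hT (R.fourier_eq_zero_of_card_gt hd (lt_of_lt_of_le (not_le.mp h) ?_))
    exact Finset.one_lt_card.mpr ⟨v, hvT, u, huT, hvu⟩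
  -- Taking the best small set makes its own `nu` an admissible `β` in the upper bound for the
  -- covariance.
  obtain ⟨I, hI, hmax⟩ := Finset.exists_max_image
    ((R.nbhd u \ S).powerset.filter fun I => I.card ≤ R.latentDegree - 1)
    (fun I => nu R.obsProb u I S) ⟨∅, by simp⟩
  rw [mem_filter, mem_powerset] at hI
  refine ⟨I, hI.1, hI.2, ?_⟩
  have h1 := R.fieldCov_le hd (u := u) (S := S) (β := nu R.obsProb u I S)
    fun I' h h' => hmax I' (mem_filter.mpr ⟨mem_powerset.mpr h, h'⟩)
  have h2 := R.fieldCov_ge huT hvT hvu huS hvS hT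
  have h3 : R.minPotential ^ 2 ≤ R.fourier T ^ 2 := by
    rw [← sq_abs (R.fourier T)]
    have := R.minPotential_nonneg
    gcongr
    exact R.minPotential_le ⟨u, huT⟩ hT
  have h4 : (2 : ℝ) ^ R.latentDegree = 2 * 2 ^ (R.latentDegree - 1) := by
    rw [← pow_succ', Nat.sub_add_cancel hd]
  rw [div_le_iff₀ (by positivity), h4]
  have h5 : R.minPotential ^ 2 * (Real.exp (-2 * R.width) ^ (R.maxDegree + 1) / 2)
      ≤ R.fourier T ^ 2 * (Real.exp (-2 * R.width) ^ (R.maxDegree + 1) / 2) := by gcongr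
  nlinarith

end RBM

/-! ### Interpolation of products by products of few factors -/

section Interpolation

/-- If each signed measure `q z` is carried by at most `k` points, then the moments of a product of
many bounded coordinates are controlled by those of the products of at most `k` of them. -/
theorem sum_abs_moment_le {ζ η ι : Type*} [Fintype ζ] [Fintype η] [DecidableEq ι]
    (φ : ζ → ι → η → ℝ) (k : ℕ) (I : Finset ι) :
    ∀ (q : ζ → η → ℝ) (P : ζ → Finset (ι → ℝ)) (β : ℝ), (∀ z, (P z).card ≤ k) →
      (∀ z, ∀ p ∈ P z, ∀ i, |p i| ≤ 1) → (∀ z y, q z y ≠ 0 → (fun i => φ z i y) ∈ P z) →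
      (∀ A ⊆ I, A.card ≤ k → ∑ z, |∑ y, q z y * ∏ i ∈ A, φ z i y| ≤ β) →
      ∑ z, |∑ y, q z y * ∏ i ∈ I, φ z i y| ≤ (1 + 2 * I.card) ^ k * β := by
  induction k generalizing I with
  | zero =>
    intro q P β hP _ hq hβ
    have h0 : ∀ z y, q z y = 0 := fun z y => by
      by_contra h
      have h1 := hq z y h
      rw [Finset.card_eq_zero.mp (Nat.le_zero.mp (hP z))] at h1
      simp at h1
    have := hβ ∅ (by simp) (by simp)
    simp only [h0, zero_mul, Finset.sum_const_zero, abs_zero, pow_zero, one_mul] at this ⊢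
    exact this
  | succ k ihk =>
    induction I using Finset.induction_on with
    | empty =>
      intro q P β hP _ hq hβ
      simpa using hβ ∅ (by simp) (by simp)
    | insert i I hi ihI =>
      intro q P β hP hP1 hq hβ
      -- One support point of each measure, to be removed; the value `0` is a dummy for an empty
      -- support.
      set a : ζ → ι → ℝ := fun z => if h : (P z).Nonempty then h.choose else 0 with ha
      have ha1 : ∀ z, |a z i| ≤ 1 := fun z => by
        simp only [ha]
        split_ifs with h
        · exact hP1 z _ h.choose_spec i
        · simp
      have hc : ∀ z, ((P z).erase (a z)).card ≤ k := fun z => by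
        by_cases h : (P z).Nonempty
        · have hm : a z ∈ P z := by simp only [ha, dif_pos h]; exact h.choose_spec
          rw [card_erase_of_mem hm]
          have := hP z
          omega
        · rw [Finset.not_nonempty_iff_eq_empty.mp h]; simp
      -- Multiplication by `φ z i y - a z i` kills the mass at the point `a z`, so the new measure
      -- has one support point fewer. Its short moments are those of `q` with and without `i`,
      -- whence `2 * β`.
      have h1 := ihk I (fun z y => q z y * (φ z i y - a z i)) (fun z => (P z).erase (a z)) (2 * β) hc
        (fun z p hp => hP1 z p (mem_of_mem_erase hp))
        (fun z y h => mem_erase.mpr ⟨fun he => right_ne_zero_of_mul h (by rw [← he]; simp),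
          hq z y (left_ne_zero_of_mul h)⟩)
        (by
          intro A hA hAk
          have hiA : i ∉ A := fun h => hi (hA h)
          have h2 := hβ (insert i A) (insert_subset_insert i hA)
            ((card_insert_le i A).trans (by omega))
          have h3 := hβ A (hA.trans (subset_insert i I)) (by omega)
          rw [two_mul]
          refine le_trans ?_ (add_le_add h2 h3)
          rw [← Finset.sum_add_distrib]
          refine Finset.sum_le_sum fun z _ => ?_
          have h4 : ∑ y, q z y * (φ z i y - a z i) * ∏ j ∈ A, φ z j y
              = ∑ y, q z y * ∏ j ∈ insert i A, φ z j y
                - a z i * ∑ y, q z y * ∏ j ∈ A, φ z j y := by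
            rw [Finset.mul_sum, ← Finset.sum_sub_distrib]
            refine Finset.sum_congr rfl fun y _ => ?_
            rw [Finset.prod_insert hiA]; ring
          rw [h4]
          refine (abs_sub _ _).trans ?_
          rw [abs_mul]
          have := mul_le_of_le_one_left (abs_nonneg (∑ y, q z y * ∏ j ∈ A, φ z j y)) (ha1 z)
          linarith)
      have h2 := ihI q P β hP hP1 hq
        (fun A hA hAk => hβ A (hA.trans (subset_insert i I)) hAk)
      have hβ0 : 0 ≤ β := le_trans (Finset.sum_nonneg fun z _ => abs_nonneg _)
        (hβ ∅ (by simp) (by simp))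
      have h3 : ∑ z, |∑ y, q z y * ∏ j ∈ insert i I, φ z j y|
          ≤ ∑ z, |∑ y, q z y * (φ z i y - a z i) * ∏ j ∈ I, φ z j y|
            + ∑ z, |∑ y, q z y * ∏ j ∈ I, φ z j y| := by
        rw [← Finset.sum_add_distrib]
        refine Finset.sum_le_sum fun z _ => ?_
        have h4 : ∑ y, q z y * ∏ j ∈ insert i I, φ z j y
            = ∑ y, q z y * (φ z i y - a z i) * ∏ j ∈ I, φ z j y
              + a z i * ∑ y, q z y * ∏ j ∈ I, φ z j y := by
          rw [Finset.mul_sum, ← Finset.sum_add_distrib]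
          refine Finset.sum_congr rfl fun y _ => ?_
          rw [Finset.prod_insert hi]; ring
        rw [h4]
        refine (abs_add_le _ _).trans ?_
        rw [abs_mul]
        have := mul_le_of_le_one_left (abs_nonneg (∑ y, q z y * ∏ j ∈ I, φ z j y)) (ha1 z)
        linarith
      rw [card_insert_of_notMem hi]
      push_cast
      set t : ℝ := (I.card : ℝ)
      have ht : 0 ≤ t := Nat.cast_nonneg _
      -- The recursion is `c (k + 1) (t + 1) ≤ 2 * c k t + c (k + 1) t`, and `c k t = (1 + 2 * t) ^
      -- k` satisfies it.
      calc _ ≤ (1 + 2 * t) ^ k * (2 * β) + (1 + 2 * t) ^ (k + 1) * β := by linarith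
        _ = (1 + 2 * (t + 1)) * (1 + 2 * t) ^ k * β := by ring
        _ ≤ (1 + 2 * (t + 1)) * (1 + 2 * (t + 1)) ^ k * β := by gcongr; linarith
        _ = _ := by ring

end Interpolation

/-! ### Conditioning on the latent variables -/

section Product

variable {n : ℕ}

theorem marg_prod (e : Fin n → ℤˣ → ℝ) (A : Finset (Fin n)) (z : Fin n → ℤˣ) :
    marg (fun x => ∏ i, e i (x i)) A z = ∏ i, if i ∈ A then e i (z i) else e i 1 + e i (-1) := by
  have h1 : ∀ x : Fin n → ℤˣ, (if ∀ i ∈ A, x i = z i then ∏ i, e i (x i) else 0)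
      = ∏ i, if i ∈ A ∧ x i ≠ z i then 0 else e i (x i) := by
    intro x
    split_ifs with h
    · exact Finset.prod_congr rfl fun i _ => by rw [if_neg fun h' => h'.2 (h i h'.1)]
    · push Not at h
      obtain ⟨i, hi, hx⟩ := h
      refine (Finset.prod_eq_zero (mem_univ i) ?_).symm
      rw [if_pos ⟨hi, hx⟩]
  unfold marg
  simp_rw [h1]
  have h2 := Finset.prod_univ_sum (fun _ : Fin n => (univ : Finset ℤˣ))
    (fun i b => if i ∈ A ∧ b ≠ z i then 0 else e i b)
  rw [Fintype.piFinset_univ] at h2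
  rw [← h2]
  refine Finset.prod_congr rfl fun i _ => ?_
  rw [sum_spins]
  by_cases hi : i ∈ A
  · rcases Int.units_eq_one_or (z i) with h | h <;> simp [hi, h, show ¬ (-1 : ℤˣ) = 1 by decide,
      show ¬ (1 : ℤˣ) = -1 by decide]
  · simp [hi]

/-- Under a product law the sites of `I` are independent of those of `S`, so fixing them multiplies
the weight by their normalised single-site weights. -/
theorem marg_prod_union {e : Fin n → ℤˣ → ℝ} {S I : Finset (Fin n)} (hSI : Disjoint S I)
    (he : ∀ i ∈ I, 0 < e i 1 + e i (-1)) (z : Fin n → ℤˣ) :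
    marg (fun x => ∏ i, e i (x i)) (S ∪ I) z
      = marg (fun x => ∏ i, e i (x i)) S z * ∏ i ∈ I, e i (z i) / (e i 1 + e i (-1)) := by
  have h1 : ∏ i ∈ I, e i (z i) / (e i 1 + e i (-1))
      = ∏ i, if i ∈ I then e i (z i) / (e i 1 + e i (-1)) else 1 := by
    rw [Finset.prod_ite_mem, univ_inter]
  rw [marg_prod, marg_prod, h1, ← Finset.prod_mul_distrib]
  refine Finset.prod_congr rfl fun i _ => ?_
  by_cases hI : i ∈ I
  · have hS : i ∉ S := fun h => Finset.disjoint_left.mp hSI h hI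
    have := he i hI
    simp [hI, hS]
    field_simp
  · simp [hI]

end Product

namespace RBM

variable {n m : ℕ} (R : RBM n m)

/-- The field at the observed variable `i`, given the latent variables. -/
noncomputable def latentField (i : Fin n) (y : Fin m → ℤˣ) : ℝ := (∑ j, R.J i j * spin (y j)) + R.h i

/-- The conditional probability of `X i = b`, given the latent variables. -/
noncomputable def latentCond (i : Fin n) (b : ℤˣ) (y : Fin m → ℤˣ) : ℝ :=
  Real.exp (spin b * R.latentField i y)
    / (Real.exp (spin 1 * R.latentField i y) + Real.exp (spin (-1) * R.latentField i y))

theorem abs_latentCond_le (i : Fin n) (b : ℤˣ) (y : Fin m → ℤˣ) : |R.latentCond i b y| ≤ 1 := by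
  unfold latentCond
  rw [abs_of_nonneg (by positivity)]
  refine div_le_one_of_le₀ ?_ (by positivity)
  have h1 := Real.exp_pos (spin 1 * R.latentField i y)
  have h2 := Real.exp_pos (spin (-1) * R.latentField i y)
  rcases Int.units_eq_one_or b with h | h <;> rw [h] <;> linarith

theorem jointProb_eq_prod (x : Fin n → ℤˣ) (y : Fin m → ℤˣ) :
    R.jointProb x y = Real.exp (∑ j, R.g j * spin (y j)) / R.partition
      * ∏ i, Real.exp (spin (x i) * R.latentField i y) := by
  rw [jointProb_eq, ← Real.exp_sum, weight, Real.exp_add, mul_comm (Real.exp _), mul_div_right_comm]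
  congr 2
  rw [← Finset.sum_add_distrib]
  refine Finset.sum_congr rfl fun i _ => ?_
  rw [latentField, mul_add, Finset.mul_sum]
  congr 1
  · exact Finset.sum_congr rfl fun j _ => by ring
  · ring

theorem marg_const_mul (c : ℝ) (w : (Fin n → ℤˣ) → ℝ) (A : Finset (Fin n)) (z : Fin n → ℤˣ) :
    marg (fun x => c * w x) A z = c * marg w A z := by
  unfold marg
  rw [Finset.mul_sum]
  exact Finset.sum_congr rfl fun y _ => by split_ifs <;> simp

theorem marg_jointProb_union {S I : Finset (Fin n)} (hSI : Disjoint S I) (y : Fin m → ℤˣ)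
    (z : Fin n → ℤˣ) :
    marg (fun x => R.jointProb x y) (S ∪ I) z
      = marg (fun x => R.jointProb x y) S z * ∏ i ∈ I, R.latentCond i (z i) y := by
  simp_rw [jointProb_eq_prod, marg_const_mul]
  rw [marg_prod_union (e := fun i b => Real.exp (spin b * R.latentField i y)) hSI
    fun i _ => by positivity]
  simp only [latentCond, mul_assoc]

/-- For fixed latent spins, inserting the indicator `up u` alters only the factor at `u`, so the law
remains an unnormalised product and the factors at the sites of `I` are unchanged. -/
theorem marg_up_jointProb_union {u : Fin n} {S I : Finset (Fin n)} (hSI : Disjoint S I)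
    (hu : u ∉ I) (y : Fin m → ℤˣ) (z : Fin n → ℤˣ) :
    marg (fun x => up u x * R.jointProb x y) (S ∪ I) z
      = marg (fun x => up u x * R.jointProb x y) S z * ∏ i ∈ I, R.latentCond i (z i) y := by
  set c := Real.exp (∑ j, R.g j * spin (y j)) / R.partition
  set e : Fin n → ℤˣ → ℝ := fun i b =>
    (if i = u then (if b = 1 then 1 else 0) else 1) * Real.exp (spin b * R.latentField i y) with he
  have h1 : ∀ x : Fin n → ℤˣ, up u x * R.jointProb x y = c * ∏ i, e i (x i) := by
    intro x
    rw [jointProb_eq_prod, he, Finset.prod_mul_distrib, Finset.prod_ite_eq' univ u]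
    simp only [mem_univ, if_true, up, c]
    ring
  have h2 : ∀ i ∈ I, ∀ b, e i b = Real.exp (spin b * R.latentField i y) := by
    intro i hi b
    simp [he, show i ≠ u by rintro rfl; exact hu hi]
  simp_rw [h1, marg_const_mul]
  rw [marg_prod_union hSI fun i hi => by rw [h2 i hi, h2 i hi]; positivity, mul_assoc]
  congr 2
  refine Finset.prod_congr rfl fun i hi => ?_
  simp only [h2 i hi, latentCond]

theorem marg_sum {κ : Type*} [Fintype κ] (w : κ → (Fin n → ℤˣ) → ℝ) (A : Finset (Fin n))
    (z : Fin n → ℤˣ) : marg (fun x => ∑ y, w y x) A z = ∑ y, marg (w y) A z := by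
  unfold marg
  rw [Finset.sum_comm]
  exact Finset.sum_congr rfl fun x _ => by split_ifs <;> simp

/-- Among the neighbours of `u`, a few carry a fair share of the information of many. -/
theorem exists_small_subset {u : Fin n} {I S : Finset (Fin n)} (hI : I ⊆ R.nbhd u \ S) :
    ∃ A ⊆ I, A.card ≤ 2 ^ R.latentCount ∧
      nu R.obsProb u I S ≤ (1 + 2 * I.card) ^ (2 ^ R.latentCount) * nu R.obsProb u A S := by
  set U : Finset (Fin m) := univ.filter fun j => ∃ i ∈ R.nbhd u, R.J i j ≠ 0 with hU
  have hUs : U.card ≤ R.latentCount :=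
    Finset.le_sup (f := fun u : Fin n =>
      (univ.filter fun j : Fin m => ∃ i ∈ R.nbhd u, R.J i j ≠ 0).card) (mem_univ u)
  -- Set to `0` off the neighbourhood, so that the whole vector `φ z · y` depends on `y` only
  -- through the latent variables in `U` and takes at most `2 ^ |U|` values.
  set φ : (Fin n → ℤˣ) → Fin n → (Fin m → ℤˣ) → ℝ := fun z i y =>
    if i ∈ R.nbhd u then R.latentCond i (z i) y else 0 with hφ
  set ext : (U → ℤˣ) → Fin m → ℤˣ := fun η j => if h : j ∈ U then η ⟨j, h⟩ else 1 with hext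
  have hφext : ∀ z y, (fun i => φ z i (ext fun j => y j)) = fun i => φ z i y := by
    intro z y
    funext i
    simp only [hφ]
    split_ifs with hi
    · have : R.latentField i (ext fun j => y j) = R.latentField i y := by
        unfold latentField
        congr 1
        refine Finset.sum_congr rfl fun j _ => ?_
        by_cases hJ : R.J i j = 0
        · simp [hJ]
        · have hj : j ∈ U := by simp only [hU, mem_filter, mem_univ, true_and]; exact ⟨i, hi, hJ⟩
          simp [hext, hj]
      unfold latentCond
      rw [this]
    · rfl
  set q : (Fin n → ℤˣ) → (Fin m → ℤˣ) → ℝ := fun z y =>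
    marg (fun x => up u x * R.jointProb x y) S z
      - marg (fun x => R.jointProb x y) S z * condUp R.obsProb u S z with hq
  have key : ∀ A ⊆ I, nu R.obsProb u A S
      = 2 ^ S.card / 2 ^ n * ∑ z, |∑ y, q z y * ∏ i ∈ A, φ z i y| := by
    -- Integrate the latent variables back in: for fixed `y` both weights on `S ∪ A` are weights on
    -- `S` times the same product over `A`, and `q z y` collects the former.
    intro A hA
    have hAN : A ⊆ R.nbhd u \ S := hA.trans hI
    have hSA : Disjoint S A := Finset.disjoint_left.mpr fun i hS hA' =>
      (mem_sdiff.mp (hAN hA')).2 hS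
    have huA : u ∉ A := fun h => R.notMem_nbhd_self u (mem_sdiff.mp (hAN h)).1
    rw [nu_eq_sum R.obsProb_nonneg u hSA]
    congr 1
    refine Finset.sum_congr rfl fun z _ => ?_
    congr 1
    have h1 : ∀ y, ∏ i ∈ A, φ z i y = ∏ i ∈ A, R.latentCond i (z i) y := fun y =>
      Finset.prod_congr rfl fun i hi => by simp only [hφ, if_pos (mem_sdiff.mp (hAN hi)).1]
    have h2 : marg (fun x => up u x * R.obsProb x) (S ∪ A) z
        = ∑ y, marg (fun x => up u x * R.jointProb x y) (S ∪ A) z := by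
      rw [← marg_sum (fun y x => up u x * R.jointProb x y)]
      simp only [obsProb, Finset.mul_sum]
    have h3 : marg R.obsProb (S ∪ A) z = ∑ y, marg (fun x => R.jointProb x y) (S ∪ A) z := by
      rw [← marg_sum (fun y x => R.jointProb x y)]
      rfl
    rw [h2, h3, Finset.sum_mul, ← Finset.sum_sub_distrib]
    refine Finset.sum_congr rfl fun y _ => ?_
    rw [R.marg_up_jointProb_union hSA huA, R.marg_jointProb_union hSA, h1]
    simp only [hq]
    ring
  obtain ⟨A, hA, hmax⟩ := Finset.exists_max_image
    (I.powerset.filter fun A => A.card ≤ 2 ^ R.latentCount)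
    (fun A => ∑ z, |∑ y, q z y * ∏ i ∈ A, φ z i y|) ⟨∅, by simp⟩
  rw [mem_filter, mem_powerset] at hA
  refine ⟨A, hA.1, hA.2, ?_⟩
  -- The support points of `q z` are indexed by the spins of the latent variables in `U`, at most `2
  -- ^ s` of them.
  have h := sum_abs_moment_le φ (2 ^ R.latentCount) I q
    (fun z => univ.image fun η : U → ℤˣ => fun i => φ z i (ext η))
    (∑ z, |∑ y, q z y * ∏ i ∈ A, φ z i y|)
    (fun z => by
      refine card_image_le.trans ?_
      rw [card_univ, Fintype.card_fun, Fintype.card_units_int, Fintype.card_coe]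
      exact Nat.pow_le_pow_right (by norm_num) hUs)
    (fun z p hp i => by
      obtain ⟨η, -, rfl⟩ := mem_image.mp hp
      simp only [hφ]
      split_ifs
      · exact R.abs_latentCond_le _ _ _
      · simp)
    (fun z y _ => mem_image.mpr ⟨fun j => y j, mem_univ _, hφext z y⟩)
    (fun B hB hBk => hmax B (mem_filter.mpr ⟨mem_powerset.mpr hB, hBk⟩))
  rw [key I le_rfl, key A hA.1]
  calc _ ≤ 2 ^ S.card / 2 ^ n * ((1 + 2 * (I.card : ℝ)) ^ 2 ^ R.latentCount
        * ∑ z, |∑ y, q z y * ∏ i ∈ A, φ z i y|) := by gcongr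
    _ = _ := by ring

end RBM

/-! ### The constants of the algorithm -/

namespace RBM

variable {n m : ℕ} (R : RBM n m)

theorem tau_pos (hd : 0 < R.latentDegree) (hγ : 0 < R.width)
    (hD : R.latentDegree ≤ R.maxDegree + 1) : 0 < R.tau := by
  have h1 := R.minPotential_pos hγ
  have h2 : 0 < R.maxDegree.choose (R.latentDegree - 1) := Nat.choose_pos (by omega)
  unfold tau
  positivity

theorem tau'_pos (hd : 0 < R.latentDegree) (hγ : 0 < R.width)
    (hD : R.latentDegree ≤ R.maxDegree + 1) : 0 < R.tau' := by
  have h1 := R.tau_pos hd hγ hD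
  unfold tau'
  positivity

theorem exp_neg_width_le_one : Real.exp (-2 * R.width) ≤ 1 :=
  Real.exp_le_one_iff.mpr (by linarith [R.width_nonneg])

/-- From `minPotential ≤ width` and `2 * width ≤ exp (2 * width)`; all other factors are at most `1`
or at least `1`, and `2 ^ (d + 1) ≥ 4`. It serves to make `L` large. -/
theorem tau_le (hd : 0 < R.latentDegree) (hγ : 0 < R.width)
    (hD : R.latentDegree ≤ R.maxDegree + 1) : R.tau ≤ 1 / 4 := by
  have h1 := R.minPotential_pos hγ
  have h2 : (1 : ℝ) ≤ R.maxDegree.choose (R.latentDegree - 1) :=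
    Nat.one_le_cast.mpr (Nat.choose_pos (by omega))
  have h3 : (1 : ℝ) ≤ (R.latentDegree : ℝ) ^ (4 * R.latentDegree) :=
    one_le_pow₀ (Nat.one_le_cast.mpr hd)
  have h4 : (4 : ℝ) ≤ 2 ^ (R.latentDegree + 1) := by
    calc (4 : ℝ) = 2 ^ 2 := by norm_num
      _ ≤ _ := pow_le_pow_right₀ (by norm_num) (by omega)
  have h5 : 2 * R.width ≤ Real.exp (2 * R.width) := by
    linarith [Real.add_one_le_exp (2 * R.width)]
  have h6 : Real.exp (-2 * R.width) ^ (R.latentDegree + R.maxDegree - 1) ≤ 1 :=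
    pow_le_one₀ (Real.exp_pos _).le R.exp_neg_width_le_one
  have h7 : 4 * R.minPotential ^ 2
      * Real.exp (-2 * R.width) ^ (R.latentDegree + R.maxDegree - 1)
      / ((R.latentDegree : ℝ) ^ (4 * R.latentDegree) * 2 ^ (R.latentDegree + 1)
      * (R.maxDegree.choose (R.latentDegree - 1) : ℝ) * R.width * Real.exp (2 * R.width))
      ≤ 4 * R.width ^ 2 * 1 / (1 * 4 * 1 * R.width * (2 * R.width)) := by
    have := R.minPotential_le_width hγ
    gcongr
  unfold tau
  have h8 : 4 * R.width ^ 2 * 1 / (1 * 4 * 1 * R.width * (2 * R.width)) = 1 / 2 := by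
    field_simp
  rw [h8] at h7
  linarith

theorem tau'_le_tau (hd : 0 < R.latentDegree) (hγ : 0 < R.width)
    (hD : R.latentDegree ≤ R.maxDegree + 1) :
    R.tau' ≤ 1 / (4 * (R.latentDegree : ℝ)) ^ (2 ^ R.latentCount) * R.tau := by
  have h1 := R.tau_pos hd hγ hD
  have hd1 : (1 : ℝ) ≤ R.latentDegree := Nat.one_le_cast.mpr hd
  have h2 : (1 / (R.latentDegree : ℝ)) ^ (2 ^ R.latentCount * (2 ^ R.latentCount + 1)) ≤ 1 :=
    pow_le_one₀ (by positivity) ((div_le_one (by positivity)).mpr hd1)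
  unfold tau'
  calc _ ≤ 1 / (4 * (R.latentDegree : ℝ)) ^ (2 ^ R.latentCount) * 1 * R.tau := by gcongr
    _ = _ := by ring

theorem tau'_le (hd : 0 < R.latentDegree) (hγ : 0 < R.width)
    (hD : R.latentDegree ≤ R.maxDegree + 1) : R.tau' ≤ 1 / 4 ^ (2 ^ R.latentCount) * (1 / 4) := by
  refine (R.tau'_le_tau hd hγ hD).trans ?_
  have hd1 : (1 : ℝ) ≤ R.latentDegree := Nat.one_le_cast.mpr hd
  have := R.tau_le hd hγ hD
  have := R.tau_pos hd hγ hD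
  gcongr
  linarith

theorem tau'_le_one (hd : 0 < R.latentDegree) (hγ : 0 < R.width)
    (hD : R.latentDegree ≤ R.maxDegree + 1) : R.tau' ≤ 1 := by
  refine (R.tau'_le hd hγ hD).trans ?_
  have : (1 : ℝ) / 4 ^ (2 ^ R.latentCount) ≤ 1 :=
    (div_le_one (by positivity)).mpr (one_le_pow₀ (by norm_num))
  linarith

theorem L_ge (hd : 0 < R.latentDegree) (hγ : 0 < R.width)
    (hD : R.latentDegree ≤ R.maxDegree + 1) : 128 * 16 ^ (2 ^ R.latentCount) ≤ R.L := by
  have h1 := R.tau'_pos hd hγ hD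
  have h2 := R.tau'_le hd hγ hD
  unfold L
  rw [le_div_iff₀ (by positivity)]
  have h3 : R.tau' ^ 2 ≤ (1 / 4 ^ (2 ^ R.latentCount) * (1 / 4)) ^ 2 := by gcongr
  have h4 : (16 : ℝ) ^ (2 ^ R.latentCount) = (4 ^ (2 ^ R.latentCount)) ^ 2 := by
    rw [← pow_mul, mul_comm, pow_mul]; norm_num
  calc (128 : ℝ) * 16 ^ (2 ^ R.latentCount) * R.tau' ^ 2
      ≤ 128 * 16 ^ (2 ^ R.latentCount) * (1 / 4 ^ (2 ^ R.latentCount) * (1 / 4)) ^ 2 := by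
        gcongr
    _ = 8 := by rw [h4]; field_simp; norm_num

theorem L_ge_128 (hd : 0 < R.latentDegree) (hγ : 0 < R.width)
    (hD : R.latentDegree ≤ R.maxDegree + 1) : 128 ≤ R.L := by
  have := R.L_ge hd hγ hD
  have h : (1 : ℝ) ≤ 16 ^ (2 ^ R.latentCount) := one_le_pow₀ (by norm_num)
  linarith

theorem two_pow_le_L (hd : 0 < R.latentDegree) (hγ : 0 < R.width)
    (hD : R.latentDegree ≤ R.maxDegree + 1) : (2 : ℝ) ^ R.latentCount ≤ R.L := by
  have h1 := R.L_ge hd hγ hD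
  have h2 : (2 ^ R.latentCount : ℕ) ≤ 2 ^ (2 ^ R.latentCount) := Nat.lt_two_pow_self.le
  have h3 : (2 : ℝ) ^ R.latentCount ≤ 2 ^ (2 ^ R.latentCount) := by exact_mod_cast h2
  have h4 : (2 : ℝ) ^ (2 ^ R.latentCount) ≤ 16 ^ (2 ^ R.latentCount) := by gcongr; norm_num
  have : (0 : ℝ) < 16 ^ (2 ^ R.latentCount) := by positivity
  linarith

/-- For `d ≥ 2` the exponent `d + D - 1` is at least `D + 1`, and `d ^ (4 d) ≥ 2` absorbs the
remaining numerical factor. -/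
theorem two_mul_tau_le (hd : 2 ≤ R.latentDegree) (hγ : 0 < R.width)
    (hD : R.latentDegree ≤ R.maxDegree + 1) :
    2 * R.tau ≤ R.minPotential ^ 2 * Real.exp (-2 * R.width) ^ (R.maxDegree + 1)
        / (2 ^ R.latentDegree * R.width) := by
  have h1 := R.minPotential_pos hγ
  have h2 : (1 : ℝ) ≤ R.maxDegree.choose (R.latentDegree - 1) :=
    Nat.one_le_cast.mpr (Nat.choose_pos (by omega))
  have h3 : (2 : ℝ) ≤ (R.latentDegree : ℝ) ^ (4 * R.latentDegree) := by
    have hd2 : (2 : ℝ) ≤ R.latentDegree := by exact_mod_cast hd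
    exact hd2.trans (le_self_pow₀ (by linarith) (by omega))
  have h4 : Real.exp (-2 * R.width) ^ (R.latentDegree + R.maxDegree - 1)
      ≤ Real.exp (-2 * R.width) ^ (R.maxDegree + 1) :=
    pow_le_pow_of_le_one (Real.exp_pos _).le R.exp_neg_width_le_one (by omega)
  have h5 : 1 ≤ Real.exp (2 * R.width) := Real.one_le_exp (by linarith)
  unfold tau
  rw [← mul_assoc]
  calc _ ≤ 2 * (1 / 2) * (4 * R.minPotential ^ 2 * Real.exp (-2 * R.width) ^ (R.maxDegree + 1)
        / (2 * 2 ^ (R.latentDegree + 1) * 1 * R.width * 1)) := by gcongr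
    _ = _ := by rw [pow_succ (2 : ℝ)]; field_simp; norm_num

/-- As long as `S` misses a neighbour of `u`, some set of at most `2 ^ s` neighbours is visibly
correlated with `u` given `S`. -/
theorem exists_nu_ge_two_mul_tau' (hd : 0 < R.latentDegree) (hγ : 0 < R.width)
    (hD : R.latentDegree ≤ R.maxDegree + 1) {u : Fin n} {S : Finset (Fin n)} (huS : u ∉ S)
    (hS : ¬ R.nbhd u ⊆ S) :
    ∃ A ⊆ R.nbhd u \ S, A.card ≤ 2 ^ R.latentCount ∧ 2 * R.tau' ≤ nu R.obsProb u A S := by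
  obtain ⟨hd2, I, hI, hIc, hInu⟩ := R.exists_nu_ge hd hγ huS hS
  obtain ⟨A, hA, hAc, hAnu⟩ := R.exists_small_subset hI
  refine ⟨A, hA.trans hI, hAc, ?_⟩
  have h0 := nu_nonneg R.obsProb_nonneg u A S
  -- The interpolation base: `|I| ≤ d - 1` gives `1 + 2 |I| ≤ 4 d`, the base of the first factor of
  -- `τ'`.
  have h1 : (1 + 2 * I.card : ℝ) ≤ 4 * R.latentDegree := by
    have : 1 + 2 * I.card ≤ 4 * R.latentDegree := by omega
    exact_mod_cast this
  have h2 := R.two_mul_tau_le hd2 hγ hD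
  have h3 : 2 * R.tau ≤ (4 * R.latentDegree : ℝ) ^ (2 ^ R.latentCount) * nu R.obsProb u A S := by
    refine (h2.trans hInu).trans (hAnu.trans ?_)
    gcongr
  have hd1 : (0 : ℝ) < R.latentDegree := Nat.cast_pos.mpr hd
  have h4 := R.tau'_le_tau hd hγ hD
  calc 2 * R.tau' ≤ 1 / (4 * (R.latentDegree : ℝ)) ^ (2 ^ R.latentCount) * (2 * R.tau) := by
        linarith
    _ ≤ 1 / (4 * (R.latentDegree : ℝ)) ^ (2 ^ R.latentCount)
        * ((4 * R.latentDegree : ℝ) ^ (2 ^ R.latentCount) * nu R.obsProb u A S) := by gcongr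
    _ = _ := by field_simp

end RBM

/-! ### The empirical law -/

section Empirical

variable {n M : ℕ}

/-- The empirical law of the samples. -/
noncomputable def emp (x : Fin M → Fin n → ℤˣ) (z : Fin n → ℤˣ) : ℝ :=
  ((univ.filter fun k => x k = z).card : ℝ) / M

theorem emp_nonneg (x : Fin M → Fin n → ℤˣ) (z : Fin n → ℤˣ) : 0 ≤ emp x z := by
  unfold emp; positivity

theorem sum_emp_mul (x : Fin M → Fin n → ℤˣ) (F : (Fin n → ℤˣ) → ℝ) :
    ∑ z, emp x z * F z = 1 / (M : ℝ) * ∑ k, F (x k) := by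
  have h : ∀ z, emp x z * F z = 1 / (M : ℝ) * ∑ k, if x k = z then F z else 0 := by
    intro z
    unfold emp
    rw [← Finset.sum_filter, Finset.sum_const, nsmul_eq_mul]
    ring
  simp_rw [h]
  rw [← Finset.mul_sum, Finset.sum_comm]
  simp

theorem sum_emp (hM : M ≠ 0) (x : Fin M → Fin n → ℤˣ) : ∑ z, emp x z = 1 := by
  have h := sum_emp_mul x fun _ => 1
  simp only [mul_one] at h
  rw [h]
  simp [hM]

theorem marg_emp (x : Fin M → Fin n → ℤˣ) (A : Finset (Fin n)) (z : Fin n → ℤˣ) :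
    marg (emp x) A z = ((univ.filter fun k => ∀ i ∈ A, x k i = z i).card : ℝ) / M := by
  have h := sum_emp_mul x fun y => if ∀ i ∈ A, y i = z i then 1 else 0
  rw [Finset.sum_boole] at h
  unfold marg
  rw [Finset.sum_congr rfl fun y _ => ?_, h]
  · ring
  · split_ifs <;> simp

theorem marg_up_emp (x : Fin M → Fin n → ℤˣ) (u : Fin n) (A : Finset (Fin n)) (z : Fin n → ℤˣ) :
    marg (fun y => up u y * emp x y) A z
      = ((univ.filter fun k => x k u = 1 ∧ ∀ i ∈ A, x k i = z i).card : ℝ) / M := by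
  have h := sum_emp_mul x fun y => if y u = 1 ∧ ∀ i ∈ A, y i = z i then 1 else 0
  rw [Finset.sum_boole] at h
  unfold marg up
  rw [Finset.sum_congr rfl fun y _ => ?_, h]
  · ring
  · by_cases h1 : y u = 1 <;> by_cases h2 : ∀ i ∈ A, y i = z i <;> simp [h1, h2]

/-- Averaging `F` over the cells of `S` does not change its mean. -/
theorem sum_mul_marg_div {w : (Fin n → ℤˣ) → ℝ} (hw : ∀ y, 0 ≤ w y) (S : Finset (Fin n))
    {F : (Fin n → ℤˣ) → ℝ} (hF : ∀ y, 0 ≤ F y) (hF1 : ∀ y, F y ≤ 1) :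
    ∑ z, w z * (marg (fun y => w y * F y) S z / marg w S z) = ∑ z, w z * F z := by
  have hD : DetBy (fun z => marg (fun y => w y * F y) S z / marg w S z) S := fun y z h => by
    simp only [detBy_marg _ S y z h]
  have h1 := sum_marg_mul w hD
  have h2 := sum_marg_mul (fun y => w y * F y) (A := S) (F := fun _ => 1) fun _ _ _ => rfl
  simp only [mul_one] at h2
  have h3 : ∀ z, marg w S z * (marg (fun y => w y * F y) S z / marg w S z)
      = marg (fun y => w y * F y) S z := by
    intro z
    by_cases h : marg w S z = 0
    · have h4 := marg_nonneg (fun y => mul_nonneg (hw y) (hF y)) S z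
      have h5 : marg (fun y => w y * F y) S z ≤ marg w S z :=
        marg_mono (fun y => mul_le_of_le_one_right (hw y) (hF1 y)) S z
      rw [h, zero_mul]; linarith
    · field_simp
  simp_rw [h3] at h1
  exact mul_left_cancel₀ (by positivity) (h1.symm.trans h2)

theorem abs_condUp_sub_le {w : (Fin n → ℤˣ) → ℝ} (hw : ∀ y, 0 ≤ w y) (u : Fin n)
    (S T : Finset (Fin n)) (z : Fin n → ℤˣ) : |condUp w u T z - condUp w u S z| ≤ 1 := by
  have h1 := condUp_nonneg hw u S z
  have h2 := condUp_nonneg hw u T z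
  have h3 := condUp_le_one hw u S z
  have h4 := condUp_le_one hw u T z
  exact abs_le.mpr ⟨by linarith, by linarith⟩

/-- Overwrite `z` with `G` on `I`. -/
def overwrite (I : Finset (Fin n)) (G : I → ℤˣ) (z : Fin n → ℤˣ) : Fin n → ℤˣ :=
  fun i => if h : i ∈ I then G ⟨i, h⟩ else z i

theorem agree_overwrite {I S : Finset (Fin n)} (hIS : Disjoint S I) (G : I → ℤˣ)
    (y z : Fin n → ℤˣ) :
    (∀ i ∈ S ∪ I, y i = overwrite I G z i) ↔ (∀ i : I, y i = G i) ∧ ∀ i ∈ S, y i = z i := by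
  constructor
  · intro h
    refine ⟨fun i => ?_, fun i hi => ?_⟩
    · rw [h i (mem_union_right _ i.2)]; simp [overwrite]
    · rw [h i (mem_union_left _ hi)]; simp [overwrite, Finset.disjoint_left.mp hIS hi]
  · rintro ⟨h1, h2⟩ i hi
    unfold overwrite
    split_ifs with h
    · exact h1 ⟨i, h⟩
    · exact h2 i ((mem_union.mp hi).resolve_right h)

/-- Every `y` in the cell of `z` belongs to exactly one pattern `G` on `I`, so the sum over `G`
reassembles the cell of `S`. -/
theorem sum_abs_marg_overwrite {w : (Fin n → ℤˣ) → ℝ} (hw : ∀ y, 0 ≤ w y) (u : Fin n)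
    {I S : Finset (Fin n)} (hIS : Disjoint S I) (z : Fin n → ℤˣ) :
    ∑ G : I → ℤˣ, |marg (fun y => up u y * w y) (S ∪ I) (overwrite I G z)
        - condUp w u S z * marg w (S ∪ I) (overwrite I G z)|
      = marg (fun y => w y * |condUp w u (S ∪ I) y - condUp w u S y|) S z := by
  have h1 : ∀ G : I → ℤˣ, |marg (fun y => up u y * w y) (S ∪ I) (overwrite I G z)
        - condUp w u S z * marg w (S ∪ I) (overwrite I G z)|
      = ∑ y, if (∀ i ∈ S, y i = z i) ∧ (fun i : I => y i) = G then
          w y * |condUp w u (S ∪ I) y - condUp w u S y| else 0 := by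
    intro G
    rw [← marg_mul_condUp hw, mul_comm (condUp w u S z), ← mul_sub, abs_mul,
      abs_of_nonneg (marg_nonneg hw _ _)]
    unfold marg
    rw [Finset.sum_mul]
    refine Finset.sum_congr rfl fun y _ => ?_
    have h2 : ((∀ i ∈ S, y i = z i) ∧ (fun i : I => y i) = G)
        ↔ ∀ i ∈ S ∪ I, y i = overwrite I G z i := by
      rw [agree_overwrite hIS, funext_iff, and_comm]
    simp only [h2]
    split_ifs with h
    · rw [detBy_condUp w u (S ∪ I) _ _ h,
        detBy_condUp w u S y z ((agree_overwrite hIS G y z).mp h).2]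
    · simp
  simp_rw [h1]
  rw [Finset.sum_comm]
  unfold marg
  refine Finset.sum_congr rfl fun y _ => ?_
  by_cases h : ∀ i ∈ S, y i = z i
  · have h2 : ∀ G : I → ℤˣ, ((∀ i ∈ S, y i = z i) ∧ (fun i : I => y i) = G)
        ↔ (fun i : I => y i) = G := fun G => and_iff_right h
    simp only [h2, if_pos h, Finset.sum_ite_eq, mem_univ, if_true]
  · have h2 : ∀ G : I → ℤˣ, ¬((∀ i ∈ S, y i = z i) ∧ (fun i : I => y i) = G) := fun G h' => h h'.1
    simp only [h2, if_neg h, if_false, Finset.sum_const_zero]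

theorem empCond_and_eq {x : Fin M → Fin n → ℤˣ} (k : Fin M) {A B : (Fin n → ℤˣ) → Prop} :
    empCond x A B = ((univ.filter fun k => A (x k) ∧ B (x k)).card / (M : ℝ))
      / ((univ.filter fun k => B (x k)).card / (M : ℝ)) := by
  have hM : (M : ℝ) ≠ 0 := Nat.cast_ne_zero.mpr (by have := k.2; omega)
  rw [div_div_div_cancel_right₀ hM]
  unfold empCond
  congr!

theorem empCond_add_neg (x : Fin M → Fin n → ℤˣ) (u : Fin n) (A B : (Fin n → ℤˣ) → Prop) :
    empCond x (fun z => z u = 1 ∧ A z) B + empCond x (fun z => z u = -1 ∧ A z) B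
      = empCond x A B := by
  unfold empCond
  rw [← add_div]
  congr 1
  simp only [Finset.card_filter]
  push_cast
  rw [← Finset.sum_add_distrib]
  refine Finset.sum_congr rfl fun k _ => ?_
  by_cases hA : A (x k) <;> by_cases hB : B (x k) <;>
    rcases Int.units_eq_one_or (x k u) with h | h <;>
    simp [h, hA, hB, show ¬ (-1 : ℤˣ) = 1 by decide, show ¬ (1 : ℤˣ) = -1 by decide]

/-- The spins `r = 1` and `r = -1` give opposite deviations, which accounts for the factor `2` in
the normalisation. Summing over `G` yields the conditional mean of the change of `condUp`, given the
cell of the sample in `S`; averaging over the samples removes the conditioning. -/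
theorem nuHat_eq_nu {x : Fin M → Fin n → ℤˣ} (u : Fin n) {I S : Finset (Fin n)}
    (hIS : Disjoint S I) : nuHat x u I S = nu (emp x) u I S := by
  have hw := emp_nonneg x
  have h1 : ∀ (k : Fin M) (G : I → ℤˣ), ∑ r : ℤˣ,
      |empCond x (fun z => z u = r ∧ ∀ i : I, z i = G i) (fun z => ∀ i ∈ S, z i = x k i)
      - empCond x (fun z => z u = r) (fun z => ∀ i ∈ S, z i = x k i)
        * empCond x (fun z => ∀ i : I, z i = G i) (fun z => ∀ i ∈ S, z i = x k i)|
      = 2 * (|marg (fun y => up u y * emp x y) (S ∪ I) (overwrite I G (x k))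
        - condUp (emp x) u S (x k) * marg (emp x) (S ∪ I) (overwrite I G (x k))|
          / marg (emp x) S (x k)) := by
    intro k G
    have hS : 0 < marg (emp x) S (x k) := by
      rw [marg_emp]
      have : 0 < (univ.filter fun l => ∀ i ∈ S, x l i = x k i).card :=
        card_pos.mpr ⟨k, by simp⟩
      have hM : 0 < M := by have := k.2; omega
      positivity
    have e1 : empCond x (fun z => z u = 1 ∧ ∀ i : I, z i = G i) (fun z => ∀ i ∈ S, z i = x k i)
        = marg (fun y => up u y * emp x y) (S ∪ I) (overwrite I G (x k))
          / marg (emp x) S (x k) := by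
      rw [empCond_and_eq k, marg_up_emp, marg_emp]
      simp only [agree_overwrite hIS, and_assoc]
      congr!
    have e2 : empCond x (fun z => ∀ i : I, z i = G i) (fun z => ∀ i ∈ S, z i = x k i)
        = marg (emp x) (S ∪ I) (overwrite I G (x k)) / marg (emp x) S (x k) := by
      rw [empCond_and_eq k, marg_emp, marg_emp]
      simp only [agree_overwrite hIS]
      congr!
    have e3 : empCond x (fun z => z u = 1) (fun z => ∀ i ∈ S, z i = x k i)
        = condUp (emp x) u S (x k) := by
      rw [empCond_and_eq k, condUp, marg_up_emp, marg_emp]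
      congr!
    have e4 := empCond_add_neg x u (fun z => ∀ i : I, z i = G i) (fun z => ∀ i ∈ S, z i = x k i)
    have e5 := empCond_add_neg x u (fun _ => True) (fun z => ∀ i ∈ S, z i = x k i)
    have e6 : empCond x (fun _ => True) (fun z => ∀ i ∈ S, z i = x k i) = 1 := by
      unfold empCond
      rw [div_eq_one_iff_eq]
      · congr 2
        ext l
        simp
      · exact Nat.cast_ne_zero.mpr (card_pos.mpr ⟨k, by simp⟩).ne'
    simp only [and_true] at e5
    rw [e6, e3] at e5
    rw [e1, e2] at e4
    rw [sum_spins, e1, e2, e3, eq_sub_of_add_eq' e4, eq_sub_of_add_eq' e5]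
    set a := marg (fun y => up u y * emp x y) (S ∪ I) (overwrite I G (x k))
    set b := marg (emp x) (S ∪ I) (overwrite I G (x k))
    set c := marg (emp x) S (x k)
    set p := condUp (emp x) u S (x k)
    have e7 : a / c - p * (b / c) = (a - p * b) / c := by ring
    have e8 : b / c - a / c - (1 - p) * (b / c) = -((a - p * b) / c) := by ring
    rw [e7, e8, abs_neg, abs_div, abs_of_pos hS]
    ring
  unfold nuHat nu
  rw [Finset.sum_comm]
  have h2 : ∀ G : I → ℤˣ, ∑ r : ℤˣ, 1 / (M : ℝ) * ∑ k : Fin M,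
      |empCond x (fun z => z u = r ∧ ∀ i : I, z i = G i) (fun z => ∀ i ∈ S, z i = x k i)
      - empCond x (fun z => z u = r) (fun z => ∀ i ∈ S, z i = x k i)
        * empCond x (fun z => ∀ i : I, z i = G i) (fun z => ∀ i ∈ S, z i = x k i)|
      = 2 * ∑ z, emp x z * (|marg (fun y => up u y * emp x y) (S ∪ I) (overwrite I G z)
        - condUp (emp x) u S z * marg (emp x) (S ∪ I) (overwrite I G z)|
          / marg (emp x) S z) := by
    intro G
    rw [← Finset.mul_sum, Finset.sum_comm, sum_emp_mul, Finset.sum_congr rfl fun k _ => h1 k G,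
      ← Finset.mul_sum]
    ring
  simp_rw [h2]
  rw [← Finset.mul_sum, Finset.sum_comm]
  simp_rw [← Finset.mul_sum, ← Finset.sum_div, sum_abs_marg_overwrite hw u hIS]
  rw [sum_mul_marg_div hw S (fun y => abs_nonneg _) fun y => abs_condUp_sub_le hw u S (S ∪ I) y]
  field_simp

end Empirical

/-! ### The growing loop keeps the set small -/

section Grow

variable {n M s : ℕ} {τ L : ℝ} {x : Fin M → Fin n → ℤˣ} {u : Fin n}

/-- The added set is nonempty since `nu` vanishes for the empty set, so `4 ^ |I| ≥ 4 |I|` turns the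
energy gain into a gain of at least `4 τ ^ 2` per added site. -/
theorem GrowStep.energy_le (hM : M ≠ 0) (hτ : 0 ≤ τ) {S S' : Finset (Fin n)}
    (h : GrowStep s τ L x u S S') :
    S ⊆ S' ∧ S.card < S'.card ∧ (u ∉ S → u ∉ S') ∧
      condEnergy (emp x) u S + 4 * τ ^ 2 * (S'.card - S.card) ≤ condEnergy (emp x) u S' := by
  obtain ⟨-, I, hI, -, hν, rfl⟩ := h
  have hdis : Disjoint S I := Finset.disjoint_left.mpr fun i hS h => (mem_sdiff.mp (hI h)).2 hS
  have huI : u ∉ I := fun h => by simpa using hI h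
  rw [nuHat_eq_nu u hdis] at hν
  have hne : I.Nonempty := by
    rw [Finset.nonempty_iff_ne_empty]
    rintro rfl
    rw [nu_empty] at hν
    linarith
  have hcard := card_union_of_disjoint hdis
  have hpos := hne.card_pos
  refine ⟨subset_union_left, by omega, by simp [huI], ?_⟩
  refine le_trans ?_ (condEnergy_add_le (emp_nonneg x) (sum_emp hM x) u I S)
  have h1 : (4 * I.card : ℝ) ≤ 4 ^ I.card := by
    have h2 : ∀ k : ℕ, 4 * k ≤ 4 ^ k := by
      intro k
      induction k with
      | zero => simp
      | succ k ih => rw [pow_succ]; have := Nat.one_le_pow k 4 (by norm_num); omega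
    exact_mod_cast h2 I.card
  rw [hcard]
  push_cast
  have h3 : τ ^ 2 ≤ nu (emp x) u I S ^ 2 := by gcongr
  have h4 : (4 * I.card : ℝ) * τ ^ 2 ≤ 4 ^ I.card * nu (emp x) u I S ^ 2 := by gcongr
  linarith

theorem energy_of_reachable (hM : M ≠ 0) (hτ : 0 ≤ τ) {S : Finset (Fin n)}
    (h : Relation.ReflTransGen (GrowStep s τ L x u) ∅ S) :
    u ∉ S ∧ 4 * τ ^ 2 * S.card ≤ condEnergy (emp x) u S := by
  induction h with
  | refl => simpa using condEnergy_nonneg (emp_nonneg x) u ∅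
  | tail _ hstep ih =>
    obtain ⟨-, -, h1, h2⟩ := hstep.energy_le hM hτ
    exact ⟨h1 ih.1, by linarith [ih.2]⟩

/-- The energy of the empirical law is at most `1`, so `4 τ ^ 2 |S| ≤ 1`. This holds for all
samples, good or bad, and the bound is `L / 32` for `L = 8 / τ ^ 2`. -/
theorem card_le_of_reachable (hM : M ≠ 0) (hτ : 0 < τ) {S : Finset (Fin n)}
    (h : Relation.ReflTransGen (GrowStep s τ L x u) ∅ S) : (S.card : ℝ) ≤ 8 / τ ^ 2 / 32 := by
  have h1 := (energy_of_reachable hM hτ.le h).2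
  have h2 := condEnergy_le_one (emp_nonneg x) (sum_emp hM x) u S
  rw [div_div, le_div_iff₀ (by positivity)]
  linarith

theorem exists_isGrown_of_reachable (hM : M ≠ 0) (hτ : 0 ≤ τ) (S : Finset (Fin n))
    (h : Relation.ReflTransGen (GrowStep s τ L x u) ∅ S) : ∃ S', IsGrown s τ L x u S' := by
  by_cases hS : ∃ S', GrowStep s τ L x u S S'
  · obtain ⟨S', hS'⟩ := hS
    have hlt := (hS'.energy_le hM hτ).2.1
    have hle : S'.card ≤ n := (card_le_univ S').trans (by simp)
    exact exists_isGrown_of_reachable hM hτ S' (h.tail hS')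
  · exact ⟨S, h, fun S' h' => hS ⟨S', h'⟩⟩
termination_by n - S.card

end Grow

/-! ### Concentration of empirical frequencies -/

section Concentration

/-- Markov's inequality for `exp (r ∑ G)`. With `e ^ t ≤ 1 + t + t ^ 2` for `|t| ≤ 1` the exponent
is `M (r ^ 2 - r ε)`, smallest at `r = ε / 2`. -/
theorem sum_prod_filter_le_exp {α : Type*} [Fintype α] {w G : α → ℝ} (hw : ∀ a, 0 ≤ w a)
    (hw1 : ∑ a, w a = 1) (hG : ∀ a, |G a| ≤ 1) (hG0 : ∑ a, w a * G a = 0) {ε : ℝ} (hε : 0 ≤ ε)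
    (hε1 : ε ≤ 1) (M : ℕ) :
    ∑ x : Fin M → α, (if M * ε < ∑ k, G (x k) then ∏ k, w (x k) else 0)
      ≤ Real.exp (-(M * ε ^ 2 / 4)) := by
  set r := ε / 2 with hr
  have h1 : ∀ x : Fin M → α, (if M * ε < ∑ k, G (x k) then ∏ k, w (x k) else 0)
      ≤ Real.exp (-(r * (M * ε))) * ∏ k, (w (x k) * Real.exp (r * G (x k))) := by
    intro x
    have hp : 0 ≤ ∏ k, w (x k) := Finset.prod_nonneg fun k _ => hw _
    rw [Finset.prod_mul_distrib, ← Real.exp_sum, ← Finset.mul_sum]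
    split_ifs with h
    · have h2 : 1 ≤ Real.exp (-(r * (M * ε))) * Real.exp (r * ∑ k, G (x k)) := by
        rw [← Real.exp_add]
        refine Real.one_le_exp ?_
        have : r * (M * ε) ≤ r * ∑ k, G (x k) := by gcongr
        linarith
      calc _ = 1 * ∏ k, w (x k) := (one_mul _).symm
        _ ≤ (Real.exp (-(r * (M * ε))) * Real.exp (r * ∑ k, G (x k))) * ∏ k, w (x k) := by gcongr
        _ = _ := by ring
    · positivity
  have h2 : ∑ a, w a * Real.exp (r * G a) ≤ Real.exp (r ^ 2) := by
    have h3 : ∀ a, w a * Real.exp (r * G a) ≤ w a + r * (w a * G a) + r ^ 2 * w a := by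
      intro a
      have hb : |r * G a| ≤ r := by
        rw [abs_mul, abs_of_nonneg (by positivity)]
        exact mul_le_of_le_one_right (by positivity) (hG a)
      have h4 := (abs_le.mp (Real.abs_exp_sub_one_sub_id_le (hb.trans (by linarith)))).2
      have h5 : (r * G a) ^ 2 ≤ r ^ 2 := by
        rw [← sq_abs]; gcongr
      nlinarith [hw a]
    calc _ ≤ ∑ a, (w a + r * (w a * G a) + r ^ 2 * w a) := Finset.sum_le_sum fun a _ => h3 a
      _ = 1 + r ^ 2 := by
        rw [Finset.sum_add_distrib, Finset.sum_add_distrib, ← Finset.mul_sum, ← Finset.mul_sum, hw1,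
          hG0]
        ring
      _ ≤ _ := by linarith [Real.add_one_le_exp (r ^ 2)]
  calc _ ≤ ∑ x : Fin M → α, Real.exp (-(r * (M * ε))) * ∏ k, (w (x k) * Real.exp (r * G (x k))) :=
        Finset.sum_le_sum fun x _ => h1 x
    _ = Real.exp (-(r * (M * ε))) * (∑ a, w a * Real.exp (r * G a)) ^ M := by
        rw [← Finset.mul_sum, Fintype.sum_pow]
    _ ≤ Real.exp (-(r * (M * ε))) * Real.exp (r ^ 2) ^ M := by
        have : 0 ≤ ∑ a, w a * Real.exp (r * G a) :=
          Finset.sum_nonneg fun a _ => mul_nonneg (hw a) (Real.exp_pos _).le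
        gcongr
    _ = _ := by
        rw [← Real.exp_nat_mul, ← Real.exp_add, hr]
        congr 1
        ring

/-- Union bound over a finite family of centered bounded functions. -/
theorem sum_prod_filter_ge {α ι : Type*} [Fintype α] [Fintype ι] {w : α → ℝ} (hw : ∀ a, 0 ≤ w a)
    (hw1 : ∑ a, w a = 1) {G : ι → α → ℝ} (hG : ∀ i a, |G i a| ≤ 1)
    (hG0 : ∀ i, ∑ a, w a * G i a = 0) {ε : ℝ} (hε : 0 ≤ ε) (hε1 : ε ≤ 1) (M : ℕ) :
    1 - Fintype.card ι * (2 * Real.exp (-(M * ε ^ 2 / 4)))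
      ≤ ∑ x : Fin M → α with ∀ i, |∑ k, G i (x k)| ≤ M * ε, ∏ k, w (x k) := by
  have h1 : ∑ x : Fin M → α, ∏ k, w (x k) = 1 := by rw [← Fintype.sum_pow, hw1, one_pow]
  have h2 : ∀ x : Fin M → α, ∏ k, w (x k)
      ≤ (if ∀ i, |∑ k, G i (x k)| ≤ M * ε then ∏ k, w (x k) else 0)
        + ∑ i, ((if M * ε < ∑ k, G i (x k) then ∏ k, w (x k) else 0)
          + (if M * ε < ∑ k, -G i (x k) then ∏ k, w (x k) else 0)) := by
    intro x
    have hp : 0 ≤ ∏ k, w (x k) := Finset.prod_nonneg fun k _ => hw _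
    have hn : ∀ i, 0 ≤ (if M * ε < ∑ k, G i (x k) then ∏ k, w (x k) else 0)
          + (if M * ε < ∑ k, -G i (x k) then ∏ k, w (x k) else 0) := fun i => by
      apply add_nonneg <;> split_ifs <;> simp [hp]
    by_cases h : ∀ i, |∑ k, G i (x k)| ≤ M * ε
    · rw [if_pos h]
      have := Finset.sum_nonneg fun i (_ : i ∈ univ) => hn i
      linarith
    · rw [if_neg h, zero_add]
      push Not at h
      obtain ⟨i, hi⟩ := h
      refine le_trans ?_ (Finset.single_le_sum (fun i _ => hn i) (mem_univ i))
      rcases lt_abs.mp hi with h | h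
      · rw [if_pos h]; split_ifs <;> linarith
      · rw [Finset.sum_neg_distrib, if_pos h]; split_ifs <;> linarith
  have h3 := Finset.sum_le_sum fun x (_ : x ∈ (univ : Finset (Fin M → α))) => h2 x
  rw [h1, Finset.sum_add_distrib, Finset.sum_comm (s := univ) (t := univ (α := ι))] at h3
  have h4 : ∀ i, ∑ x : Fin M → α, ((if M * ε < ∑ k, G i (x k) then ∏ k, w (x k) else 0)
          + (if M * ε < ∑ k, -G i (x k) then ∏ k, w (x k) else 0))
      ≤ 2 * Real.exp (-(M * ε ^ 2 / 4)) := by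
    intro i
    rw [Finset.sum_add_distrib, two_mul]
    exact add_le_add (sum_prod_filter_le_exp hw hw1 (hG i) (hG0 i) hε hε1 M)
      (sum_prod_filter_le_exp (G := fun a => -G i a) hw hw1 (by simpa using hG i)
        (by simpa using hG0 i) hε hε1 M)
  have h5 := Finset.sum_le_sum fun i (_ : i ∈ (univ : Finset ι)) => h4 i
  rw [Finset.sum_const, card_univ, nsmul_eq_mul] at h5
  rw [Finset.sum_filter]
  linarith

variable {n M : ℕ}

/-- Indicator function of the configurations that obey all constraints in a word. -/
noncomputable def obeys {K : ℕ} (c : Fin K → Fin n × ℤˣ) (z : Fin n → ℤˣ) : ℝ :=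
  if ∀ t, z (c t).1 = (c t).2 then 1 else 0

/-- The frequencies of all patterns on at most `K` sites are estimated within `ε`. -/
def GoodSample (w : (Fin n → ℤˣ) → ℝ) (K : ℕ) (ε : ℝ) (x : Fin M → Fin n → ℤˣ) : Prop :=
  ∀ c : Fin K → Fin n × ℤˣ, |∑ z, emp x z * obeys c z - ∑ z, w z * obeys c z| ≤ ε

theorem sum_goodSample_ge {w : (Fin n → ℤˣ) → ℝ} (hw : ∀ a, 0 ≤ w a) (hw1 : ∑ a, w a = 1)
    (hM : M ≠ 0) (K : ℕ) {ε : ℝ} (hε : 0 ≤ ε) (hε1 : ε ≤ 1) :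
    1 - (2 * n : ℝ) ^ K * (2 * Real.exp (-(M * ε ^ 2 / 4)))
      ≤ ∑ x : Fin M → Fin n → ℤˣ with GoodSample w K ε x, ∏ k, w (x k) := by
  have hM0 : (0 : ℝ) < M := Nat.cast_pos.mpr (Nat.pos_of_ne_zero hM)
  have h01 : ∀ (c : Fin K → Fin n × ℤˣ) z, 0 ≤ obeys c z ∧ obeys c z ≤ 1 := fun c z => by
    unfold obeys; split_ifs <;> simp
  have hp0 : ∀ c : Fin K → Fin n × ℤˣ, 0 ≤ ∑ z, w z * obeys c z := fun c =>
    Finset.sum_nonneg fun z _ => mul_nonneg (hw z) (h01 c z).1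
  have hp1 : ∀ c : Fin K → Fin n × ℤˣ, ∑ z, w z * obeys c z ≤ 1 := fun c => by
    rw [← hw1]
    exact Finset.sum_le_sum fun z _ => mul_le_of_le_one_right (hw z) (h01 c z).2
  have h := sum_prod_filter_ge hw hw1
    (G := fun (c : Fin K → Fin n × ℤˣ) z => obeys c z - ∑ z, w z * obeys c z)
    (fun c z => abs_le.mpr ⟨by linarith [h01 c z, hp1 c], by linarith [h01 c z, hp0 c]⟩)
    (fun c => by
      simp_rw [mul_sub, Finset.sum_sub_distrib]
      rw [← Finset.sum_mul, hw1, one_mul, sub_self]) hε hε1 M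
  have hcard : (Fintype.card (Fin K → Fin n × ℤˣ) : ℝ) = (2 * n : ℝ) ^ K := by
    rw [Fintype.card_fun, Fintype.card_prod, Fintype.card_fin, Fintype.card_fin,
      Fintype.card_units_int]
    push_cast
    ring
  rw [hcard] at h
  refine h.trans (Finset.sum_le_sum_of_subset_of_nonneg (fun x hx => ?_)
    fun x _ _ => Finset.prod_nonneg fun k _ => hw _)
  rw [mem_filter] at hx ⊢
  refine ⟨mem_univ _, fun c => ?_⟩
  have h1 := hx.2 c
  rw [Finset.sum_sub_distrib, Finset.sum_const, card_univ, Fintype.card_fin, nsmul_eq_mul] at h1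
  rw [sum_emp_mul]
  have h2 : 1 / (M : ℝ) * ∑ k, obeys c (x k) - ∑ z, w z * obeys c z
      = (∑ k, obeys c (x k) - M * ∑ z, w z * obeys c z) / M := by field_simp
  rw [h2, abs_div, abs_of_pos hM0, div_le_iff₀ hM0]
  linarith

/-- A nonempty set of at most `K` sites is spelled as a word of length `K` by repeating one of its
elements. The empty set has no letter to repeat, but both its weights are `1`. -/
theorem GoodSample.abs_marg_sub_le {w : (Fin n → ℤˣ) → ℝ} (hw1 : ∑ a, w a = 1) (hM : M ≠ 0)
    {K : ℕ} {ε : ℝ} (hε : 0 ≤ ε) {x : Fin M → Fin n → ℤˣ} (h : GoodSample w K ε x)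
    {A : Finset (Fin n)} (hA : A.card ≤ K) (z : Fin n → ℤˣ) :
    |marg (emp x) A z - marg w A z| ≤ ε := by
  rcases A.eq_empty_or_nonempty with rfl | ⟨a, ha⟩
  · simp [marg, hw1, sum_emp hM, hε]
  · set c : Fin K → Fin n × ℤˣ := fun t => (A.toList.getD t a, z (A.toList.getD t a))
    have h1 : ∀ y : Fin n → ℤˣ, (∀ t, y (c t).1 = (c t).2) ↔ ∀ i ∈ A, y i = z i := by
      intro y
      constructor
      · intro hy i hi
        obtain ⟨t, ht, rfl⟩ := List.mem_iff_getElem.mp (Finset.mem_toList.mpr hi)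
        have htK : t < K := lt_of_lt_of_le (by simpa using ht) hA
        have := hy ⟨t, htK⟩
        change y (A.toList.getD t a) = z (A.toList.getD t a) at this
        rwa [List.getD_eq_getElem _ _ ht] at this
      · intro hy t
        refine hy (A.toList.getD t a) ?_
        by_cases ht : (t : ℕ) < A.toList.length
        · rw [List.getD_eq_getElem _ _ ht]
          exact Finset.mem_toList.mp (List.getElem_mem ht)
        · rw [List.getD_eq_default _ _ (not_lt.mp ht)]
          exact ha
    have h2 : ∀ v : (Fin n → ℤˣ) → ℝ, ∑ y, v y * obeys c y = marg v A z := by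
      intro v
      unfold marg obeys
      exact Finset.sum_congr rfl fun y _ => by simp only [h1]; split_ifs <;> simp
    have := h c
    rwa [h2, h2] at this

theorem marg_up (w : (Fin n → ℤˣ) → ℝ) {u : Fin n} {A : Finset (Fin n)} (hu : u ∉ A)
    (z : Fin n → ℤˣ) :
    marg (fun y => up u y * w y) A z = marg w (insert u A) (Function.update z u 1) := by
  unfold marg up
  refine Finset.sum_congr rfl fun y _ => ?_
  have h : (∀ i ∈ insert u A, y i = Function.update z u 1 i)
      ↔ y u = 1 ∧ ∀ i ∈ A, y i = z i := by
    rw [Finset.forall_mem_insert, Function.update_self]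
    refine and_congr_right fun _ => forall₂_congr fun i hi => ?_
    rw [Function.update_of_ne (by rintro rfl; exact hu hi)]
  simp only [h]
  by_cases h1 : y u = 1 <;> by_cases h2 : ∀ i ∈ A, y i = z i <;> simp [h1, h2]

/-- Each of the `2 ^ n` terms in the undivided form of `nu` is off by at most `4 ε`: one `ε` for
each weight on `S ∪ I`, and `2 ε` for the error in `condUp` given `S`. -/
theorem GoodSample.abs_nu_sub_le {w : (Fin n → ℤˣ) → ℝ} (hw : ∀ a, 0 ≤ w a)
    (hw1 : ∑ a, w a = 1) (hM : M ≠ 0) {K : ℕ} {ε : ℝ} (hε : 0 ≤ ε) {x : Fin M → Fin n → ℤˣ}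
    (h : GoodSample w K ε x) {u : Fin n} {I S : Finset (Fin n)} (hSI : Disjoint S I)
    (huI : u ∉ I) (huS : u ∉ S) (hK : S.card + I.card + 1 ≤ K) :
    |nu (emp x) u I S - nu w u I S| ≤ 2 ^ S.card * (4 * ε) := by
  have hv := emp_nonneg x
  have hm : ∀ A : Finset (Fin n), A.card ≤ K → ∀ z, |marg (emp x) A z - marg w A z| ≤ ε :=
    fun A hA z => h.abs_marg_sub_le hw1 hM hε hA z
  have hmu : ∀ A : Finset (Fin n), u ∉ A → A.card + 1 ≤ K → ∀ z,
      |marg (fun y => up u y * emp x y) A z - marg (fun y => up u y * w y) A z| ≤ ε := by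
    intro A hu hA z
    rw [marg_up _ hu, marg_up _ hu]
    exact hm _ (by rw [card_insert_of_notMem hu]; exact hA) _
  have hc := card_union_of_disjoint hSI
  have key : ∀ z, abs (abs (marg (fun y => up u y * emp x y) (S ∪ I) z
        - marg (emp x) (S ∪ I) z * condUp (emp x) u S z)
      - abs (marg (fun y => up u y * w y) (S ∪ I) z - marg w (S ∪ I) z * condUp w u S z))
      ≤ 4 * ε := by
    intro z
    refine (abs_abs_sub_abs_le_abs_sub _ _).trans ?_
    have a1 := abs_le.mp (hmu (S ∪ I) (by simp [huI, huS]) (by omega) z)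
    have a2 := abs_le.mp (hm (S ∪ I) (by omega) z)
    have a3 := abs_le.mp (hmu S huS (by omega) z)
    have a4 := abs_le.mp (hm S (by omega) z)
    have b1 := marg_mul_condUp hv u S z
    have b2 := marg_mul_condUp hw u S z
    have b3 := marg_anti hw (subset_union_left (s₁ := S) (s₂ := I)) z
    have b4 := marg_nonneg hw (S ∪ I) z
    have c1 := condUp_nonneg hv u S z
    have c2 := condUp_le_one hv u S z
    set p := condUp (emp x) u S z
    set q := condUp w u S z
    set a := marg (fun y => up u y * emp x y) (S ∪ I) z
    set a' := marg (fun y => up u y * w y) (S ∪ I) z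
    set b := marg (emp x) (S ∪ I) z
    set b' := marg w (S ∪ I) z
    set c := marg (emp x) S z
    set c' := marg w S z
    -- The error `p - q` may be large on cells of small weight, but it only enters multiplied by `b'
    -- ≤ c'`, and `c' * p` and `c' * q` are close.
    have d1 : |c' * (p - q)| ≤ 2 * ε := by
      have : c' * (p - q) = (c' - c) * p + (c * p - c' * q) := by ring
      rw [this, b1, b2]
      refine abs_le.mpr ⟨?_, ?_⟩ <;> nlinarith
    have d2 : |b' * (p - q)| ≤ 2 * ε := by
      refine le_trans ?_ d1
      rw [abs_mul, abs_mul, abs_of_nonneg b4, abs_of_nonneg (b4.trans b3)]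
      exact mul_le_mul_of_nonneg_right b3 (abs_nonneg _)
    have d3 := abs_le.mp d2
    have : a - b * p - (a' - b' * q) = (a - a') - (b - b') * p - b' * (p - q) := by ring
    rw [this]
    refine abs_le.mpr ⟨?_, ?_⟩ <;> nlinarith
  rw [nu_eq_sum hv u hSI, nu_eq_sum hw u hSI, ← mul_sub, ← Finset.sum_sub_distrib, abs_mul,
    abs_of_nonneg (by positivity)]
  calc _ ≤ (2 : ℝ) ^ S.card / 2 ^ n * ∑ _z : Fin n → ℤˣ, 4 * ε := by
        gcongr
        exact (Finset.abs_sum_le_sum_abs _ _).trans (Finset.sum_le_sum fun z _ => key z)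
    _ = _ := by
        rw [Finset.sum_const, card_univ, Fintype.card_fun, Fintype.card_units_int, Fintype.card_fin,
          nsmul_eq_mul]
        push_cast
        field_simp

end Concentration

/-! ### Correctness of the algorithm -/

namespace RBM

variable {n m : ℕ} (R : RBM n m)

/-- All the values of `nuHat` that matter to the run from `u` are close to the true ones. -/
def AccurateAt {M : ℕ} (x : Fin M → Fin n → ℤˣ) (u : Fin n) : Prop :=
  ∀ I S : Finset (Fin n), Disjoint S I → u ∉ I → u ∉ S → I.card ≤ 2 ^ R.latentCount →
    (S.card : ℝ) ≤ R.L / 32 → |nuHat x u I S - nu R.obsProb u I S| ≤ R.tau' / 4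

variable {R} {M : ℕ} {x : Fin M → Fin n → ℤˣ} {u : Fin n}

/-- As long as the current set contains the neighbourhood, the test is right. If `i` is a neighbour,
it is the only one missing from `T \ {i}`, so the set with `nu ≥ 2 τ'` must be `{i}`. If not, the
true value is `0`. -/
theorem pruneStep_eq (hd : 0 < R.latentDegree) (hγ : 0 < R.width)
    (hD : R.latentDegree ≤ R.maxDegree + 1) (hx : R.AccurateAt x u) {T : Finset (Fin n)}
    (huT : u ∉ T) (hT : R.nbhd u ⊆ T) (hTc : (T.card : ℝ) ≤ R.L / 32) {i : Fin n} (hi : i ≠ u) :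
    pruneStep R.tau' x u T i = T \ ({i} \ R.nbhd u) := by
  have hτ := R.tau'_pos hd hγ hD
  have hcard : ((T \ {i}).card : ℝ) ≤ R.L / 32 :=
    le_trans (by exact_mod_cast card_le_card sdiff_subset) hTc
  have huT' : u ∉ T \ {i} := fun h => huT (mem_sdiff.mp h).1
  have hacc := abs_le.mp (hx {i} (T \ {i}) (Finset.sdiff_disjoint) (by simpa using hi.symm) huT'
    (by simpa using Nat.one_le_two_pow) hcard)
  unfold pruneStep
  by_cases hiN : i ∈ R.nbhd u
  · have hsub : ¬ R.nbhd u ⊆ T \ {i} := fun h => by simpa using h hiN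
    obtain ⟨A, hA, -, hAν⟩ := R.exists_nu_ge_two_mul_tau' hd hγ hD huT' hsub
    have hAi : A ⊆ {i} := by
      intro j hj
      have h1 := mem_sdiff.mp (hA hj)
      by_contra h
      exact h1.2 (mem_sdiff.mpr ⟨hT h1.1, h⟩)
    rcases Finset.subset_singleton_iff.mp hAi with rfl | rfl
    · rw [nu_empty] at hAν; linarith
    · rw [if_neg (by linarith [hacc.1]),
        sdiff_eq_empty_iff_subset.mpr (singleton_subset_iff.mpr hiN), sdiff_empty]
  · have hN : R.nbhd u ⊆ T \ {i} := fun j hj =>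
      mem_sdiff.mpr ⟨hT hj, by rw [mem_singleton]; rintro rfl; exact hiN hj⟩
    rw [R.nu_eq_zero huT' (by simpa using hi.symm) hN] at hacc
    rw [if_pos (by linarith [hacc.2]),
      sdiff_eq_self_of_disjoint (disjoint_singleton_left.mpr hiN)]

theorem foldl_pruneStep_eq (hd : 0 < R.latentDegree) (hγ : 0 < R.width)
    (hD : R.latentDegree ≤ R.maxDegree + 1) (hx : R.AccurateAt x u) (l : List (Fin n))
    {T : Finset (Fin n)} (huT : u ∉ T) (hT : R.nbhd u ⊆ T) (hTc : (T.card : ℝ) ≤ R.L / 32)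
    (hl : ∀ i ∈ l, i ≠ u) :
    l.foldl (pruneStep R.tau' x u) T = T \ (l.toFinset \ R.nbhd u) := by
  induction l generalizing T with
  | nil => simp
  | cons i l ih =>
    rw [List.foldl_cons, pruneStep_eq hd hγ hD hx huT hT hTc (hl i (by simp)), ih]
    · ext j
      simp only [mem_sdiff, List.toFinset_cons, mem_insert, mem_singleton]
      tauto
    · exact fun h => huT (mem_sdiff.mp h).1
    · exact fun j hj => mem_sdiff.mpr ⟨hT hj, fun h => (mem_sdiff.mp h).2 hj⟩
    · exact le_trans (by exact_mod_cast card_le_card sdiff_subset) hTc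
    · exact fun j hj => hl j (List.mem_cons_of_mem i hj)

theorem isOutput_iff (hd : 0 < R.latentDegree) (hγ : 0 < R.width)
    (hD : R.latentDegree ≤ R.maxDegree + 1) (hM : M ≠ 0) (hx : R.AccurateAt x u)
    (T : Finset (Fin n)) : IsOutput R.latentCount R.tau' R.L x u T ↔ T = R.nbhd u := by
  have hτ := R.tau'_pos hd hγ hD
  have hL := R.L_ge_128 hd hγ hD
  have key : ∀ T, IsOutput R.latentCount R.tau' R.L x u T → T = R.nbhd u := by
    rintro T ⟨S, ⟨hreach, hmax⟩, l, -, hlS, rfl⟩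
    have hS : (S.card : ℝ) ≤ R.L / 32 := card_le_of_reachable hM hτ hreach
    have huS := (energy_of_reachable hM hτ.le hreach).1
    have hNS : R.nbhd u ⊆ S := by
      by_contra hN
      obtain ⟨A, hA, hAc, hAν⟩ := R.exists_nu_ge_two_mul_tau' hd hγ hD huS hN
      have huA : u ∉ A := fun h => R.notMem_nbhd_self u (mem_sdiff.mp (hA h)).1
      have hacc := abs_le.mp (hx A S (Finset.disjoint_left.mpr fun i hi h =>
        (mem_sdiff.mp (hA h)).2 hi) huA huS hAc hS)
      refine hmax (S ∪ A) ⟨by linarith, A, fun i hi => ?_, hAc, by linarith [hacc.1], rfl⟩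
      simp only [mem_sdiff, mem_univ, true_and, mem_singleton]
      exact ⟨by rintro rfl; exact huA hi, (mem_sdiff.mp (hA hi)).2⟩
    rw [foldl_pruneStep_eq hd hγ hD hx l huS hNS hS, hlS]
    · ext i
      have := @hNS i
      simp only [mem_sdiff]
      tauto
    · intro i hi
      rintro rfl
      exact huS (hlS ▸ List.mem_toFinset.mpr hi)
  refine ⟨key T, ?_⟩
  rintro rfl
  obtain ⟨S, hS⟩ := exists_isGrown_of_reachable (s := R.latentCount) (L := R.L) (x := x) (u := u)
    hM hτ.le ∅ .refl
  have hout : IsOutput R.latentCount R.tau' R.L x u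
      (S.toList.foldl (pruneStep R.tau' x u) S) :=
    ⟨S, hS, S.toList, Finset.nodup_toList S, Finset.toList_toFinset S, rfl⟩
  rwa [key _ hout] at hout

theorem accurateAt_of_goodSample (hd : 0 < R.latentDegree) (hγ : 0 < R.width)
    (hD : R.latentDegree ≤ R.maxDegree + 1) (hM : M ≠ 0)
    (hx : GoodSample R.obsProb (⌊R.L / 32⌋₊ + 2 ^ R.latentCount + 1)
      (R.tau' / (2 * 2 ^ R.L)) x) : R.AccurateAt x u := by
  intro I S hSI huI huS hI hS
  have hτ := R.tau'_pos hd hγ hD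
  have hL := R.L_ge_128 hd hγ hD
  have hSn : S.card ≤ ⌊R.L / 32⌋₊ := Nat.le_floor hS
  rw [nuHat_eq_nu u hSI]
  refine (hx.abs_nu_sub_le R.obsProb_nonneg R.sum_obsProb hM (by positivity) hSI huI huS
    (by omega)).trans ?_
  -- Here `|S| + 3 ≤ L / 32 + 3 ≤ L`, because `L ≥ 128`.
  have h1 : (2 : ℝ) ^ S.card * 8 ≤ 2 ^ R.L := by
    calc (2 : ℝ) ^ S.card * 8 = 2 ^ ((S.card : ℝ) + 3) := by
          rw [Real.rpow_add (by norm_num), Real.rpow_natCast]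
          norm_num
      _ ≤ 2 ^ R.L := Real.rpow_le_rpow_of_exponent_le (by norm_num) (by linarith)
  have h2 : (0 : ℝ) < 2 ^ R.L := by positivity
  have h3 : (2 : ℝ) ^ S.card * (4 * (R.tau' / (2 * 2 ^ R.L)))
      = R.tau' / 4 * ((2 ^ S.card * 8) / 2 ^ R.L) := by
    field_simp
    norm_num
  rw [h3]
  exact mul_le_of_le_one_right (by positivity) ((div_le_one h2).mpr h1)

theorem sum_le_sampleProb {E E' : (Fin M → Fin n → ℤˣ) → Prop} (h : ∀ x, E x → E' x) :
    ∑ x : Fin M → Fin n → ℤˣ with E x, ∏ k, R.obsProb (x k) ≤ R.sampleProb M E' := by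
  refine Finset.sum_le_sum_of_subset_of_nonneg (fun x hx => ?_)
    fun x _ _ => Finset.prod_nonneg fun k _ => R.obsProb_nonneg _
  rw [mem_filter] at hx ⊢
  exact ⟨hx.1, h x hx.2⟩

theorem sampleProb_ge (hd : 0 < R.latentDegree) (hγ : 0 < R.width)
    (hD : R.latentDegree ≤ R.maxDegree + 1) {ω : ℝ} (hω : 0 < ω) (hM : R.sampleBound ω ≤ M) :
    1 - ω ≤ R.sampleProb M fun x => ∀ (u : Fin n) (T : Finset (Fin n)),
      IsOutput R.latentCount R.tau' R.L x u T ↔ T = R.nbhd u := by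
  -- For `ω ≥ 1` there is nothing to prove, and `log (1 / ω)` could be negative.
  rcases le_or_gt 1 ω with hω1 | hω1
  · exact (sub_nonpos.mpr hω1).trans
      (Finset.sum_nonneg fun x _ => Finset.prod_nonneg fun k _ => R.obsProb_nonneg _)
  have hτ := R.tau'_pos hd hγ hD
  have hτ1 := R.tau'_le_one hd hγ hD
  have hL := R.L_ge_128 hd hγ hD
  have hn : (1 : ℝ) ≤ n := by
    obtain ⟨u, -⟩ := R.exists_fourier_ne_zero hγ
    exact Nat.one_le_cast.mpr (lt_of_le_of_lt (Nat.zero_le _) u.2)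
  set K := ⌊R.L / 32⌋₊ + 2 ^ R.latentCount + 1 with hK
  set ε := R.tau' / (2 * (2 : ℝ) ^ R.L) with hε
  have hKL : (K : ℝ) ≤ R.L + 2 ^ R.latentCount + 1 := by
    have := Nat.floor_le (show 0 ≤ R.L / 32 by linarith)
    rw [hK]
    push_cast
    linarith
  have hK1 : (1 : ℝ) ≤ R.L + 2 ^ R.latentCount + 1 := by
    have : (0 : ℝ) < 2 ^ R.latentCount := by positivity
    linarith
  have hlogn : 0 ≤ Real.log (2 * n) := Real.log_nonneg (by linarith)
  have hlog2 : 0 < Real.log 2 := Real.log_pos (by norm_num)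
  have hlogω : 0 ≤ Real.log (1 / ω) := Real.log_nonneg (by rw [le_div_iff₀ hω]; linarith)
  -- Chosen so that `exp Λ = 2 (2 n) ^ K / ω`, the quantity that the union bound must beat.
  set Λ := Real.log (1 / ω) + K * Real.log (2 * n) + Real.log 2 with hΛ
  have hΛ0 : 0 < Λ := by positivity
  have hΛ1 : Λ ≤ Real.log (1 / ω) + Real.log (R.L + 2 ^ R.latentCount + 1)
      + (R.L + 2 ^ R.latentCount + 1) * Real.log (2 * n) + Real.log 2 := by
    have h1 := Real.log_nonneg hK1
    have h2 : K * Real.log (2 * n) ≤ (R.L + 2 ^ R.latentCount + 1) * Real.log (2 * n) := by gcongr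
    linarith
  have h2L : (2 : ℝ) ^ (2 * R.L) = (2 ^ R.L) ^ 2 := by
    rw [mul_comm, Real.rpow_mul (by norm_num)]; norm_num
  have h2L0 : (0 : ℝ) < 2 ^ R.L := by positivity
  have h2L1 : (1 : ℝ) ≤ 2 ^ R.L := Real.one_le_rpow (by norm_num) (by linarith)
  have hexp : Real.exp (-2 * R.width) ^ (2 * R.L) ≤ 1 :=
    Real.rpow_le_one (Real.exp_pos _).le R.exp_neg_width_le_one (by linarith)
  have hexp0 : 0 < Real.exp (-2 * R.width) ^ (2 * R.L) := Real.rpow_pos_of_pos (Real.exp_pos _) _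
  have hMΛ : 60 * (2 ^ R.L) ^ 2 / R.tau' ^ 2 * Λ ≤ M := by
    refine le_trans ?_ hM
    unfold sampleBound
    rw [h2L]
    refine mul_le_mul ?_ hΛ1 hΛ0.le (by positivity)
    refine div_le_div_of_nonneg_left (by positivity) (by positivity) ?_
    exact mul_le_of_le_one_right (by positivity) hexp
  have hM0 : M ≠ 0 := by
    rintro rfl
    have : 0 < 60 * ((2 : ℝ) ^ R.L) ^ 2 / R.tau' ^ 2 * Λ := by positivity
    simp only [Nat.cast_zero] at hMΛ
    linarith
  have hε0 : 0 < ε := by positivity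
  have hε1 : ε ≤ 1 := by
    rw [hε, div_le_one (by positivity)]
    linarith
  have hbound : (2 * n : ℝ) ^ K * (2 * Real.exp (-(M * ε ^ 2 / 4))) ≤ ω := by
    -- Since `ε ^ 2 = τ' ^ 2 / (4 * 2 ^ (2 L))`, the constant `60` leaves `15 / 4` times `Λ`.
    have h1 : Λ ≤ M * ε ^ 2 / 4 := by
      have h2 : 60 * (2 ^ R.L) ^ 2 / R.tau' ^ 2 * Λ * ε ^ 2 ≤ M * ε ^ 2 := by gcongr
      have h3 : 60 * (2 ^ R.L) ^ 2 / R.tau' ^ 2 * Λ * ε ^ 2 = 15 * Λ := by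
        rw [hε]; field_simp; norm_num
      linarith
    have h2 : Real.exp (-(M * ε ^ 2 / 4)) ≤ Real.exp (-Λ) := Real.exp_le_exp.mpr (by linarith)
    have h3 : Real.exp Λ = 1 / ω * (2 * n) ^ K * 2 := by
      rw [hΛ, Real.exp_add, Real.exp_add, Real.exp_log (by positivity), Real.exp_log (by norm_num),
        Real.exp_nat_mul, Real.exp_log (by positivity)]
    calc _ ≤ (2 * n : ℝ) ^ K * (2 * Real.exp (-Λ)) := by gcongr
      _ = ω := by rw [Real.exp_neg, h3]; field_simp
  have hgood := sum_goodSample_ge R.obsProb_nonneg R.sum_obsProb hM0 K hε0.le hε1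
  refine le_trans (by linarith) (hgood.trans ?_)
  exact sum_le_sampleProb fun x hx u T =>
    isOutput_iff hd hγ hD hM0 (accurateAt_of_goodSample hd hγ hD hM0 hx) T

end RBM

/-! ### Time-bounded execution of programs -/

infixr:65 " ;; " => RamProg.seq

/-- Within `t` steps, `P` started in `σ` halts in a state that satisfies `Q`. -/
def Runs (tb : ℕ → ℕ → ℕ) (P : RamProg) (σ : RamState) (t : ℕ) (Q : RamState → Prop) : Prop :=
  ∃ σ' t', RamExec tb P σ σ' t' ∧ t' ≤ t ∧ Q σ'

namespace RamState

/-- Assign to a register for natural numbers. -/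
def setNat (σ : RamState) (d v : ℕ) : RamState := { σ with nat := Function.update σ.nat d v }
/-- Assign to a register for real numbers. -/
noncomputable def setReal (σ : RamState) (d : ℕ) (v : ℝ) : RamState :=
  { σ with real := Function.update σ.real d v }
/-- Assign to an array cell. -/
def setArr (σ : RamState) (p i v : ℕ) : RamState :=
  { σ with arr := Function.update σ.arr p (Function.update (σ.arr p) i v) }

variable (σ : RamState) (d v p i q : ℕ) (a : ℝ)

@[simp] theorem setNat_nat (r : ℕ) : (σ.setNat d v).nat r = if r = d then v else σ.nat r := by
  simp [setNat, Function.update_apply]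
@[simp] theorem setNat_real : (σ.setNat d v).real = σ.real := rfl
@[simp] theorem setNat_arr : (σ.setNat d v).arr = σ.arr := rfl
@[simp] theorem setReal_nat : (σ.setReal d a).nat = σ.nat := rfl
@[simp] theorem setReal_real (r : ℕ) : (σ.setReal d a).real r = if r = d then a else σ.real r := by
  simp [setReal, Function.update_apply]
@[simp] theorem setReal_arr : (σ.setReal d a).arr = σ.arr := rfl
@[simp] theorem setArr_nat : (σ.setArr p i v).nat = σ.nat := rfl
@[simp] theorem setArr_real : (σ.setArr p i v).real = σ.real := rfl
@[simp] theorem setArr_arr : (σ.setArr p i v).arr q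
    = if q = p then Function.update (σ.arr p) i v else σ.arr q := by
  simp [setArr, Function.update_apply]

/-- The registers for natural numbers below `a`, the registers for real numbers below `b` and the
arrays below `c` have the same contents in both states. -/
def Keep (a b c : ℕ) (σ σ' : RamState) : Prop :=
  (∀ r < a, σ'.nat r = σ.nat r) ∧ (∀ r < b, σ'.real r = σ.real r) ∧ ∀ p < c, σ'.arr p = σ.arr p

variable {σ} {σ' σ'' : RamState} {a b c a' b' c' : ℕ}

theorem Keep.refl (a b c : ℕ) (σ : RamState) : Keep a b c σ σ :=
  ⟨fun _ _ => rfl, fun _ _ => rfl, fun _ _ => rfl⟩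

theorem Keep.trans (h : Keep a b c σ σ') (h' : Keep a b c σ' σ'') : Keep a b c σ σ'' :=
  ⟨fun r hr => (h'.1 r hr).trans (h.1 r hr), fun r hr => (h'.2.1 r hr).trans (h.2.1 r hr),
    fun p hp => (h'.2.2 p hp).trans (h.2.2 p hp)⟩

theorem Keep.mono (h : Keep a b c σ σ') (ha : a' ≤ a) (hb : b' ≤ b) (hc : c' ≤ c) :
    Keep a' b' c' σ σ' :=
  ⟨fun r hr => h.1 r (hr.trans_le ha), fun r hr => h.2.1 r (hr.trans_le hb),
    fun p hp => h.2.2 p (hp.trans_le hc)⟩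

@[simp] theorem keep_setNat {d v : ℕ} (hd : a ≤ d) :
    Keep a b c σ (σ'.setNat d v) ↔ Keep a b c σ σ' := by
  unfold Keep
  refine and_congr (forall₂_congr fun r hr => ?_) Iff.rfl
  rw [setNat_nat, if_neg (by omega)]

@[simp] theorem keep_setReal {d : ℕ} {v : ℝ} (hd : b ≤ d) :
    Keep a b c σ (σ'.setReal d v) ↔ Keep a b c σ σ' := by
  unfold Keep
  refine and_congr Iff.rfl (and_congr (forall₂_congr fun r hr => ?_) Iff.rfl)
  rw [setReal_real, if_neg (by omega)]

@[simp] theorem keep_setArr {p i v : ℕ} (hp : c ≤ p) :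
    Keep a b c σ (σ'.setArr p i v) ↔ Keep a b c σ σ' := by
  unfold Keep
  refine and_congr Iff.rfl (and_congr Iff.rfl (forall₂_congr fun q hq => ?_))
  rw [setArr_arr, if_neg (by omega)]

end RamState

open RamState

section Rules

variable {tb : ℕ → ℕ → ℕ} {P P' : RamProg} {σ : RamState} {t t₁ t₂ : ℕ} {Q Q' : RamState → Prop}

theorem Runs.mono (h : Runs tb P σ t₁ Q) (ht : t₁ ≤ t) (hQ : ∀ σ', Q σ' → Q' σ') :
    Runs tb P σ t Q' := by
  obtain ⟨σ', t', h1, h2, h3⟩ := h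
  exact ⟨σ', t', h1, h2.trans ht, hQ σ' h3⟩

theorem Runs.seq (h : Runs tb P σ t₁ Q) (h' : ∀ σ', Q σ' → Runs tb P' σ' t₂ Q')
    (ht : t₁ + t₂ ≤ t) : Runs tb (P ;; P') σ t Q' := by
  obtain ⟨σ', s, h1, h2, h3⟩ := h
  obtain ⟨σ'', s', h4, h5, h6⟩ := h' σ' h3
  exact ⟨σ'', s + s', h1.seq h4, by omega, h6⟩

theorem Runs.prim {σ' : RamState} (h : RamExec tb P σ σ' 1) (hQ : Q σ') : Runs tb P σ (t + 1) Q :=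
  ⟨σ', 1, h, by omega, hQ⟩

theorem Runs.prim_seq {σ' : RamState} (h : RamExec tb P σ σ' 1) (h' : Runs tb P' σ' t Q) :
    Runs tb (P ;; P') σ (t + 1) Q :=
  (Runs.prim (t := 0) (Q := fun τ => τ = σ') h rfl).seq (by rintro _ rfl; exact h') (by omega)

theorem Runs.ifLt {a b : ℕ} (h : σ.nat a < σ.nat b → Runs tb P σ t Q)
    (h' : ¬ σ.nat a < σ.nat b → Runs tb P' σ t Q) : Runs tb (.ifLt a b P P') σ (t + 1) Q := by
  by_cases hab : σ.nat a < σ.nat b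
  · obtain ⟨σ', s, h1, h2, h3⟩ := h hab
    exact ⟨σ', s + 1, .ifLt_pos hab h1, by omega, h3⟩
  · obtain ⟨σ', s, h1, h2, h3⟩ := h' hab
    exact ⟨σ', s + 1, .ifLt_neg hab h1, by omega, h3⟩

theorem Runs.ifRealLt {a b : ℕ} (h : σ.real a < σ.real b → Runs tb P σ t Q)
    (h' : ¬ σ.real a < σ.real b → Runs tb P' σ t Q) :
    Runs tb (.ifRealLt a b P P') σ (t + 1) Q := by
  by_cases hab : σ.real a < σ.real b
  · obtain ⟨σ', s, h1, h2, h3⟩ := h hab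
    exact ⟨σ', s + 1, .ifRealLt_pos hab h1, by omega, h3⟩
  · obtain ⟨σ', s, h1, h2, h3⟩ := h' hab
    exact ⟨σ', s + 1, .ifRealLt_neg hab h1, by omega, h3⟩

/-- A loop that uses up fuel in every iteration. -/
theorem Runs.whileLt {a b : ℕ} (Inv : ℕ → RamState → Prop) (T : ℕ)
    (h : ∀ f σ, Inv f σ → σ.nat a < σ.nat b → Runs tb P σ T fun σ' => ∃ f' < f, Inv f' σ')
    {f : ℕ} (hf : Inv f σ) :
    Runs tb (.whileLt a b P) σ (f * (T + 1) + 1)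
      fun σ' => (∃ f', Inv f' σ') ∧ ¬ σ'.nat a < σ'.nat b := by
  induction f using Nat.strong_induction_on generalizing σ with
  | _ f ih =>
    by_cases hab : σ.nat a < σ.nat b
    · obtain ⟨σ', s, h1, h2, f', hf', hI⟩ := h f σ hf hab
      obtain ⟨σ'', s', h4, h5, h6⟩ := ih f' hf' hI
      refine ⟨σ'', s + s' + 1, .while_step hab h1 h4, ?_, h6⟩
      have : (f' + 1) * (T + 1) ≤ f * (T + 1) := Nat.mul_le_mul_right _ hf'
      rw [add_mul] at this
      omega
    · exact ⟨σ, 1, by constructor; exact hab, by omega, ⟨f, hf⟩, hab⟩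

/-- A loop with a counter. -/
theorem Runs.forLt {a b : ℕ} (Inv : ℕ → RamState → Prop) (N T : ℕ)
    (h0 : ∀ j σ, Inv j σ → σ.nat a = j ∧ σ.nat b = N)
    (h : ∀ j σ, j < N → Inv j σ → Runs tb P σ T (Inv (j + 1))) (hI : Inv 0 σ) :
    Runs tb (.whileLt a b P) σ (N * (T + 1) + 1) (Inv N) := by
  refine (Runs.whileLt (fun f σ => f ≤ N ∧ Inv (N - f) σ) T (fun f σ hf hab => ?_) (f := N)
    ⟨le_rfl, by simpa using hI⟩).mono le_rfl ?_
  · obtain ⟨h1, h2⟩ := h0 _ _ hf.2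
    rw [h1, h2] at hab
    refine (h _ σ hab hf.2).mono le_rfl fun σ' hσ' => ⟨f - 1, by omega, by omega, ?_⟩
    rwa [show N - (f - 1) = N - f + 1 by omega]
  · rintro σ' ⟨⟨f, hf, hI'⟩, hab⟩
    obtain ⟨h1, h2⟩ := h0 _ _ hI'
    rw [h1, h2] at hab
    rwa [show N - f = N by omega] at hI'

variable {d a b c p i j : ℕ}

theorem Runs.skip (h : Q σ) : Runs tb .skip σ (t + 1) Q := .prim (.skip σ) h
theorem Runs.const (h : Q (σ.setNat d c)) : Runs tb (.const d c) σ (t + 1) Q :=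
  .prim (.const σ d c) h
theorem Runs.const_seq (h : Runs tb P (σ.setNat d c) t Q) :
    Runs tb (.const d c ;; P) σ (t + 1) Q := .prim_seq (.const σ d c) h
theorem Runs.add (h : Q (σ.setNat d (σ.nat a + σ.nat b))) : Runs tb (.add d a b) σ (t + 1) Q :=
  .prim (.add σ d a b) h
theorem Runs.add_seq (h : Runs tb P (σ.setNat d (σ.nat a + σ.nat b)) t Q) :
    Runs tb (.add d a b ;; P) σ (t + 1) Q := .prim_seq (.add σ d a b) h
theorem Runs.sub (h : Q (σ.setNat d (σ.nat a - σ.nat b))) : Runs tb (.sub d a b) σ (t + 1) Q :=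
  .prim (.sub σ d a b) h
theorem Runs.load_seq (h : Runs tb P (σ.setNat d (σ.arr p (σ.nat i))) t Q) :
    Runs tb (.load d p i ;; P) σ (t + 1) Q := .prim_seq (.load σ d p i) h
theorem Runs.store (h : Q (σ.setArr p (σ.nat i) (σ.nat a))) : Runs tb (.store p i a) σ (t + 1) Q :=
  .prim (.store σ p i a) h
theorem Runs.store_seq (h : Runs tb P (σ.setArr p (σ.nat i) (σ.nat a)) t Q) :
    Runs tb (.store p i a ;; P) σ (t + 1) Q := .prim_seq (.store σ p i a) h
theorem Runs.read_seq (h : Runs tb P (σ.setNat d (tb (σ.nat i) (σ.nat j))) t Q) :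
    Runs tb (.read d i j ;; P) σ (t + 1) Q := .prim_seq (.read σ d i j) h
theorem Runs.cast_seq (h : Runs tb P (σ.setReal d (σ.nat a)) t Q) :
    Runs tb (.cast d a ;; P) σ (t + 1) Q := .prim_seq (.cast σ d a) h
theorem Runs.radd (h : Q (σ.setReal d (σ.real a + σ.real b))) :
    Runs tb (.radd d a b) σ (t + 1) Q := .prim (.radd σ d a b) h
theorem Runs.radd_seq (h : Runs tb P (σ.setReal d (σ.real a + σ.real b)) t Q) :
    Runs tb (.radd d a b ;; P) σ (t + 1) Q := .prim_seq (.radd σ d a b) h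
theorem Runs.rsub (h : Q (σ.setReal d (σ.real a - σ.real b))) :
    Runs tb (.rsub d a b) σ (t + 1) Q := .prim (.rsub σ d a b) h
theorem Runs.rsub_seq (h : Runs tb P (σ.setReal d (σ.real a - σ.real b)) t Q) :
    Runs tb (.rsub d a b ;; P) σ (t + 1) Q := .prim_seq (.rsub σ d a b) h
theorem Runs.rdiv (h : Q (σ.setReal d (σ.real a / σ.real b))) :
    Runs tb (.rdiv d a b) σ (t + 1) Q := .prim (.rdiv σ d a b) h
theorem Runs.rdiv_seq (h : Runs tb P (σ.setReal d (σ.real a / σ.real b)) t Q) :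
    Runs tb (.rdiv d a b ;; P) σ (t + 1) Q := .prim_seq (.rdiv σ d a b) h

end Rules

/-! ### Codes of patterns -/

/-- The code of the pattern of `row` on the set with indicator function `A`. -/
def patternCode (A row : ℕ → ℕ) : ℕ → ℕ
  | 0 => 0
  | j + 1 => 2 * patternCode A row j + if 0 < A j then row j else 0

/-- Compute in register `31` the code of the pattern of sample `nat 20` on the set in array `p`. -/
def codeProg (p : ℕ) : RamProg :=
  .const 30 0 ;; .const 31 0 ;; .whileLt 30 0
    (.add 31 31 31 ;; .load 32 p 30 ;; .ifLt 4 32 (.read 33 20 30 ;; .add 31 31 33) .skip ;;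
      .add 30 30 5)

/-- Registers `4` and `5` hold the constants `0` and `1` throughout. The bound `100` in `Keep`
exceeds every name in use, so it stands for all registers or arrays of that kind. -/
theorem runs_codeProg {tb : ℕ → ℕ → ℕ} (p : ℕ) {σ : RamState} (h4 : σ.nat 4 = 0)
    (h5 : σ.nat 5 = 1) :
    Runs tb (codeProg p) σ (7 * σ.nat 0 + 3) fun σ' => Keep 30 100 100 σ σ' ∧
      σ'.nat 31 = patternCode (σ.arr p) (tb (σ.nat 20)) (σ.nat 0) ∧ σ'.arr = σ.arr := by
  unfold codeProg
  refine Runs.const_seq (Runs.const_seq ?_)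
  refine (Runs.forLt (fun j σ' => Keep 30 100 100 σ σ' ∧ σ'.nat 30 = j ∧
    σ'.nat 31 = patternCode (σ.arr p) (tb (σ.nat 20)) j ∧ σ'.arr = σ.arr) (σ.nat 0) 6 ?_ ?_ ?_).mono
    (by omega) ?_
  · rintro j σ' ⟨hk, hj, -⟩
    exact ⟨hj, hk.1 0 (by norm_num)⟩
  · rintro j σ' - ⟨hk, hj, hc, ha⟩
    have e4 := (hk.1 4 (by norm_num)).trans h4
    have e5 := (hk.1 5 (by norm_num)).trans h5
    have e20 := hk.1 20 (by norm_num)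
    refine Runs.add_seq (Runs.load_seq ?_)
    refine Runs.seq (t₁ := 3) (t₂ := 1) (Runs.ifLt (fun h => Runs.read_seq (Runs.add (Q := fun σ' =>
      Keep 30 100 100 σ σ' ∧ σ'.nat 30 = j ∧
      σ'.nat 31 = patternCode (σ.arr p) (tb (σ.nat 20)) (j + 1) ∧ σ'.arr = σ.arr) ?_))
      fun h => Runs.skip ?_) ?_ le_rfl
    · simp only [setNat_nat, setNat_arr, ha] at h
      simp [hk, hj, ha, hc, e20, patternCode, two_mul]
      intro h'
      simp [hj, e4, h'] at h
    · simp only [setNat_nat, setNat_arr, ha] at h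
      simp [hk, hj, ha, hc, patternCode, two_mul]
      intro h'
      simp [hj, e4] at h
      omega
    · rintro σ'' ⟨hk, hj, hc, ha⟩
      have e5 := (hk.1 5 (by norm_num)).trans h5
      exact Runs.add (by simp [hk, hj, hc, ha, e5])
  · simp [Keep.refl, patternCode]
  · rintro σ' ⟨hk, -, hc, ha⟩
    exact ⟨hk, hc, ha⟩

/-! ### Counting patterns and evaluating the proxy -/

section Tally

variable {tb : ℕ → ℕ → ℕ}

/-- Store in array `c` the codes of all samples on the set in array `p`, and clear the cells with
these positions in the arrays `c + 1` and `c + 2`. -/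
def clearProg (p c : ℕ) : RamProg :=
  .const 20 0 ;; .whileLt 20 1
    (codeProg p ;; .store c 20 31 ;; .store (c + 1) 31 4 ;; .store (c + 2) 31 4 ;; .add 20 20 5)

/-- Count in array `c + 1` the samples with each code, and in array `c + 2` those with spin `1`. -/
def countProg (c : ℕ) : RamProg :=
  .const 20 0 ;; .whileLt 20 1
    (.load 31 c 20 ;; .load 32 (c + 1) 31 ;; .add 32 32 5 ;; .store (c + 1) 31 32 ;;
      .read 33 20 2 ;; .load 32 (c + 2) 31 ;; .add 32 32 33 ;; .store (c + 2) 31 32 ;;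
      .add 20 20 5)

/-- Only the cells addressed by codes of actual samples are cleared, at most `M` of them, although a
code may be exponentially large in `n`. -/
theorem runs_clearProg {p c : ℕ} (hpc : p < c) {σ : RamState} (h4 : σ.nat 4 = 0)
    (h5 : σ.nat 5 = 1) {cd : ℕ → ℕ}
    (hcd : ∀ k, cd k = patternCode (σ.arr p) (tb k) (σ.nat 0)) :
    Runs tb (clearProg p c) σ (σ.nat 1 * (7 * σ.nat 0 + 8) + 2) fun σ' => Keep 20 100 c σ σ' ∧
      ∀ k < σ.nat 1, σ'.arr c k = cd k ∧ σ'.arr (c + 1) (cd k) = 0 ∧ σ'.arr (c + 2) (cd k) = 0 := by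
  unfold clearProg
  refine Runs.const_seq ?_
  refine (Runs.forLt (fun j σ' => Keep 20 100 c σ σ' ∧ σ'.nat 20 = j ∧
    ∀ k < j, σ'.arr c k = cd k ∧ σ'.arr (c + 1) (cd k) = 0 ∧ σ'.arr (c + 2) (cd k) = 0)
    (σ.nat 1) (7 * σ.nat 0 + 7) ?_ ?_ ?_).mono (by simp) ?_
  · rintro j σ' ⟨hk, hj, -⟩
    exact ⟨hj, hk.1 1 (by norm_num)⟩
  · rintro j σ' - ⟨hk, hj, hc⟩
    have e0 := hk.1 0 (by norm_num)
    have e4 := (hk.1 4 (by norm_num)).trans h4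
    have e5 := (hk.1 5 (by norm_num)).trans h5
    have ep := hk.2.2 p hpc
    refine Runs.seq (t₂ := 4) (runs_codeProg p e4 e5) ?_ (by rw [e0])
    rintro τ ⟨hk', hcode, harr⟩
    have hkτ : Keep 20 100 c σ τ :=
      ⟨fun r hr => (hk'.1 r (by omega)).trans (hk.1 r hr),
        fun r hr => (hk'.2.1 r hr).trans (hk.2.1 r hr), fun q hq => by rw [harr, hk.2.2 q hq]⟩
    have f4 := (hkτ.1 4 (by norm_num)).trans h4
    have f5 := (hkτ.1 5 (by norm_num)).trans h5
    have f20 : τ.nat 20 = j := (hk'.1 20 (by norm_num)).trans hj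
    have f31 : τ.nat 31 = cd j := by rw [hcode, ep, hj, e0, hcd]
    refine Runs.store_seq (Runs.store_seq (Runs.store_seq (Runs.add ?_)))
    refine ⟨by simp [hkτ], by simp [f20, f5], fun k hkj => ?_⟩
    simp only [setNat_arr, setArr_arr, setArr_nat, harr, f20, f31, f4]
    -- Cells cleared earlier stay `0`: a later write to the tallies also writes `0`, even when two
    -- samples share a code.
    by_cases hkj' : k = j
    · subst hkj'
      simp
    · obtain ⟨g1, g2, g3⟩ := hc k (by omega)
      simp [Function.update_apply, hkj', g1, g2, g3]
  · simp [Keep.refl]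
  · rintro σ' ⟨hk, -, hc⟩
    exact ⟨hk, hc⟩

theorem runs_countProg {c : ℕ} {σ : RamState} (h5 : σ.nat 5 = 1) {cd : ℕ → ℕ}
    (hc : ∀ k < σ.nat 1, σ.arr c k = cd k ∧ σ.arr (c + 1) (cd k) = 0 ∧ σ.arr (c + 2) (cd k) = 0) :
    Runs tb (countProg c) σ (σ.nat 1 * 10 + 2) fun σ' => Keep 20 100 (c + 1) σ σ' ∧
      ∀ k < σ.nat 1, σ'.arr (c + 1) (cd k) = (∑ l ∈ range (σ.nat 1), if cd l = cd k then 1 else 0) ∧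
        σ'.arr (c + 2) (cd k)
          = ∑ l ∈ range (σ.nat 1), if cd l = cd k then tb l (σ.nat 2) else 0 := by
  unfold countProg
  refine Runs.const_seq ?_
  refine (Runs.forLt (fun j σ' => Keep 20 100 (c + 1) σ σ' ∧ σ'.nat 20 = j ∧
    ∀ k < σ.nat 1, σ'.arr (c + 1) (cd k) = (∑ l ∈ range j, if cd l = cd k then 1 else 0) ∧
      σ'.arr (c + 2) (cd k) = ∑ l ∈ range j, if cd l = cd k then tb l (σ.nat 2) else 0)
    (σ.nat 1) 9 ?_ ?_ ?_).mono (by simp) ?_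
  · rintro j σ' ⟨hk, hj, -⟩
    exact ⟨hj, hk.1 1 (by norm_num)⟩
  · rintro j σ' hjM ⟨hk, hj, hcnt⟩
    have e2 := hk.1 2 (by norm_num)
    have e5 := (hk.1 5 (by norm_num)).trans h5
    have ec : σ'.arr c j = cd j := by rw [hk.2.2 c (by omega), (hc j hjM).1]
    obtain ⟨g1, g2⟩ := hcnt j hjM
    refine Runs.load_seq (Runs.load_seq (Runs.add_seq (Runs.store_seq (Runs.read_seq
      (Runs.load_seq (Runs.add_seq (Runs.store_seq (Runs.add ?_))))))))
    refine ⟨by simp [hk], by simp [hj, e5], fun k hkM => ?_⟩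
    obtain ⟨g3, g4⟩ := hcnt k hkM
    rw [Finset.sum_range_succ, Finset.sum_range_succ]
    by_cases hkj : cd k = cd j
    · simp [hj, ec, e2, e5, g1, g2, hkj, -Finset.sum_boole]
    · simp [hj, ec, e2, e5, hkj, Ne.symm hkj, g3, g4, -Finset.sum_boole]
  · refine ⟨by simp [Keep.refl], by simp, fun k hk => ?_⟩
    simpa using (hc k hk).2
  · rintro σ' ⟨hk, -, hc⟩
    exact ⟨hk, hc⟩

/-- The samples with the same code as each sample, in total and with spin `1`. -/
def tallyProg (p c : ℕ) : RamProg := clearProg p c ;; countProg c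

theorem runs_tallyProg {p c : ℕ} (hpc : p < c) {σ : RamState} (h4 : σ.nat 4 = 0)
    (h5 : σ.nat 5 = 1) {cd : ℕ → ℕ}
    (hcd : ∀ k, cd k = patternCode (σ.arr p) (tb k) (σ.nat 0)) :
    Runs tb (tallyProg p c) σ (σ.nat 1 * (7 * σ.nat 0 + 18) + 4) fun σ' => Keep 20 100 c σ σ' ∧
      ∀ k < σ.nat 1, σ'.arr c k = cd k ∧
        σ'.arr (c + 1) (cd k) = (∑ l ∈ range (σ.nat 1), if cd l = cd k then 1 else 0) ∧
        σ'.arr (c + 2) (cd k)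
          = ∑ l ∈ range (σ.nat 1), if cd l = cd k then tb l (σ.nat 2) else 0 := by
  refine Runs.seq (t₂ := σ.nat 1 * 10 + 2) (runs_clearProg hpc h4 h5 hcd) ?_ (by ring_nf; rfl)
  rintro σ' ⟨hk, hc⟩
  have e1 := hk.1 1 (by norm_num)
  have e2 := hk.1 2 (by norm_num)
  have e5 := (hk.1 5 (by norm_num)).trans h5
  rw [← e1] at hc
  have := runs_countProg (tb := tb) e5 hc
  rw [e1, e2] at this
  refine this.mono le_rfl ?_
  rintro σ'' ⟨hk', hc'⟩
  refine ⟨hk.trans (hk'.mono le_rfl le_rfl (by omega)), fun k hkM => ⟨?_, hc' k hkM⟩⟩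
  rw [hk'.2.2 c (by omega), (hc k (by omega)).1]

/-- The difference of the frequencies of spin `1` in two cells, given by their tallies. -/
noncomputable def tallyGap (N N1 N' N1' : ℕ → ℕ) (c c' : ℕ → ℕ) (k : ℕ) : ℝ :=
  |(N1' (c' k) : ℝ) / N' (c' k) - (N1 (c k) : ℝ) / N (c k)|

/-- Sum over the samples of the differences of the frequencies tallied in the arrays `3, 4, 5` and
`6, 7, 8`. -/
def gapProg : RamProg :=
  .cast 9 4 ;; .cast 2 4 ;; .const 20 0 ;; .whileLt 20 1
    (.load 31 3 20 ;; .load 32 4 31 ;; .load 33 5 31 ;; .cast 10 32 ;; .cast 11 33 ;;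
      .rdiv 10 11 10 ;; .load 31 6 20 ;; .load 32 7 31 ;; .load 33 8 31 ;; .cast 11 32 ;;
      .cast 12 33 ;; .rdiv 11 12 11 ;; .rsub 10 11 10 ;;
      .ifRealLt 10 9 (.rsub 10 9 10) .skip ;; .radd 2 2 10 ;; .add 20 20 5)

theorem runs_gapProg {σ : RamState} (h4 : σ.nat 4 = 0) (h5 : σ.nat 5 = 1) :
    Runs tb gapProg σ (σ.nat 1 * 18 + 4) fun σ' => Keep 20 2 100 σ σ' ∧
      σ'.real 2 = ∑ k ∈ range (σ.nat 1),
        tallyGap (σ.arr 4) (σ.arr 5) (σ.arr 7) (σ.arr 8) (σ.arr 3) (σ.arr 6) k := by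
  unfold gapProg
  refine Runs.cast_seq (Runs.cast_seq (Runs.const_seq ?_))
  refine (Runs.forLt (fun j σ' => Keep 20 2 100 σ σ' ∧ σ'.nat 20 = j ∧ σ'.real 9 = 0 ∧
    σ'.real 2 = ∑ k ∈ range j,
      tallyGap (σ.arr 4) (σ.arr 5) (σ.arr 7) (σ.arr 8) (σ.arr 3) (σ.arr 6) k)
    (σ.nat 1) 17 ?_ ?_ ?_).mono (by simp) ?_
  · rintro j σ' ⟨hk, hj, -⟩
    exact ⟨hj, hk.1 1 (by norm_num)⟩
  · rintro j σ' - ⟨hk, hj, h9, h2⟩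
    have e5 := (hk.1 5 (by norm_num)).trans h5
    have a3 := hk.2.2 3 (by norm_num)
    have a4 := hk.2.2 4 (by norm_num)
    have a5 := hk.2.2 5 (by norm_num)
    have a6 := hk.2.2 6 (by norm_num)
    have a7 := hk.2.2 7 (by norm_num)
    have a8 := hk.2.2 8 (by norm_num)
    refine Runs.load_seq (Runs.load_seq (Runs.load_seq (Runs.cast_seq (Runs.cast_seq
      (Runs.rdiv_seq (Runs.load_seq (Runs.load_seq (Runs.load_seq (Runs.cast_seq (Runs.cast_seq
      (Runs.rdiv_seq (Runs.rsub_seq ?_))))))))))))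
    refine Runs.seq (t₁ := 2) (t₂ := 2) (Runs.ifRealLt (Q := fun σ' => Keep 20 2 100 σ σ' ∧
      σ'.nat 20 = j ∧ σ'.real 9 = 0 ∧ σ'.real 2 = ∑ k ∈ range j,
        tallyGap (σ.arr 4) (σ.arr 5) (σ.arr 7) (σ.arr 8) (σ.arr 3) (σ.arr 6) k ∧ σ'.real 10
        = tallyGap (σ.arr 4) (σ.arr 5) (σ.arr 7) (σ.arr 8) (σ.arr 3) (σ.arr 6) j)
      (fun h => Runs.rsub ?_) fun h => Runs.skip ?_) ?_ le_rfl
    · simp [h9, hj, a3, a4, a5, a6, a7, a8] at h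
      simp [hk, hj, h9, h2, a3, a4, a5, a6, a7, a8, tallyGap]
      rw [abs_of_nonpos (by linarith)]
      ring
    · simp [h9, hj, a3, a4, a5, a6, a7, a8] at h
      simp [hk, hj, h9, h2, a3, a4, a5, a6, a7, a8, tallyGap]
      rw [abs_of_nonneg (by linarith)]
    · rintro τ ⟨hk, hj, h9, h2, h10⟩
      have e5 := (hk.1 5 (by norm_num)).trans h5
      refine Runs.radd_seq (Runs.add ?_)
      simp [hk, hj, h9, h2, h10, e5, Finset.sum_range_succ]
  · simp [Keep.refl, h4]
  · rintro σ' ⟨hk, -, -, h2⟩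
    exact ⟨hk, h2⟩

/-- Compute the number of samples times `2` to the number of sites in array `2` and not in
array `0`. -/
def weightProg : RamProg :=
  .cast 3 1 ;; .const 20 0 ;; .whileLt 20 0
    (.load 31 0 20 ;; .load 32 2 20 ;; .ifLt 31 32 (.radd 3 3 3) .skip ;; .add 20 20 5)

theorem runs_weightProg {σ : RamState} (h5 : σ.nat 5 = 1) :
    Runs tb weightProg σ (σ.nat 0 * 6 + 3) fun σ' => Keep 20 3 100 σ σ' ∧
      σ'.real 3 = σ.nat 1 * ∏ i ∈ range (σ.nat 0), if σ.arr 0 i < σ.arr 2 i then 2 else 1 := by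
  unfold weightProg
  refine Runs.cast_seq (Runs.const_seq ?_)
  refine (Runs.forLt (fun j σ' => Keep 20 3 100 σ σ' ∧ σ'.nat 20 = j ∧
    σ'.real 3 = σ.nat 1 * ∏ i ∈ range j, if σ.arr 0 i < σ.arr 2 i then 2 else 1)
    (σ.nat 0) 5 ?_ ?_ ?_).mono (by simp) ?_
  · rintro j σ' ⟨hk, hj, -⟩
    exact ⟨hj, hk.1 0 (by norm_num)⟩
  · rintro j σ' - ⟨hk, hj, h3⟩
    have e5 := (hk.1 5 (by norm_num)).trans h5
    have a0 := hk.2.2 0 (by norm_num)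
    have a2 := hk.2.2 2 (by norm_num)
    refine Runs.load_seq (Runs.load_seq ?_)
    refine Runs.seq (t₁ := 2) (t₂ := 1) (Runs.ifLt (Q := fun σ' => Keep 20 3 100 σ σ' ∧
      σ'.nat 20 = j ∧ σ'.real 3 = σ.nat 1 * ∏ i ∈ range (j + 1),
        if σ.arr 0 i < σ.arr 2 i then 2 else 1)
      (fun h => Runs.radd ?_) fun h => Runs.skip ?_) ?_ le_rfl
    · simp [hj, a0, a2] at h
      simp [hk, hj, h3, Finset.prod_range_succ, h]
      ring
    · simp [hj, a0, a2] at h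
      simp [hk, hj, h3, Finset.prod_range_succ, Nat.not_lt.mpr h]
    · rintro τ ⟨hk, hj, h3⟩
      have e5 := (hk.1 5 (by norm_num)).trans h5
      exact Runs.add (by simp [hk, hj, h3, e5])
  · simp [Keep.refl]
  · rintro σ' ⟨hk, -, h3⟩
    exact ⟨hk, h3⟩

/-- The value computed by `nuProg`. -/
noncomputable def tallyNu (tb : ℕ → ℕ → ℕ) (n M u : ℕ) (A B : ℕ → ℕ) : ℝ :=
  (∑ k ∈ range M, |((∑ l ∈ range M, if patternCode B (tb l) n = patternCode B (tb k) n
        then tb l u else 0 : ℕ) : ℝ)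
      / ((∑ l ∈ range M, if patternCode B (tb l) n = patternCode B (tb k) n then 1 else 0 : ℕ) : ℝ)
    - ((∑ l ∈ range M, if patternCode A (tb l) n = patternCode A (tb k) n
        then tb l u else 0 : ℕ) : ℝ)
      / ((∑ l ∈ range M, if patternCode A (tb l) n = patternCode A (tb k) n then 1 else 0 : ℕ)
        : ℝ)|)
  / (M * ∏ i ∈ range n, if A i < B i then 2 else 1)

/-- Compute in the real register `2` the proxy for the sets in the arrays `0` and `2`. -/
def nuProg : RamProg := tallyProg 0 3 ;; tallyProg 2 6 ;; gapProg ;; weightProg ;; .rdiv 2 2 3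

/-- Array `0` holds `S`, array `2` holds `S ∪ I`; the codes and the two tallies are in arrays `3`,
`4`, `5` for the former and `6`, `7`, `8` for the latter. The cost is linear in `M n`. -/
theorem runs_nuProg {σ : RamState} (h4 : σ.nat 4 = 0) (h5 : σ.nat 5 = 1) :
    Runs tb nuProg σ (σ.nat 1 * (14 * σ.nat 0 + 54) + 6 * σ.nat 0 + 16) fun σ' =>
      Keep 20 2 3 σ σ' ∧
      σ'.real 2 = tallyNu tb (σ.nat 0) (σ.nat 1) (σ.nat 2) (σ.arr 0) (σ.arr 2) := by
  unfold nuProg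
  refine Runs.seq (t₂ := σ.nat 1 * (7 * σ.nat 0 + 36) + 6 * σ.nat 0 + 12)
    (runs_tallyProg (by norm_num) h4 h5 fun k => rfl) ?_ (by ring_nf; rfl)
  rintro σ₁ ⟨k₁, c₁⟩
  have e0 := k₁.1 0 (by norm_num)
  have e1 := k₁.1 1 (by norm_num)
  have e2 := k₁.1 2 (by norm_num)
  have a0 := k₁.2.2 0 (by norm_num)
  have a2 := k₁.2.2 2 (by norm_num)
  refine Runs.seq (t₂ := σ.nat 1 * 18 + 6 * σ.nat 0 + 8) (runs_tallyProg (by norm_num)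
    ((k₁.1 4 (by norm_num)).trans h4) ((k₁.1 5 (by norm_num)).trans h5) fun k => rfl) ?_
    (by rw [e0, e1]; ring_nf; rfl)
  rw [e0, e1, e2, a2]
  rintro σ₂ ⟨k₂, c₂⟩
  have K₂ : Keep 20 100 3 σ σ₂ := k₁.trans (k₂.mono le_rfl le_rfl (by norm_num))
  refine Runs.seq (t₂ := 6 * σ.nat 0 + 4) (runs_gapProg ((K₂.1 4 (by norm_num)).trans h4)
    ((K₂.1 5 (by norm_num)).trans h5)) ?_ (by rw [K₂.1 1 (by norm_num)]; ring_nf; rfl)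
  rintro σ₃ ⟨k₃, g₃⟩
  have K₃ : Keep 20 2 3 σ σ₃ :=
    (K₂.mono le_rfl (by norm_num) le_rfl).trans (k₃.mono le_rfl le_rfl (by norm_num))
  refine Runs.seq (t₂ := 1) (runs_weightProg ((K₃.1 5 (by norm_num)).trans h5)) ?_
    (by rw [K₃.1 0 (by norm_num)]; ring_nf; rfl)
  rintro σ₄ ⟨k₄, g₄⟩
  have K₄ : Keep 20 2 3 σ σ₄ := K₃.trans (k₄.mono le_rfl (by norm_num) (by norm_num))
  refine Runs.rdiv ⟨by simp [K₄], ?_⟩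
  simp only [setReal_real, if_true]
  rw [k₄.2.1 2 (by norm_num), g₃, g₄, K₃.1 0 (by norm_num), K₃.1 1 (by norm_num),
    K₃.2.2 0 (by norm_num), K₃.2.2 2 (by norm_num), K₂.1 1 (by norm_num)]
  unfold tallyNu
  congr 1
  refine Finset.sum_congr rfl fun k hk => ?_
  have hk := mem_range.mp hk
  obtain ⟨u1, u2, u3⟩ := c₁ k hk
  obtain ⟨v1, v2, v3⟩ := c₂ k hk
  unfold tallyGap
  rw [k₂.2.2 3 (by norm_num), k₂.2.2 4 (by norm_num), k₂.2.2 5 (by norm_num), u1, v1, u2, u3, v2,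
    v3]

end Tally

/-! ### The program computes the proxy -/

section Proxy

variable {n M : ℕ}

/-- The array `a` is the indicator function of `A`. -/
def IsInd (a : ℕ → ℕ) (A : Finset (Fin n)) : Prop := ∀ i : Fin n, a i = if i ∈ A then 1 else 0

/-- The code is a binary expansion with one digit per site, `0` off the set, so it determines the
pattern. -/
theorem patternCode_eq_iff {a r r' : ℕ → ℕ} (hr : ∀ i, r i ≤ 1) (hr' : ∀ i, r' i ≤ 1) (j : ℕ) :
    patternCode a r j = patternCode a r' j ↔ ∀ i < j, 0 < a i → r i = r' i := by
  induction j with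
  | zero => simp [patternCode]
  | succ j ih =>
    have h1 := hr j
    have h2 := hr' j
    have key : patternCode a r (j + 1) = patternCode a r' (j + 1)
        ↔ patternCode a r j = patternCode a r' j ∧ (0 < a j → r j = r' j) := by
      simp only [patternCode]
      split_ifs with h
      · simp only [h, forall_const]; omega
      · simp only [h, false_imp_iff, and_true]; omega
    rw [key, ih]
    constructor
    · rintro ⟨h, h'⟩ i hi hai
      rcases Nat.lt_succ_iff_lt_or_eq.mp hi with hi | rfl
      · exact h i hi hai
      · exact h' hai
    · exact fun h => ⟨fun i hi => h i (by omega), h j (by omega)⟩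

theorem sampleTable_le_one (x : Fin M → Fin n → ℤˣ) (k i : ℕ) : sampleTable x k i ≤ 1 := by
  unfold sampleTable; split_ifs <;> simp

theorem sampleTable_apply (x : Fin M → Fin n → ℤˣ) (k : Fin M) (i : Fin n) :
    sampleTable x k i = if x k i = 1 then 1 else 0 := by
  simp [sampleTable]

theorem patternCode_sampleTable (x : Fin M → Fin n → ℤˣ) {a : ℕ → ℕ} {A : Finset (Fin n)}
    (ha : IsInd a A) (l k : Fin M) :
    patternCode a (sampleTable x l) n = patternCode a (sampleTable x k) n
      ↔ ∀ i ∈ A, x l i = x k i := by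
  rw [patternCode_eq_iff (sampleTable_le_one x l) (sampleTable_le_one x k)]
  have h1 : ∀ i : Fin n, sampleTable x l i = sampleTable x k i ↔ x l i = x k i := by
    intro i
    rw [sampleTable_apply, sampleTable_apply]
    rcases Int.units_eq_one_or (x l i) with h | h <;>
      rcases Int.units_eq_one_or (x k i) with h' | h' <;>
      simp [h, h', show ¬ (-1 : ℤˣ) = 1 by decide, show ¬ (1 : ℤˣ) = -1 by decide]
  constructor
  · intro h i hi
    exact (h1 i).mp (h i i.2 (by simp [ha i, hi]))
  · intro h i hi hai
    refine (h1 ⟨i, hi⟩).mpr (h ⟨i, hi⟩ ?_)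
    by_contra hA
    have := ha ⟨i, hi⟩
    simp only [hA, if_false] at this
    omega

theorem condUp_emp_eq (x : Fin M → Fin n → ℤˣ) (u : Fin n) {a : ℕ → ℕ} {A : Finset (Fin n)}
    (ha : IsInd a A) (k : Fin M) :
    condUp (emp x) u A (x k)
      = ((∑ l ∈ range M, if patternCode a (sampleTable x l) n = patternCode a (sampleTable x k) n
          then sampleTable x l u else 0 : ℕ) : ℝ)
        / ((∑ l ∈ range M, if patternCode a (sampleTable x l) n = patternCode a (sampleTable x k) n
          then 1 else 0 : ℕ) : ℝ) := by
  have hM : (M : ℝ) ≠ 0 := Nat.cast_ne_zero.mpr (by have := k.2; omega)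
  rw [condUp, marg_up_emp, marg_emp, div_div_div_cancel_right₀ hM, Finset.sum_range,
    Finset.sum_range]
  simp only [patternCode_sampleTable x ha, sampleTable_apply, Finset.card_filter]
  congr 2
  refine Finset.sum_congr rfl fun l _ => ?_
  by_cases h1 : x l u = 1 <;> by_cases h2 : ∀ i ∈ A, x l i = x k i <;> simp [h1, h2]

/-- In the form `nu (emp x)` the proxy is an average over the samples of differences of two
conditional frequencies, each a quotient of tallies. The sites marked in `b` and not in `a` are
those of `I`, so the product is `2 ^ |I|`. -/
theorem tallyNu_eq_nuHat (x : Fin M → Fin n → ℤˣ) (u : Fin n) {a b : ℕ → ℕ}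
    {S I : Finset (Fin n)} (hSI : Disjoint S I) (ha : IsInd a S) (hb : IsInd b (S ∪ I)) :
    tallyNu (sampleTable x) n M u a b = nuHat x u I S := by
  have h1 : ∏ i ∈ range n, (if a i < b i then (2 : ℝ) else 1) = 2 ^ I.card := by
    rw [Finset.prod_range]
    have : ∀ i : Fin n, (if a i < b i then (2 : ℝ) else 1) = if i ∈ I then 2 else 1 := by
      intro i
      rw [ha i, hb i]
      by_cases hI : i ∈ I
      · have hS : i ∉ S := fun h => Finset.disjoint_left.mp hSI h hI
        simp [hI, hS]
      · simp [hI]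
    simp_rw [this]
    rw [Finset.prod_ite_mem, univ_inter, Finset.prod_const]
  rw [nuHat_eq_nu u hSI, nu, sum_emp_mul, tallyNu, h1, Finset.sum_range]
  simp only [condUp_emp_eq x u ha, condUp_emp_eq x u hb]
  rw [← div_div, one_div, mul_comm (M : ℝ)⁻¹, ← div_eq_mul_inv]

end Proxy

/-! ### Odometers -/

/-- Surjectivity of the base `n` expansion: every word of `k` digits is met by the odometer. -/
theorem exists_digits {n : ℕ} (k : ℕ) (d : ℕ → ℕ) (hd : ∀ j, d j < n) :
    ∃ c < n ^ k, ∀ j < k, c / n ^ j % n = d j := by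
  induction k generalizing d with
  | zero => exact ⟨0, by simp, by simp⟩
  | succ k ih =>
    obtain ⟨c, hc, hcd⟩ := ih (fun j => d (j + 1)) fun j => hd (j + 1)
    have hn : 0 < n := lt_of_le_of_lt (Nat.zero_le _) (hd 0)
    refine ⟨d 0 + n * c, ?_, fun j hj => ?_⟩
    · calc d 0 + n * c < n + n * c := by have := hd 0; omega
        _ = n * (c + 1) := by ring
        _ ≤ n * n ^ k := Nat.mul_le_mul_left n hc
        _ = n ^ (k + 1) := by ring
    · cases j with
      | zero => simp [Nat.mod_eq_of_lt (hd 0)]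
      | succ j =>
        rw [pow_succ', ← Nat.div_div_eq_div_mul, Nat.add_mul_div_left _ _ hn,
          Nat.div_eq_of_lt (hd 0), zero_add]
        exact hcd j (by omega)

/-- The digits of `c + 1`, when `carry` tells whether all digits before the `j`-th overflow. -/
theorem digit_succ {n c j : ℕ} (hn : 0 < n) :
    (c + 1) / n ^ j % n = (if n ^ j ∣ c + 1 then
      (if c / n ^ j % n + 1 < n then c / n ^ j % n + 1 else 0) else c / n ^ j % n) ∧
    (n ^ (j + 1) ∣ c + 1 ↔ n ^ j ∣ c + 1 ∧ ¬ c / n ^ j % n + 1 < n) := by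
  have hp : 0 < n ^ j := Nat.pow_pos hn
  have hlt := Nat.mod_lt (c / n ^ j) hn
  have hmod : ∀ m : ℕ, (m + 1) % n = if m % n + 1 < n then m % n + 1 else 0 := by
    intro m
    have h := Nat.mod_lt m hn
    have h1 : m + 1 = (m % n + 1) + n * (m / n) := by have := Nat.mod_add_div m n; omega
    rw [h1, Nat.add_mul_mod_self_left]
    split_ifs with h2
    · exact Nat.mod_eq_of_lt h2
    · rw [show m % n + 1 = n by omega, Nat.mod_self]
  refine ⟨?_, ?_⟩
  · rw [Nat.succ_div]
    split_ifs with h1 h2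
    · rw [hmod, if_pos h2]
    · rw [hmod, if_neg h2]
    · simp
  · by_cases h : n ^ j ∣ c + 1
    · obtain ⟨q, hq⟩ := h
      have h1 : c / n ^ j + 1 = q := by
        have := Nat.succ_div (a := c) (b := n ^ j)
        rw [if_pos ⟨q, hq⟩, hq, Nat.mul_div_cancel_left _ hp] at this
        exact this.symm
      rw [hq, pow_succ, Nat.mul_dvd_mul_iff_left hp, ← h1, Nat.dvd_iff_mod_eq_zero, hmod]
      simp
    · simp only [h, false_and, iff_false]
      exact fun h' => h ((Dvd.intro _ (pow_succ n j).symm).trans h')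

/-! ### The growing loop -/

section Programs

variable {tb : ℕ → ℕ → ℕ}

/-- Copy array `p` to array `q`. -/
def copyProg (p q : ℕ) : RamProg :=
  .const 20 0 ;; .whileLt 20 0 (.load 31 p 20 ;; .store q 20 31 ;; .add 20 20 5)

theorem runs_copyProg {p q : ℕ} (hpq : p ≠ q) {σ : RamState} (h5 : σ.nat 5 = 1) :
    Runs tb (copyProg p q) σ (4 * σ.nat 0 + 2) fun σ' => Keep 20 100 0 σ σ' ∧
      (∀ r, r ≠ q → σ'.arr r = σ.arr r) ∧ ∀ i < σ.nat 0, σ'.arr q i = σ.arr p i := by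
  unfold copyProg
  refine Runs.const_seq ?_
  refine (Runs.forLt (fun j σ' => Keep 20 100 0 σ σ' ∧ σ'.nat 20 = j ∧
    (∀ r, r ≠ q → σ'.arr r = σ.arr r) ∧ ∀ i < j, σ'.arr q i = σ.arr p i)
    (σ.nat 0) 3 ?_ ?_ ?_).mono (by simp; omega) ?_
  · rintro j σ' ⟨hk, hj, -⟩
    exact ⟨hj, hk.1 0 (by norm_num)⟩
  · rintro j σ' - ⟨hk, hj, ha, hq⟩
    have e5 := (hk.1 5 (by norm_num)).trans h5
    refine Runs.load_seq (Runs.store_seq (Runs.add ⟨by simp [hk], by simp [hj, e5], ?_, ?_⟩))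
    · intro r hr
      simp [hr, ha r hr]
    · intro i hi
      simp only [setNat_arr, setArr_arr, if_true, setNat_nat, ha p hpq]
      by_cases hij : i = j
      · subst hij; simp [hj]
      · simp [hj, Function.update_of_ne hij, hq i (by omega)]
  · simp [Keep.refl]
  · rintro σ' ⟨hk, -, ha, hq⟩
    exact ⟨hk, ha, hq⟩

/-- Mark in array `2` the sites that occur as digits in array `1`, except for `u`. -/
def markProg : RamProg :=
  .const 20 0 ;; .whileLt 20 6
    (.load 31 1 20 ;; .ifLt 31 2 (.store 2 31 5) (.ifLt 2 31 (.store 2 31 5) .skip) ;;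
      .add 20 20 5)

theorem runs_markProg {σ : RamState} (h5 : σ.nat 5 = 1) :
    Runs tb markProg σ (6 * σ.nat 6 + 2) fun σ' => Keep 20 100 2 σ σ' ∧
      ∀ i, σ'.arr 2 i
        = if i ≠ σ.nat 2 ∧ ∃ j < σ.nat 6, σ.arr 1 j = i then 1 else σ.arr 2 i := by
  unfold markProg
  refine Runs.const_seq ?_
  refine (Runs.forLt (fun j σ' => Keep 20 100 2 σ σ' ∧ σ'.nat 20 = j ∧
    ∀ i, σ'.arr 2 i = if i ≠ σ.nat 2 ∧ ∃ j' < j, σ.arr 1 j' = i then 1 else σ.arr 2 i)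
    (σ.nat 6) 5 ?_ ?_ ?_).mono (by simp; omega) ?_
  · rintro j σ' ⟨hk, hj, -⟩
    exact ⟨hj, hk.1 6 (by norm_num)⟩
  · rintro j σ' - ⟨hk, hj, ha⟩
    have e5 := (hk.1 5 (by norm_num)).trans h5
    have e2 := hk.1 2 (by norm_num)
    have a1 := hk.2.2 1 (by norm_num)
    -- Shared by the two branches that write; a digit differs from `u` exactly when it is smaller or
    -- larger, and order is the only test available.
    have hmark : ∀ τ : RamState, τ.arr 2 = Function.update (σ'.arr 2) (σ.arr 1 j) 1 →
        σ.arr 1 j ≠ σ.nat 2 → ∀ i, τ.arr 2 i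
          = if i ≠ σ.nat 2 ∧ ∃ j' < j + 1, σ.arr 1 j' = i then 1 else σ.arr 2 i := by
      intro τ hτ hne i
      rw [hτ]
      by_cases hi : i = σ.arr 1 j
      · subst hi
        rw [Function.update_self, if_pos ⟨hne, j, by omega, rfl⟩]
      · rw [Function.update_of_ne hi, ha]
        refine if_congr (and_congr_right fun _ => ⟨?_, ?_⟩) rfl rfl
        · rintro ⟨j', hj', h⟩; exact ⟨j', by omega, h⟩
        · rintro ⟨j', hj', h⟩
          refine ⟨j', ?_, h⟩
          have : j' ≠ j := by rintro rfl; exact hi h.symm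
          omega
    refine Runs.load_seq ?_
    refine Runs.seq (t₁ := 3) (t₂ := 1) (Runs.ifLt (Q := fun σ' => Keep 20 100 2 σ σ' ∧
      σ'.nat 20 = j ∧ ∀ i, σ'.arr 2 i
        = if i ≠ σ.nat 2 ∧ ∃ j' < j + 1, σ.arr 1 j' = i then 1 else σ.arr 2 i)
      (fun h => Runs.store ⟨by simp [hk], by simp [hj], ?_⟩)
      fun h => Runs.ifLt (fun h' => Runs.store ⟨by simp [hk], by simp [hj], ?_⟩)
        fun h' => Runs.skip ⟨by simp [hk], by simp [hj], ?_⟩) ?_ le_rfl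
    · simp [hj, a1, e2] at h
      exact hmark _ (by simp [hj, a1, e5]) (by omega)
    · simp [hj, a1, e2] at h'
      exact hmark _ (by simp [hj, a1, e5]) (by omega)
    · simp [hj, a1, e2] at h h'
      intro i
      rw [setNat_arr, ha]
      refine if_congr (and_congr_right fun hi => ⟨?_, ?_⟩) rfl rfl
      · rintro ⟨j', hj', h⟩; exact ⟨j', by omega, h⟩
      · rintro ⟨j', hj', h⟩
        refine ⟨j', ?_, h⟩
        have : j' ≠ j := by rintro rfl; omega
        omega
    · rintro τ ⟨hk, hj, ha⟩
      have e5 := (hk.1 5 (by norm_num)).trans h5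
      exact Runs.add ⟨by simp [hk], by simp [hj, e5], by simpa using ha⟩
  · simp [Keep.refl]
  · rintro σ' ⟨hk, -, ha⟩
    exact ⟨hk, ha⟩

/-- Set all digits to `0`. -/
def resetProg : RamProg := .const 20 0 ;; .whileLt 20 6 (.store 1 20 4 ;; .add 20 20 5)

theorem runs_resetProg {σ : RamState} (h4 : σ.nat 4 = 0) (h5 : σ.nat 5 = 1) :
    Runs tb resetProg σ (3 * σ.nat 6 + 2) fun σ' => Keep 20 100 1 σ σ' ∧
      ∀ j < σ.nat 6, σ'.arr 1 j = 0 := by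
  unfold resetProg
  refine Runs.const_seq ?_
  refine (Runs.forLt (fun j σ' => Keep 20 100 1 σ σ' ∧ σ'.nat 20 = j ∧
    ∀ i < j, σ'.arr 1 i = 0) (σ.nat 6) 2 ?_ ?_ ?_).mono (by simp; omega) ?_
  · rintro j σ' ⟨hk, hj, -⟩
    exact ⟨hj, hk.1 6 (by norm_num)⟩
  · rintro j σ' - ⟨hk, hj, ha⟩
    have e4 := (hk.1 4 (by norm_num)).trans h4
    have e5 := (hk.1 5 (by norm_num)).trans h5
    refine Runs.store_seq (Runs.add ⟨by simp [hk], by simp [hj, e5], fun i hi => ?_⟩)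
    by_cases hij : i = j
    · subst hij; simp [hj, e4]
    · simp [hj, Function.update_of_ne hij, ha i (by omega)]
  · simp [Keep.refl]
  · rintro σ' ⟨hk, -, ha⟩
    exact ⟨hk, ha⟩

/-- Increment the odometer in array `1`. Register `7` tells whether it did not overflow. -/
def incrProg : RamProg :=
  .const 8 1 ;; .const 20 0 ;; .whileLt 20 6
    (.ifLt 4 8 (.load 31 1 20 ;; .add 31 31 5 ;;
      .ifLt 31 0 (.store 1 20 31 ;; .const 8 0) (.store 1 20 4)) .skip ;; .add 20 20 5) ;;
    .sub 7 5 8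

theorem runs_incrProg {σ : RamState} (h4 : σ.nat 4 = 0) (h5 : σ.nat 5 = 1) {n c : ℕ}
    (hn : 0 < n) (h0 : σ.nat 0 = n) (hc : c < n ^ σ.nat 6)
    (hd : ∀ j < σ.nat 6, σ.arr 1 j = c / n ^ j % n) :
    Runs tb incrProg σ (8 * σ.nat 6 + 4) fun σ' => Keep 7 100 1 σ σ' ∧
      (c + 1 < n ^ σ.nat 6 ∧ σ'.nat 7 = 1 ∧ (∀ j < σ.nat 6, σ'.arr 1 j = (c + 1) / n ^ j % n) ∨
        c + 1 = n ^ σ.nat 6 ∧ σ'.nat 7 = 0) := by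
  unfold incrProg
  refine Runs.const_seq (Runs.const_seq ?_)
  -- Register `8` is the carry into digit `j`: it is `1` iff all lower digits overflow, that is, iff
  -- `n ^ j ∣ c + 1`. A carry out of the last digit means that the odometer is exhausted.
  refine Runs.seq (t₂ := 1) (Runs.forLt (fun j σ' => Keep 7 100 1 σ σ' ∧ σ'.nat 20 = j ∧
    (σ'.nat 8 = if n ^ j ∣ c + 1 then 1 else 0) ∧ (∀ i < j, σ'.arr 1 i = (c + 1) / n ^ i % n) ∧
    ∀ i < σ.nat 6, j ≤ i → σ'.arr 1 i = c / n ^ i % n) (σ.nat 6) 7 ?_ ?_ ?_) ?_ (by omega)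
  · rintro j σ' ⟨hk, hj, -⟩
    exact ⟨hj, hk.1 6 (by norm_num)⟩
  · rintro j σ' hjk ⟨hk, hj, h8, hlo, hhi⟩
    have e4 := (hk.1 4 (by norm_num)).trans h4
    have e5 := (hk.1 5 (by norm_num)).trans h5
    have e0 := (hk.1 0 (by norm_num)).trans h0
    have hdig := hhi j hjk le_rfl
    obtain ⟨s1, s2⟩ := digit_succ (c := c) (j := j) hn
    have hup : ∀ (τ : RamState) (v : ℕ), τ.arr 1 = Function.update (σ'.arr 1) j v →
        v = (c + 1) / n ^ j % n → (∀ i < j + 1, τ.arr 1 i = (c + 1) / n ^ i % n) ∧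
          ∀ i < σ.nat 6, j + 1 ≤ i → τ.arr 1 i = c / n ^ i % n := by
      intro τ v hτ hv
      rw [hτ]
      refine ⟨fun i hi => ?_, fun i hi hi' => ?_⟩
      · by_cases hij : i = j
        · subst hij; simp [hv]
        · rw [Function.update_of_ne hij, hlo i (by omega)]
      · rw [Function.update_of_ne (by omega), hhi i hi (by omega)]
    refine Runs.seq (t₁ := 6) (t₂ := 1) (Runs.ifLt (Q := fun σ' => Keep 7 100 1 σ σ' ∧
      σ'.nat 20 = j ∧ (σ'.nat 8 = if n ^ (j + 1) ∣ c + 1 then 1 else 0) ∧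
      (∀ i < j + 1, σ'.arr 1 i = (c + 1) / n ^ i % n) ∧
      ∀ i < σ.nat 6, j + 1 ≤ i → σ'.arr 1 i = c / n ^ i % n)
      (fun h => Runs.load_seq (Runs.add_seq (Runs.ifLt
        (fun h' => Runs.store_seq (Runs.const ⟨by simp [hk], by simp [hj], ?_, ?_⟩))
        fun h' => Runs.store ⟨by simp [hk], by simp [hj], ?_, ?_⟩)))
      fun h => Runs.skip ⟨by simp [hk], by simp [hj], ?_, ?_⟩) ?_ le_rfl
    · simp [hj, e0, e5, hdig] at h'
      have : ¬ n ^ (j + 1) ∣ c + 1 := fun hdiv => (s2.mp hdiv).2 h'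
      simp [this]
    · simp [hj, e0, e5, hdig] at h'
      rw [e4, h8] at h
      have hdvd : n ^ j ∣ c + 1 := by
        by_contra hdvd
        simp [hdvd] at h
      refine hup _ (c / n ^ j % n + 1) (by simp [hj, e5, hdig]) ?_
      rw [s1, if_pos hdvd, if_pos h']
    · simp only [hj, e0, e5, hdig, setNat_nat, if_true] at h'
      rw [e4, h8] at h
      have hdvd : n ^ j ∣ c + 1 := by
        by_contra hdvd
        simp [hdvd] at h
      have hn' : ¬ c / n ^ j % n + 1 < n := by simpa [hj, hdig, e5, e0] using h'
      simp [s2.mpr ⟨hdvd, hn'⟩, h8, hdvd]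
    · simp only [hj, e0, e5, hdig, setNat_nat, if_true] at h'
      rw [e4, h8] at h
      have hdvd : n ^ j ∣ c + 1 := by
        by_contra hdvd
        simp [hdvd] at h
      have hn' : ¬ c / n ^ j % n + 1 < n := by simpa [hj, hdig, e5, e0] using h'
      refine hup _ 0 (by simp [hj, e4]) ?_
      rw [s1, if_pos hdvd, if_neg hn']
    · rw [e4, h8] at h
      have hdvd : ¬ n ^ j ∣ c + 1 := fun hdvd => by simp [hdvd] at h
      have : ¬ n ^ (j + 1) ∣ c + 1 := fun hdiv => hdvd (s2.mp hdiv).1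
      simp [h8, hdvd, this]
    · rw [e4, h8] at h
      have hdvd : ¬ n ^ j ∣ c + 1 := fun hdvd => by simp [hdvd] at h
      refine hup _ (c / n ^ j % n) ?_ (by rw [s1, if_neg hdvd])
      rw [← hdig, Function.update_eq_self]
    · rintro τ ⟨hk, hj, h8, hlo, hhi⟩
      have e5 := (hk.1 5 (by norm_num)).trans h5
      exact Runs.add ⟨by simp [hk], by simp [hj, e5], by simpa using h8, by simpa using hlo,
        by simpa using hhi⟩
  · exact ⟨by simp [Keep.refl], by simp, by simp, by simp, by simpa using hd⟩
  · rintro τ ⟨hk, -, h8, hlo, -⟩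
    have e5 := (hk.1 5 (by norm_num)).trans h5
    refine Runs.sub ⟨by simp [hk], ?_⟩
    by_cases hov : c + 1 < n ^ σ.nat 6
    · refine Or.inl ⟨hov, ?_, by simpa using hlo⟩
      have : ¬ n ^ σ.nat 6 ∣ c + 1 := fun h => absurd (Nat.le_of_dvd (by omega) h) (by omega)
      simp [e5, h8, this]
    · have heq : c + 1 = n ^ σ.nat 6 := by omega
      refine Or.inr ⟨heq, ?_⟩
      simp [e5, h8, heq]

end Programs

/-! ### Exhaustive search through the candidate sets -/

section Grow

variable {n M : ℕ}

/-- The registers that hold the parameters of a run of the algorithm. -/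
structure IsRunState (n M u k : ℕ) (τ L : ℝ) (σ : RamState) : Prop where
  nat_zero : σ.nat 0 = n
  nat_one : σ.nat 1 = M
  nat_two : σ.nat 2 = u
  nat_four : σ.nat 4 = 0
  nat_five : σ.nat 5 = 1
  nat_six : σ.nat 6 = k
  real_zero : σ.real 0 = τ
  real_one : σ.real 1 = L

theorem IsRunState.keep {u k a b c : ℕ} {τ L : ℝ} {σ σ' : RamState} (h : IsRunState n M u k τ L σ)
    (hk : Keep a b c σ σ') (ha : 7 ≤ a) (hb : 2 ≤ b) : IsRunState n M u k τ L σ' where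
  nat_zero := (hk.1 0 (by omega)).trans h.nat_zero
  nat_one := (hk.1 1 (by omega)).trans h.nat_one
  nat_two := (hk.1 2 (by omega)).trans h.nat_two
  nat_four := (hk.1 4 (by omega)).trans h.nat_four
  nat_five := (hk.1 5 (by omega)).trans h.nat_five
  nat_six := (hk.1 6 (by omega)).trans h.nat_six
  real_zero := (hk.2.1 0 (by omega)).trans h.real_zero
  real_one := (hk.2.1 1 (by omega)).trans h.real_one

/-- The set of new sites among the first `k` digits of `c` in base `n`. -/
def candidate (k c : ℕ) (u : Fin n) (S : Finset (Fin n)) : Finset (Fin n) :=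
  {i | i ≠ u ∧ i ∉ S ∧ ∃ j < k, c / n ^ j % n = i}

theorem candidate_subset (k c : ℕ) (u : Fin n) (S : Finset (Fin n)) :
    candidate k c u S ⊆ (univ \ {u}) \ S := by
  intro i hi
  simp only [candidate, mem_filter, mem_univ, true_and] at hi
  simp [hi.1, hi.2.1]

theorem card_candidate_le (k c : ℕ) (u : Fin n) (S : Finset (Fin n)) :
    (candidate k c u S).card ≤ k := by
  have h : (candidate k c u S).image (fun i : Fin n => (i : ℕ))
      ⊆ (range k).image fun j => c / n ^ j % n := by
    intro a ha
    simp only [candidate, mem_image, mem_filter, mem_univ, true_and] at ha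
    obtain ⟨i, ⟨-, -, j, hj, h⟩, rfl⟩ := ha
    exact mem_image.2 ⟨j, mem_range.2 hj, h⟩
  rw [← card_image_of_injective _ Fin.val_injective]
  exact (card_le_card h).trans (card_image_le.trans (card_range k).le)

/-- List the elements of `I` as digits and fill the remaining places with one of them. Repeated
digits do no harm, so `n ^ k` words cover all nonempty sets of at most `k` sites. -/
theorem exists_candidate_eq {k : ℕ} {u : Fin n} {S I : Finset (Fin n)}
    (hI : I ⊆ (univ \ {u}) \ S) (hne : I.Nonempty) (hk : I.card ≤ k) :
    ∃ c < n ^ k, candidate k c u S = I := by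
  obtain ⟨a, ha⟩ := hne
  obtain ⟨c, hc, hd⟩ := exists_digits k (fun j => (I.toList.getD j a : Fin n)) fun j => Fin.isLt _
  refine ⟨c, hc, ?_⟩
  ext i
  simp only [candidate, mem_filter, mem_univ, true_and]
  constructor
  · rintro ⟨-, -, j, hj, h⟩
    rw [hd j hj] at h
    rw [← Fin.ext h]
    by_cases hjl : j < I.toList.length
    · rw [List.getD_eq_getElem _ _ hjl]
      exact mem_toList.1 (List.getElem_mem hjl)
    · rwa [List.getD_eq_default _ _ (by omega)]
  · intro hi
    have := hI hi
    simp only [mem_sdiff, mem_univ, mem_singleton, true_and] at this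
    refine ⟨this.1, this.2, ?_⟩
    obtain ⟨j, hj, h⟩ := List.getElem_of_mem (mem_toList.2 hi)
    have hjk : j < k := by
      rw [length_toList] at hj
      omega
    exact ⟨j, hjk, by rw [hd j hjk, List.getD_eq_getElem _ _ hj, h]⟩

/-- Test one candidate and either add it or pass to the next one. -/
def growBody : RamProg :=
  copyProg 0 2 ;; markProg ;; nuProg ;; .ifRealLt 0 2 (copyProg 2 0 ;; resetProg) incrProg

theorem IsInd.congr {a b : ℕ → ℕ} {A : Finset (Fin n)} (h : IsInd a A) (hab : ∀ i < n, b i = a i) :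
    IsInd b A := fun i => (hab i i.isLt).trans (h i)

theorem runs_growBody (x : Fin M → Fin n → ℤˣ) {u : Fin n} {k c : ℕ} {τ L : ℝ} {σ : RamState}
    (hσ : IsRunState n M u k τ L σ) {S : Finset (Fin n)} (hS : IsInd (σ.arr 0) S)
    (hc : c < n ^ k) (hd : ∀ j < k, σ.arr 1 j = c / n ^ j % n) :
    Runs (sampleTable x) growBody σ (M * (14 * n + 54) + 14 * n + 14 * k + 25) fun σ' =>
      IsRunState n M u k τ L σ' ∧
      (τ < nuHat x u (candidate k c u S) S ∧ IsInd (σ'.arr 0) (S ∪ candidate k c u S) ∧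
          (∀ j < k, σ'.arr 1 j = 0) ∧ σ'.nat 7 = σ.nat 7 ∨
        ¬ τ < nuHat x u (candidate k c u S) S ∧ IsInd (σ'.arr 0) S ∧
          (c + 1 < n ^ k ∧ σ'.nat 7 = 1 ∧ (∀ j < k, σ'.arr 1 j = (c + 1) / n ^ j % n) ∨
            c + 1 = n ^ k ∧ σ'.nat 7 = 0)) := by
  have hn : 0 < n := u.pos
  unfold growBody
  refine Runs.seq (t₂ := M * (14 * n + 54) + 10 * n + 14 * k + 23)
    (runs_copyProg (by norm_num) hσ.nat_five) ?_ (by rw [hσ.nat_zero]; omega)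
  rintro σ₁ ⟨k₁, a₁, h₁⟩
  have hσ₁ := hσ.keep k₁ (by norm_num) (by norm_num)
  refine Runs.seq (t₂ := M * (14 * n + 54) + 10 * n + 8 * k + 21)
    (runs_markProg hσ₁.nat_five) ?_ (by rw [hσ₁.nat_six]; omega)
  rintro σ₂ ⟨k₂, h₂⟩
  have hσ₂ := hσ₁.keep k₂ (by norm_num) (by norm_num)
  have ind₀ : IsInd (σ₂.arr 0) S := by
    rwa [k₂.2.2 0 (by norm_num), a₁ 0 (by norm_num)]
  have ind₂ : IsInd (σ₂.arr 2) (S ∪ candidate k c u S) := by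
    intro i
    rw [h₂, h₁ i (by rw [hσ.nat_zero]; exact i.isLt), hS i, hσ₁.nat_two, hσ₁.nat_six,
      a₁ 1 (by norm_num)]
    have hex : (∃ j < k, σ.arr 1 j = i) ↔ ∃ j < k, c / n ^ j % n = i :=
      exists_congr fun j => and_congr_right fun hj => by rw [hd j hj]
    simp only [hex]
    by_cases hiS : i ∈ S
    · simp [hiS]
    · simp [hiS, candidate, Fin.val_inj]
  refine Runs.seq (t₂ := 4 * n + 8 * k + 5) (runs_nuProg hσ₂.nat_four hσ₂.nat_five) ?_
    (by rw [hσ₂.nat_zero, hσ₂.nat_one]; omega)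
  rintro σ₃ ⟨k₃, h₃⟩
  have hσ₃ := hσ₂.keep k₃ (by norm_num) (by norm_num)
  have hdisj : Disjoint S (candidate k c u S) :=
    disjoint_right.2 fun i hi => (mem_sdiff.1 (candidate_subset _ _ _ _ hi)).2
  rw [hσ₂.nat_zero, hσ₂.nat_one, hσ₂.nat_two, tallyNu_eq_nuHat x u hdisj ind₀ ind₂] at h₃
  have a3 : σ₃.arr 1 = σ.arr 1 := by
    rw [k₃.2.2 1 (by norm_num), k₂.2.2 1 (by norm_num), a₁ 1 (by norm_num)]
  have n3 : σ₃.nat 7 = σ.nat 7 := by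
    rw [k₃.1 7 (by norm_num), k₂.1 7 (by norm_num), k₁.1 7 (by norm_num)]
  have ind₃ : IsInd (σ₃.arr 0) S := by rwa [k₃.2.2 0 (by norm_num)]
  have ind₃' : IsInd (σ₃.arr 2) (S ∪ candidate k c u S) := by rwa [k₃.2.2 2 (by norm_num)]
  refine Runs.ifRealLt (fun h => ?_) fun h => ?_
  · rw [hσ₃.real_zero, h₃] at h
    refine Runs.seq (t₂ := 3 * k + 2) (runs_copyProg (by norm_num) hσ₃.nat_five) ?_
      (by rw [hσ₃.nat_zero]; omega)
    rintro σ₄ ⟨k₄, a₄, h₄⟩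
    have hσ₄ := hσ₃.keep k₄ (by norm_num) (by norm_num)
    refine (runs_resetProg hσ₄.nat_four hσ₄.nat_five).mono (by rw [hσ₄.nat_six]) ?_
    rintro σ₅ ⟨k₅, h₅⟩
    rw [hσ₄.nat_six] at h₅
    refine ⟨hσ₄.keep k₅ (by norm_num) (by norm_num), Or.inl ⟨h, ?_, h₅, ?_⟩⟩
    · rw [k₅.2.2 0 (by norm_num)]
      exact ind₃'.congr (by rwa [hσ₃.nat_zero] at h₄)
    · rw [k₅.1 7 (by norm_num), k₄.1 7 (by norm_num), n3]
  · rw [hσ₃.real_zero, h₃] at h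
    refine (runs_incrProg (n := n) (c := c) hσ₃.nat_four hσ₃.nat_five hn hσ₃.nat_zero
      (by rwa [hσ₃.nat_six]) (by rwa [hσ₃.nat_six, a3])).mono (by rw [hσ₃.nat_six]; omega) ?_
    rintro σ₄ ⟨k₄, h₄⟩
    rw [hσ₃.nat_six] at h₄
    refine ⟨hσ₃.keep k₄ (by norm_num) (by norm_num), Or.inr ⟨h, ?_, h₄⟩⟩
    rwa [k₄.2.2 0 (by norm_num)]

/-- Add candidates as long as possible. -/
def growProg : RamProg := .const 7 1 ;; .whileLt 4 7 growBody

theorem nuHat_empty_le (x : Fin M → Fin n → ℤˣ) (u : Fin n) (S : Finset (Fin n)) :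
    nuHat x u ∅ S ≤ 0 := by
  rw [nuHat_eq_nu u (disjoint_empty_right S), nu_empty]

/-- `B` bounds all reachable sets, so there are at most `B` additions and at most `B + 1` searches
of `n ^ k` candidates each. The program never tests `|S| ≤ L`, as `hB` guarantees it. -/
theorem runs_growProg (x : Fin M → Fin n → ℤˣ) {u : Fin n} {s B : ℕ} {τ L : ℝ} (hM : M ≠ 0)
    (hτ : 0 ≤ τ)
    (hB : ∀ S, Relation.ReflTransGen (GrowStep s τ L x u) ∅ S → S.card ≤ B ∧ (S.card : ℝ) ≤ L)
    {σ : RamState} (hσ : IsRunState n M u (2 ^ s) τ L σ) (h0 : ∀ i, σ.arr 0 i = 0)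
    (h1 : ∀ j, σ.arr 1 j = 0) :
    Runs (sampleTable x) growProg σ
      ((B + 1) * n ^ 2 ^ s * (M * (14 * n + 54) + 14 * n + 14 * 2 ^ s + 26) + 2) fun σ' =>
      IsRunState n M u (2 ^ s) τ L σ' ∧ ∃ S, IsGrown s τ L x u S ∧ IsInd (σ'.arr 0) S := by
  have hn : 0 < n := u.pos
  set k := 2 ^ s with hk
  unfold growProg
  refine Runs.const_seq ?_
  -- The fuel `(B - |S|) * n ^ k + (n ^ k - c)` drops both when a set is added, which resets `c` to
  -- `0`, and when `c` advances. Register `7` is `1` during the search and `0` once every candidate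
  -- has failed for the current `S`.
  refine (Runs.whileLt (fun f σ' => IsRunState n M u k τ L σ' ∧ ∃ S,
    Relation.ReflTransGen (GrowStep s τ L x u) ∅ S ∧ IsInd (σ'.arr 0) S ∧
    (σ'.nat 7 = 1 ∧ (∃ c < n ^ k, (∀ j < k, σ'.arr 1 j = c / n ^ j % n) ∧
      (∀ c' < c, ¬ τ < nuHat x u (candidate k c' u S) S) ∧
      f = (B - S.card) * n ^ k + (n ^ k - c)) ∨
     σ'.nat 7 = 0 ∧ (∀ c' < n ^ k, ¬ τ < nuHat x u (candidate k c' u S) S) ∧ f = 0))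
    (M * (14 * n + 54) + 14 * n + 14 * k + 25) ?_ (f := B * n ^ k + n ^ k) ?_).mono ?_ ?_
  · rintro f σ' ⟨hσ', S, hS, hind, h⟩ hlt
    rw [hσ'.nat_four] at hlt
    obtain ⟨h7, c, hc, hd, hfail, hf⟩ := h.resolve_right fun h => by omega
    refine (runs_growBody x hσ' hind hc hd).mono le_rfl ?_
    rintro σ'' ⟨hσ'', hcase⟩
    rcases hcase with ⟨hlt', hind', hd', h7'⟩ | ⟨hnlt, hind', hcase⟩
    · have hstep : GrowStep s τ L x u S (S ∪ candidate k c u S) :=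
        ⟨(hB S hS).2, _, candidate_subset _ _ _ _, card_candidate_le _ _ _ _, hlt', rfl⟩
      have hS' := hS.tail hstep
      have hcard := (hstep.energy_le hM hτ).2.1
      have hBc := (hB _ hS').1
      refine ⟨(B - (S ∪ candidate k c u S).card) * n ^ k + (n ^ k - 0), ?_, hσ'', _, hS', hind',
        Or.inl ⟨h7'.trans h7, 0, by omega, by simpa using hd', by simp, rfl⟩⟩
      have : (B - (S ∪ candidate k c u S).card + 1) * n ^ k ≤ (B - S.card) * n ^ k :=
        Nat.mul_le_mul_right _ (by omega)
      rw [add_mul] at this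
      omega
    · have hfail' : ∀ c' < c + 1, ¬ τ < nuHat x u (candidate k c' u S) S := by
        intro c' hc'
        rcases Nat.lt_succ_iff_lt_or_eq.1 hc' with h | rfl
        · exact hfail c' h
        · exact hnlt
      rcases hcase with ⟨hc1, h7', hd'⟩ | ⟨hc1, h7'⟩
      · exact ⟨(B - S.card) * n ^ k + (n ^ k - (c + 1)), by omega, hσ'', S, hS, hind',
          Or.inl ⟨h7', c + 1, hc1, hd', hfail', rfl⟩⟩
      · exact ⟨0, by omega, hσ'', S, hS, hind', Or.inr ⟨h7', by rwa [← hc1], rfl⟩⟩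
  · refine ⟨⟨by simp [hσ.nat_zero], by simp [hσ.nat_one], by simp [hσ.nat_two],
      by simp [hσ.nat_four], by simp [hσ.nat_five], by simp [hσ.nat_six], by simp [hσ.real_zero],
      by simp [hσ.real_one]⟩, ∅, .refl, fun i => by simp [h0], Or.inl ⟨by simp, 0, by positivity,
      by simp [h1], by simp, by simp⟩⟩
  · exact le_of_eq (by ring)
  · rintro σ' ⟨⟨f, hσ', S, hS, hind, h⟩, hnlt⟩
    rw [hσ'.nat_four] at hnlt
    obtain ⟨-, hfail, -⟩ := h.resolve_left fun h => by omega
    refine ⟨hσ', S, ⟨hS, ?_⟩, hind⟩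
    rintro S' ⟨-, I, hI, hIk, hlt, -⟩
    -- The empty set needs no candidate: its proxy is at most `0`, so it never passes the strict
    -- test with `τ ≥ 0`.
    rcases I.eq_empty_or_nonempty with rfl | hne
    · exact absurd hlt (not_lt.2 ((nuHat_empty_le x u S).trans hτ))
    · obtain ⟨c, hc, rfl⟩ := exists_candidate_eq hI hne hIk
      exact hfail c hc hlt

end Grow

/-! ### The pruning loop, the whole program and its running time -/

section Prune

variable {n M : ℕ}

/-- Go once through all sites of the set and remove those that fail the test. -/
def pruneProg : RamProg :=
  .const 10 0 ;; .whileLt 10 0 (.load 31 0 10 ;;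
    .ifLt 4 31 (copyProg 0 2 ;; .store 0 10 4 ;; nuProg ;; .ifRealLt 2 0 .skip (.store 0 10 5))
      .skip ;; .add 10 10 5)

/-- The pruning steps at the sites of `S` below `j`, in increasing order. -/
noncomputable def pruned (τ : ℝ) (x : Fin M → Fin n → ℤˣ) (u : Fin n) (S : Finset (Fin n))
    (j : ℕ) : Finset (Fin n) :=
  (((List.finRange n).take j).filter (· ∈ S)).foldl (pruneStep τ x u) S

theorem pruned_succ (τ : ℝ) (x : Fin M → Fin n → ℤˣ) (u : Fin n) (S : Finset (Fin n))
    (j : Fin n) : pruned τ x u S (j + 1)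
      = if j ∈ S then pruneStep τ x u (pruned τ x u S j) j else pruned τ x u S j := by
  have hlen : (j : ℕ) < (List.finRange n).length := by simp
  unfold pruned
  rw [List.take_succ_eq_append_getElem hlen, List.filter_append, List.foldl_append]
  have : (List.finRange n)[(j : ℕ)] = j := by simp
  rw [this]
  by_cases hj : j ∈ S <;> simp [hj]

theorem IsInd.erase {a : ℕ → ℕ} {T : Finset (Fin n)} (h : IsInd a T) (j : Fin n) :
    IsInd (Function.update a j 0) (T \ {j}) := by
  intro i
  by_cases hij : i = j
  · subst hij; simp
  · have : (i : ℕ) ≠ j := fun h => hij (Fin.ext h)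
    simp [Function.update_of_ne this, h i, hij]

theorem IsInd.restore {a : ℕ → ℕ} {T : Finset (Fin n)} {j : Fin n} (h : IsInd a (T \ {j}))
    (hj : j ∈ T) : IsInd (Function.update a j 1) T := by
  intro i
  by_cases hij : i = j
  · subst hij; simp [hj]
  · have : (i : ℕ) ≠ j := fun h => hij (Fin.ext h)
    simp [Function.update_of_ne this, h i, hij]

/-- Site `j` is first erased from array `0`, with a copy of the old set in array `2`, which is the
configuration that `nuProg` expects for `I = {j}`. The site is written back if it passes the test.
-/
theorem runs_pruneProg (x : Fin M → Fin n → ℤˣ) {u : Fin n} {k : ℕ} {τ L : ℝ} {σ : RamState}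
    (hσ : IsRunState n M u k τ L σ) {S : Finset (Fin n)} (hS : IsInd (σ.arr 0) S) :
    Runs (sampleTable x) pruneProg σ (n * (M * (14 * n + 54) + 10 * n + 25) + 2) fun σ' =>
      IsInd (σ'.arr 0) (pruned τ x u S n) := by
  unfold pruneProg
  refine Runs.const_seq ?_
  -- The last clause says that sites not yet visited are untouched. Hence testing membership in the
  -- current set agrees with testing membership in the grown set `S`.
  refine (Runs.forLt (fun j σ' => IsRunState n M u k τ L σ' ∧ σ'.nat 10 = j ∧
    IsInd (σ'.arr 0) (pruned τ x u S j) ∧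
    ∀ i : Fin n, j ≤ (i : ℕ) → (i ∈ pruned τ x u S j ↔ i ∈ S))
    n (M * (14 * n + 54) + 10 * n + 24) ?_ ?_ ?_).mono (by simp) ?_
  · rintro j σ' ⟨hσ', hj, -⟩
    exact ⟨hj, hσ'.nat_zero⟩
  · rintro j₀ σ₁ hj₀ ⟨hσ₁, h10, hT, htail⟩
    obtain ⟨j, rfl⟩ : ∃ j : Fin n, (j : ℕ) = j₀ := ⟨⟨j₀, hj₀⟩, rfl⟩
    have hjT := htail j le_rfl
    have htail' : ∀ i : Fin n, (j : ℕ) + 1 ≤ i → (i ∈ pruned τ x u S (j + 1) ↔ i ∈ S) := by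
      intro i hi
      rw [← htail i (by omega), pruned_succ]
      have hij : i ≠ j := by rintro rfl; omega
      unfold pruneStep
      split_ifs <;> simp [hij]
    set T := pruned τ x u S j with hTdef
    refine Runs.load_seq ?_
    set σ₂ := σ₁.setNat 31 (σ₁.arr 0 (σ₁.nat 10)) with hσ₂def
    have kp : Keep 20 100 100 σ₁ σ₂ := by simp [hσ₂def, Keep.refl]
    have hσ₂ := hσ₁.keep kp (by norm_num) (by norm_num)
    have h31 : σ₂.nat 31 = if j ∈ S then 1 else 0 := by
      simp [hσ₂def, h10, hT j, hjT]
    have g10 : σ₂.nat 10 = j := (kp.1 10 (by norm_num)).trans h10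
    have hT₂ : IsInd (σ₂.arr 0) T := hT
    refine Runs.seq (t₁ := M * (14 * n + 54) + 10 * n + 22) (t₂ := 1)
      (Q := fun σ' => IsRunState n M u k τ L σ' ∧ σ'.nat 10 = j ∧
        IsInd (σ'.arr 0) (pruned τ x u S (j + 1))) (Runs.ifLt (fun h => ?_) fun h => ?_) ?_
      (by omega)
    · have hjS : j ∈ S := by
        by_contra hjS
        simp [h31, hjS] at h
      refine Runs.seq (t₂ := M * (14 * n + 54) + 6 * n + 19)
        (runs_copyProg (by norm_num) hσ₂.nat_five) ?_ (by rw [hσ₂.nat_zero]; omega)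
      rintro σ₃ ⟨k₃, a₃, h₃⟩
      have hσ₃ := hσ₂.keep k₃ (by norm_num) (by norm_num)
      have f10 : σ₃.nat 10 = j := (k₃.1 10 (by norm_num)).trans g10
      refine Runs.store_seq ?_
      set σ₄ := σ₃.setArr 0 (σ₃.nat 10) (σ₃.nat 4) with hσ₄def
      have k₄ : Keep 20 100 0 σ₃ σ₄ := by simp [hσ₄def, Keep.refl]
      have hσ₄ := hσ₃.keep k₄ (by norm_num) (by norm_num)
      have i₀ : IsInd (σ₄.arr 0) (T \ {j}) := by
        have : σ₄.arr 0 = Function.update (σ₂.arr 0) j 0 := by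
          simp [hσ₄def, f10, hσ₃.nat_four, a₃ 0 (by norm_num)]
        rw [this]
        exact hT₂.erase j
      have i₂ : IsInd (σ₄.arr 2) (T \ {j} ∪ {j}) := by
        have : σ₄.arr 2 = σ₃.arr 2 := by simp [hσ₄def]
        rw [this, sdiff_union_of_subset (singleton_subset_iff.2 (hjT.2 hjS))]
        exact hT₂.congr (by rwa [hσ₂.nat_zero] at h₃)
      refine Runs.seq (t₂ := 2) (runs_nuProg hσ₄.nat_four hσ₄.nat_five) ?_
        (by rw [hσ₄.nat_zero, hσ₄.nat_one])
      rintro σ₅ ⟨k₅, h₅⟩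
      rw [hσ₄.nat_zero, hσ₄.nat_one, hσ₄.nat_two,
        tallyNu_eq_nuHat x u sdiff_disjoint i₀ i₂] at h₅
      have hσ₅ := hσ₄.keep k₅ (by norm_num) (by norm_num)
      have e10 : σ₅.nat 10 = j := ((k₅.1 10 (by norm_num)).trans (k₄.1 10 (by norm_num))).trans f10
      have i₅ : IsInd (σ₅.arr 0) (T \ {j}) := by rwa [k₅.2.2 0 (by norm_num)]
      rw [pruned_succ, if_pos hjS, ← hTdef, pruneStep]
      refine Runs.ifRealLt (fun h => Runs.skip ?_) fun h => Runs.store ?_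
      · rw [h₅, hσ₅.real_zero] at h
        rw [if_pos h]
        exact ⟨hσ₅, e10, i₅⟩
      · rw [h₅, hσ₅.real_zero] at h
        rw [if_neg h]
        refine ⟨hσ₅.keep (a := 20) (b := 100) (c := 0) (by simp [Keep.refl]) (by norm_num)
          (by norm_num), by simp [e10], ?_⟩
        have := i₅.restore (hjT.2 hjS)
        simpa [e10, hσ₅.nat_five] using this
    · have hjS : j ∉ S := by
        intro hjS
        simp [h31, hjS, hσ₂.nat_four] at h
      rw [pruned_succ, if_neg hjS]
      exact Runs.skip ⟨hσ₂, g10, hT₂⟩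
    · rintro σ₃ ⟨hσ₃, h10, hind⟩
      refine Runs.add ⟨hσ₃.keep (a := 10) (b := 100) (c := 100) (by simp [Keep.refl]) (by norm_num)
        (by norm_num), by simp [h10, hσ₃.nat_five], hind, htail'⟩
  · refine ⟨hσ.keep (a := 10) (b := 100) (c := 100) (by simp [Keep.refl]) (by norm_num)
      (by norm_num), by simp, by simpa [pruned] using hS, by simp [pruned]⟩
  · rintro σ' ⟨-, -, h, -⟩
    exact h

theorem IsGrown.isOutput_pruned {s : ℕ} {τ L : ℝ} {x : Fin M → Fin n → ℤˣ} {u : Fin n}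
    {S : Finset (Fin n)} (h : IsGrown s τ L x u S) : IsOutput s τ L x u (pruned τ x u S n) := by
  refine ⟨S, h, (List.finRange n).filter (· ∈ S), (List.nodup_finRange n).filter _, ?_, ?_⟩
  · ext i; simp
  · rw [pruned, List.take_of_length_le (by simp)]

theorem ramOutput_eq {σ : RamState} {T : Finset (Fin n)} (h : IsInd (σ.arr 0) T) :
    ramOutput n σ = T := by
  ext i
  by_cases hi : i ∈ T <;> simp [ramOutput, h i, hi]

/-- The whole algorithm. -/
def mainProg : RamProg :=
  .const 4 0 ;; .const 5 1 ;; .const 6 1 ;; .const 20 0 ;;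
    .whileLt 20 3 (.add 6 6 6 ;; .add 20 20 5) ;; growProg ;; pruneProg

theorem runs_mainProg (x : Fin M → Fin n → ℤˣ) (u : Fin n) {s B : ℕ} {τ L : ℝ} (hM : M ≠ 0)
    (hτ : 0 ≤ τ)
    (hB : ∀ S, Relation.ReflTransGen (GrowStep s τ L x u) ∅ S → S.card ≤ B ∧ (S.card : ℝ) ≤ L) :
    Runs (sampleTable x) mainProg (ramInput n M u s τ L)
      ((B + 1) * n ^ 2 ^ s * (M * (14 * n + 54) + 14 * n + 14 * 2 ^ s + 26)
        + n * (M * (14 * n + 54) + 10 * n + 25) + 3 * s + 9)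
      fun σ => IsOutput s τ L x u (ramOutput n σ) := by
  unfold mainProg
  refine Runs.const_seq (Runs.const_seq (Runs.const_seq (Runs.const_seq ?_)))
  refine Runs.seq (t₁ := s * (2 + 1) + 1) (Runs.forLt (fun j σ => IsRunState n M u (2 ^ j) τ L σ ∧
    σ.nat 3 = s ∧ σ.nat 20 = j ∧ ∀ p i, σ.arr p i = 0) s 2 ?_ ?_ ?_)
    (t₂ := (B + 1) * n ^ 2 ^ s * (M * (14 * n + 54) + 14 * n + 14 * 2 ^ s + 26) + 2
      + (n * (M * (14 * n + 54) + 10 * n + 25) + 2)) ?_ (by omega)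
  · rintro j σ ⟨-, h3, h20, -⟩
    exact ⟨h20, h3⟩
  · rintro j σ - ⟨hσ, h3, h20, ha⟩
    refine Runs.add_seq (Runs.add ⟨⟨?_, ?_, ?_, ?_, ?_, ?_, ?_, ?_⟩, ?_, ?_, ?_⟩)
    all_goals simp [hσ.nat_zero, hσ.nat_one, hσ.nat_two, hσ.nat_four, hσ.nat_five, hσ.nat_six,
      hσ.real_zero, hσ.real_one, h3, h20, ha, pow_succ, mul_two]
  · refine ⟨⟨?_, ?_, ?_, ?_, ?_, ?_, ?_, ?_⟩, ?_, ?_, ?_⟩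
    all_goals simp [ramInput]
  · rintro σ ⟨hσ, -, -, ha⟩
    refine Runs.seq (runs_growProg x hM hτ hB hσ (ha 0) (ha 1)) ?_ le_rfl
    rintro σ₁ ⟨hσ₁, S, hS, hind⟩
    refine (runs_pruneProg x hσ₁ hind).mono le_rfl fun σ₂ h => ?_
    rw [ramOutput_eq h]
    exact hS.isOutput_pruned

end Prune

/-- Both bounds on `B` matter: `B + 1 ≤ L` for the part of a pass proportional to `M n`, and `B + 1
≤ 2 M n` for the part proportional to `k`, where `k ≤ L` supplies the factor `L`. -/
theorem runtime_le {B k n M s : ℕ} {L : ℝ} (hn : 1 ≤ n) (hM : 1 ≤ M) (hk : 1 ≤ k) (hkL : (k : ℝ) ≤ L)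
    (hsk : s ≤ k) (hBn : B ≤ n) (hBL : (B : ℝ) ≤ L / 32) (hL : 128 ≤ L) :
    (((B + 1) * n ^ k * (M * (14 * n + 54) + 14 * n + 14 * k + 26)
      + n * (M * (14 * n + 54) + 10 * n + 25) + 3 * s + 9 : ℕ) : ℝ)
      ≤ 300 * (M * L * (n : ℝ) ^ (k + 1)) := by
  have hn' : (1 : ℝ) ≤ n := by exact_mod_cast hn
  have hM' : (1 : ℝ) ≤ M := by exact_mod_cast hM
  have hBn' : (B : ℝ) ≤ n := by exact_mod_cast hBn
  have hsk' : (s : ℝ) ≤ k := by exact_mod_cast hsk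
  have hN : (n : ℝ) ≤ (n : ℝ) ^ k := le_self_pow₀ hn' (by omega)
  push_cast
  rw [pow_succ]
  set N : ℝ := (n : ℝ) ^ k
  have hMn : (n : ℝ) ≤ M * n := le_mul_of_one_le_left (by linarith) hM'
  have hMM : (M : ℝ) ≤ M * n := le_mul_of_one_le_right (by linarith) hn'
  have h1 : ((B : ℝ) + 1) * N * (M * (14 * n + 54) + 14 * n + 26) ≤ L * N * (108 * (M * n)) := by
    gcongr
    · linarith
    · nlinarith
  have h2 : ((B : ℝ) + 1) * k * N ≤ (2 * (M * n)) * L * N := by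
    gcongr
    linarith
  have h3 : (n : ℝ) * (M * (14 * n + 54) + 10 * n + 25) ≤ N * (103 * (M * n)) := by
    gcongr
    nlinarith
  have h4 : N * (M * n) ≤ L * (N * (M * n)) :=
    le_mul_of_one_le_left (by positivity) (by linarith)
  have h5 : L ≤ L * (N * (M * n)) := le_mul_of_one_le_right (by linarith)
    (one_le_mul_of_one_le_of_one_le (hn'.trans hN) (hn'.trans hMn))
  nlinarith

theorem theorem3p3 :
    ∃ (P : RamProg) (C : ℝ), ∀ (n m : ℕ) (R : RBM n m),
      -- the denominators in the definition of `tau` and `tau'` do not vanish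
      0 < R.latentDegree → 0 < R.width → R.latentDegree ≤ R.maxDegree + 1 →
      -- recovery of all neighbourhoods, by every execution of the algorithm
      (∀ (ω : ℝ) (M : ℕ), 0 < ω → R.sampleBound ω ≤ M →
        1 - ω ≤ R.sampleProb M fun x => ∀ (u : Fin n) (T : Finset (Fin n)),
          IsOutput R.latentCount R.tau' R.L x u T ↔ T = R.nbhd u) ∧
      -- running time: `P` carries out the algorithm within the stated number of steps
      (∀ (M : ℕ) (x : Fin M → Fin n → ℤˣ) (u : Fin n), 1 ≤ M →
        ∃ (σ : RamState) (t : ℕ),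
          RamExec (sampleTable x) P (ramInput n M u R.latentCount R.tau' R.L) σ t ∧
          (t : ℝ) ≤ C * (M * R.L * (n : ℝ) ^ (2 ^ R.latentCount + 1)) ∧
          IsOutput R.latentCount R.tau' R.L x u (ramOutput n σ)) := by
  refine ⟨mainProg, 300, fun n m R hd hγ hD => ⟨fun ω M hω hM =>
    R.sampleProb_ge hd hγ hD hω hM, fun M x u hM => ?_⟩⟩
  have hτ := R.tau'_pos hd hγ hD
  have hL := R.L_ge_128 hd hγ hD
  have hcard : ∀ S, Relation.ReflTransGen (GrowStep R.latentCount R.tau' R.L x u) ∅ S →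
      (S.card : ℝ) ≤ R.L / 32 := fun S h => card_le_of_reachable (by omega) hτ h
  -- A reachable set has at most `n` sites trivially and at most `L / 32` by the energy argument;
  -- the running time estimate needs both.
  obtain ⟨σ, t, hrun, ht, hout⟩ := runs_mainProg x u (B := min n ⌊R.L / 32⌋₊) (M := M) (by omega)
    hτ.le fun S hS => ⟨le_min ((card_le_univ S).trans_eq (Fintype.card_fin n))
      (Nat.le_floor (hcard S hS)), (hcard S hS).trans (by linarith)⟩
  refine ⟨σ, t, hrun, (Nat.cast_le.2 ht).trans (runtime_le u.pos hM Nat.one_le_two_pow ?_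
    Nat.lt_two_pow_self.le (min_le_left _ _) ?_ hL), hout⟩
  · exact_mod_cast R.two_pow_le_L hd hγ hD
  · exact (Nat.cast_le.2 (min_le_right _ _)).trans (Nat.floor_le (by linarith))
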